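/- An ADHZ market consists of $n\ge 1$ agents and $n$ goods, utilities $u_{ij}\ge 0$ and an endowment matrix $e=(e_{ij})$ that is a fractional perfect matching, i.e. $e\ge 0$, $\sum_j e_{ij}=1$ for every agent $i$ and $\sum_i e_{ij}=1$ for every good $j$; all $u_{ij}$ and $e_{ij}$ are rational. The utilities are *bi-valued* if for every agent $i$ there are numbers $0\le a_i<b_i$ with $u_{ij}\in\{a_i,b_i\}$ for all $j$ (*dichotomous* utilities are the case $a_i=0$, $b_i=1$). For a budget vector $b$, a *Hylland–Zeckhauser (HZ) equilibrium* is a pair $(x,p)$ of a fractional perfect matching $x$ and prices $p\ge 0$ such that every agent $i$ satisfies $\sum_j p_jx_{ij}\le b_i$, $$\sum_j u_{ij}x_{ij}=\max\Big\{\sum_j u_{ij}y_j : y\ge 0,\ \sum_j y_j=1,\ \sum_j p_jy_j\le b_i\Big\}$$ and $$\sum_j p_jx_{ij}=\min\Big\{\sum_j p_jy_j : y\ge 0,\ \sum_j y_j=1,\ \sum_j u_{ij}y_j\ge\sum_j u_{ij}x_{ij}\Big\}.$$ An *$\epsilon$-approximate ADHZ equilibrium* is an HZ equilibrium $(x,p)$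 for some budget vector $b$ with $(1-\epsilon)\sum_j p_je_{ij}\le b_i\le \epsilon+\sum_j p_je_{ij}$ for all $i$, and with $b_i=b_{i'}$ whenever agents $i,i'$ have the same endowment. **Theorem.** There is a fully polynomial time approximation scheme that, given an ADHZ market with bi-valued (in particular, dichotomous) utilities and a rational $\epsilon\in(0,1)$, computes an $\epsilon$-approximate ADHZ equilibrium. More precisely, there is one program for a random access machine over the natural and the rational numbers that, on every such input, halts and outputs a rational $\epsilon$-approximate ADHZ equilibrium $(x,p)$; the number of elementary operations it performs (arithmetic, comparisons, memory accesses) is bounded by a polynomial in $n$ and $1/\epsilon$ alone, and its running time under logarithmic (bit) cost is bounded by a polynomial in $n$, $1/\epsilon$ and the binary length of the input. Moreover, the output is $(x,p)=(x^{(K)},p^{(K)})$ for some $K=O\big(\tfrac n\epsilon(1+\log\tfrac n\epsilon)\big)$ and some sequence $(x^{(k)},p^{(k)})_{0\le k\le K}$ with $p^{(k)}\le p^{(k+1)}$, in which $(x^{(k)},p^{(k)})$ is an HZ equilibrium for the budgets $b^{(k)}$ given by $b^{(0)}_i=\tfrac\epsilon2$ and $b^{(k+1)}_i=\tfrac\epsilon2+(1-\tfrac\epsilon2)\sum_j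 p^{(k)}_je_{ij}$, and $(x,p)$ is an $\epsilon$-approximate ADHZ equilibrium with budget vector $b^{(K)}$. -/

import Mathlib

namespace ADHZ

/-! ### Hylland-Zeckhauser equilibria and approximate ADHZ equilibria -/

section Economics

variable {A G : Type*} [Fintype A] [Fintype G]

/-- A bundle: a non-negative vector of probability shares that sum to one. -/
def IsBundle (y : G → ℝ) : Prop :=
  (∀ j, 0 ≤ y j) ∧ ∑ j, y j = 1

/-- A fractional perfect matching of agents to goods. -/
def IsFractionalPerfectMatching (x : A → G → ℝ) : Prop :=
  (∀ i j, 0 ≤ x i j) ∧ (∀ i, ∑ j, x i j = 1) ∧ (∀ j, ∑ i, x i j = 1)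

/-- `x` is an optimal bundle, i.e. a cheapest utility-maximizing bundle, for an agent with
utilities `v` and budget `β` at the prices `p`. -/
def IsOptimalBundle (v p : G → ℝ) (β : ℝ) (x : G → ℝ) : Prop :=
  IsGreatest {w : ℝ | ∃ y : G → ℝ, IsBundle y ∧ ∑ j, p j * y j ≤ β ∧ w = ∑ j, v j * y j}
      (∑ j, v j * x j) ∧
    IsLeast {c : ℝ | ∃ y : G → ℝ, IsBundle y ∧ ∑ j, v j * x j ≤ ∑ j, v j * y j ∧
        c = ∑ j, p j * y j}
      (∑ j, p j * x j)

/-- `(x, p)` is a Hylland-Zeckhauser equilibrium for the utilities `u` and the budgets `b`. -/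
structure IsHZEquilibrium (u : A → G → ℝ) (b : A → ℝ) (x : A → G → ℝ) (p : G → ℝ) : Prop where
  price_nonneg : ∀ j, 0 ≤ p j
  matching : IsFractionalPerfectMatching x
  within_budget : ∀ i, ∑ j, p j * x i j ≤ b i
  optimal : ∀ i, IsOptimalBundle (u i) p (b i) (x i)

/-- `(x, p)` is an `ε`-approximate ADHZ equilibrium for the utilities `u` and the endowments `e`,
with budget vector `b`. -/
structure IsApproxEquilibriumWith (ε : ℝ) (u e : A → G → ℝ) (b : A → ℝ)
    (x : A → G → ℝ) (p : G → ℝ) : Prop where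
  hz : IsHZEquilibrium u b x p
  budget_lower : ∀ i, (1 - ε) * ∑ j, p j * e i j ≤ b i
  budget_upper : ∀ i, b i ≤ ε + ∑ j, p j * e i j
  budget_equal : ∀ i i', e i = e i' → b i = b i'

/-- `(x, p)` is an `ε`-approximate ADHZ equilibrium. -/
def IsApproxEquilibrium (ε : ℝ) (u e : A → G → ℝ) (x : A → G → ℝ) (p : G → ℝ) : Prop :=
  ∃ b : A → ℝ, IsApproxEquilibriumWith ε u e b x p

/-- The budgets used in each round, given the prices of all rounds: `ε / 2` in round `0`, and
`ε / 2 + (1 - ε / 2) * (value of the endowment at the prices of round k)` in round `k + 1`. -/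
noncomputable def roundBudget (ε : ℝ) (e : A → G → ℝ) (p : ℕ → G → ℝ) : ℕ → A → ℝ
  | 0 => fun _ => ε / 2
  | k + 1 => fun i => ε / 2 + (1 - ε / 2) * ∑ j, p k j * e i j

/-- `(x k, p k)`, `k = 0, …, K`, are HZ equilibria for the budgets of the rounds `0, …, K`, and
the prices never decrease from one round to the next. -/
def IsPriceRaisingRun (ε : ℝ) (u e : A → G → ℝ) (K : ℕ) (x : ℕ → A → G → ℝ)
    (p : ℕ → G → ℝ) : Prop :=
  (∀ k ≤ K, IsHZEquilibrium u (roundBudget ε e p k) (x k) (p k)) ∧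
    ∀ k < K, ∀ j, p k j ≤ p (k + 1) j

end Economics

/-! ### A random access machine with natural-number and rational registers

Programs are finite, and one program has to serve all instances.  The memory consists of
natural-number arrays (for counting and addressing) and of rational arrays, numbered by ℕ; all
cells that hold no input are `0` at the start.  Two running times are recorded: the uniform cost
(every elementary operation costs `1`) and the logarithmic cost (every elementary operation also
costs the number of bits of the number that it reads or produces). -/

structure State where
  nat : ℕ → ℕ → ℕ
  rat : ℕ → ℕ → ℚ

def State.setNat (s : State) (a k v : ℕ) : State :=
  { s with nat := Function.update s.nat a (Function.update (s.nat a) k v) }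

def State.setRat (s : State) (a k : ℕ) (v : ℚ) : State :=
  { s with rat := Function.update s.rat a (Function.update (s.rat a) k v) }

/-- Encoding length of a natural number (its number of binary digits, plus one). -/
def natBits (k : ℕ) : ℕ := Nat.size k + 1

/-- Encoding length of a rational number in lowest terms (numerator, denominator and sign). -/
def ratBits (q : ℚ) : ℕ := Nat.size q.num.natAbs + Nat.size q.den + 1

/-- Natural-number expressions; `get a i` reads cell `i` of the natural-number array `a`, and
`sub` is truncated subtraction. -/
inductive NExp where
  | const (k : ℕ)
  | get (a : ℕ) (i : NExp)
  | add (l r : NExp)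
  | sub (l r : NExp)
  | mul (l r : NExp)

def NExp.eval (s : State) : NExp → ℕ
  | .const k => k
  | .get a i => s.nat a (i.eval s)
  | .add l r => l.eval s + r.eval s
  | .sub l r => l.eval s - r.eval s
  | .mul l r => l.eval s * r.eval s

/-- Uniform cost. -/
def NExp.steps : NExp → ℕ
  | .const _ => 1
  | .get _ i => i.steps + 1
  | .add l r => l.steps + r.steps + 1
  | .sub l r => l.steps + r.steps + 1
  | .mul l r => l.steps + r.steps + 1

/-- Logarithmic cost. -/
def NExp.bits (s : State) : NExp → ℕ
  | .const k => natBits k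
  | .get a i => i.bits s + natBits (s.nat a (i.eval s))
  | .add l r => l.bits s + r.bits s + natBits (l.eval s + r.eval s)
  | .sub l r => l.bits s + r.bits s + natBits (l.eval s - r.eval s)
  | .mul l r => l.bits s + r.bits s + natBits (l.eval s * r.eval s)

/-- Rational expressions; `get a i` reads cell `i` of the rational array `a`. -/
inductive QExp where
  | const (q : ℚ)
  | ofNat (i : NExp)
  | get (a : ℕ) (i : NExp)
  | add (l r : QExp)
  | sub (l r : QExp)
  | mul (l r : QExp)
  | div (l r : QExp)

def QExp.eval (s : State) : QExp → ℚ
  | .const q => q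
  | .ofNat i => (i.eval s : ℚ)
  | .get a i => s.rat a (i.eval s)
  | .add l r => l.eval s + r.eval s
  | .sub l r => l.eval s - r.eval s
  | .mul l r => l.eval s * r.eval s
  | .div l r => l.eval s / r.eval s

/-- Uniform cost. -/
def QExp.steps : QExp → ℕ
  | .const _ => 1
  | .ofNat i => i.steps + 1
  | .get _ i => i.steps + 1
  | .add l r => l.steps + r.steps + 1
  | .sub l r => l.steps + r.steps + 1
  | .mul l r => l.steps + r.steps + 1
  | .div l r => l.steps + r.steps + 1

/-- Logarithmic cost. -/
def QExp.bits (s : State) : QExp → ℕ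
  | .const q => ratBits q
  | .ofNat i => i.bits s + ratBits (i.eval s : ℚ)
  | .get a i => i.bits s + ratBits (s.rat a (i.eval s))
  | .add l r => l.bits s + r.bits s + ratBits (l.eval s + r.eval s)
  | .sub l r => l.bits s + r.bits s + ratBits (l.eval s - r.eval s)
  | .mul l r => l.bits s + r.bits s + ratBits (l.eval s * r.eval s)
  | .div l r => l.bits s + r.bits s + ratBits (l.eval s / r.eval s)

/-- Tests: comparisons and their Boolean combinations. -/
inductive Test where
  | natLE (l r : NExp)
  | ratLE (l r : QExp)
  | neg (c : Test)
  | both (c d : Test)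

def Test.holds (s : State) : Test → Prop
  | .natLE l r => l.eval s ≤ r.eval s
  | .ratLE l r => l.eval s ≤ r.eval s
  | .neg c => ¬ c.holds s
  | .both c d => c.holds s ∧ d.holds s

/-- Uniform cost. -/
def Test.steps : Test → ℕ
  | .natLE l r => l.steps + r.steps + 1
  | .ratLE l r => l.steps + r.steps + 1
  | .neg c => c.steps + 1
  | .both c d => c.steps + d.steps + 1

/-- Logarithmic cost. -/
def Test.bits (s : State) : Test → ℕ
  | .natLE l r => l.bits s + r.bits s + 1
  | .ratLE l r => l.bits s + r.bits s + 1
  | .neg c => c.bits s + 1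
  | .both c d => c.bits s + d.bits s + 1

/-- Programs. -/
inductive Program where
  | skip
  | setNat (a : ℕ) (i e : NExp)
  | setRat (a : ℕ) (i : NExp) (e : QExp)
  | seq (P Q : Program)
  | cond (c : Test) (P Q : Program)
  | loop (c : Test) (P : Program)

/-- `Exec P s s' t w`: started in `s`, the program `P` halts in the state `s'`, with total uniform
cost `t` and total logarithmic cost `w`. -/
inductive Exec : Program → State → State → ℕ → ℕ → Prop where
  | skip (s : State) : Exec .skip s s 1 1
  | setNat (s : State) (a : ℕ) (i e : NExp) :
      Exec (.setNat a i e) s (s.setNat a (i.eval s) (e.eval s))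
        (i.steps + e.steps + 1) (i.bits s + e.bits s + 1)
  | setRat (s : State) (a : ℕ) (i : NExp) (e : QExp) :
      Exec (.setRat a i e) s (s.setRat a (i.eval s) (e.eval s))
        (i.steps + e.steps + 1) (i.bits s + e.bits s + 1)
  | seq {P Q : Program} {s s' s'' : State} {t t' w w' : ℕ} :
      Exec P s s' t w → Exec Q s' s'' t' w' → Exec (.seq P Q) s s'' (t + t') (w + w')
  | condTrue {c : Test} {P Q : Program} {s s' : State} {t w : ℕ} :
      c.holds s → Exec P s s' t w → Exec (.cond c P Q) s s' (c.steps + t) (c.bits s + w)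
  | condFalse {c : Test} {P Q : Program} {s s' : State} {t w : ℕ} :
      ¬ c.holds s → Exec Q s s' t w → Exec (.cond c P Q) s s' (c.steps + t) (c.bits s + w)
  | loopDone {c : Test} {P : Program} {s : State} :
      ¬ c.holds s → Exec (.loop c P) s s c.steps (c.bits s)
  | loopStep {c : Test} {P : Program} {s s' s'' : State} {t t' w w' : ℕ} :
      c.holds s → Exec P s s' t w → Exec (.loop c P) s' s'' t' w' →
        Exec (.loop c P) s s'' (c.steps + t + t') (c.bits s + w + w')

/-! ### Problem instances and their encoding -/

/-- An ADHZ market with `n` agents and `n` goods and rational data. -/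
structure Market (n : ℕ) where
  u : Fin n → Fin n → ℚ
  e : Fin n → Fin n → ℚ
  u_nonneg : ∀ i j, 0 ≤ u i j
  e_nonneg : ∀ i j, 0 ≤ e i j
  e_row : ∀ i, ∑ j, e i j = 1
  e_col : ∀ j, ∑ i, e i j = 1

namespace Market

variable {n : ℕ} (M : Market n)

/-- Bi-valued utilities: the utilities of each agent come from a set of two values, which may
differ between agents.  Dichotomous utilities are the case of the values `0` and `1`. -/
def IsBivalued : Prop :=
  ∀ i, ∃ lo hi : ℚ, 0 ≤ lo ∧ lo < hi ∧ ∀ j, M.u i j = lo ∨ M.u i j = hi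

/-- The utilities as real numbers. -/
def utility : Fin n → Fin n → ℝ := fun i j => (M.u i j : ℝ)

/-- The endowments as real numbers. -/
def endowment : Fin n → Fin n → ℝ := fun i j => (M.e i j : ℝ)

/-- The number of bits of the input. -/
def inputBits (ε : ℚ) : ℕ :=
  natBits n + ratBits ε + ∑ i, ∑ j, (ratBits (M.u i j) + ratBits (M.e i j))

/-- The contents of a rational array that stores an `n × n` matrix row by row. -/
def rowMajor (m : Fin n → Fin n → ℚ) (k : ℕ) : ℚ :=
  if h : k < n * n then m (Fin.divNat ⟨k, h⟩) (Fin.modNat ⟨k, h⟩) else 0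

/-- The input: `n` in natural-number array `0`; `ε`, the utilities and the endowments in the
rational arrays `0`, `1`, `2`. -/
def initialState (ε : ℚ) : State where
  nat a k := if a = 0 ∧ k = 0 then n else 0
  rat a k :=
    if a = 0 ∧ k = 0 then ε
    else if a = 1 then rowMajor M.u k
    else if a = 2 then rowMajor M.e k
    else 0

end Market

/-- The output allocation, read row by row from the rational array `3`. -/
def outputAllocation (n : ℕ) (s : State) : Fin n → Fin n → ℝ :=
  fun i j => (s.rat 3 ((i : ℕ) * n + j) : ℝ)

/-- The output prices, read from the rational array `4`. -/
def outputPrices (n : ℕ) (s : State) : Fin n → ℝ :=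
  fun j => (s.rat 4 (j : ℕ) : ℝ)

end ADHZ

/-!
# An approximation scheme for ADHZ markets with two utility levels

*Equilibria.*  With two utility levels an agent only distinguishes the goods it likes, those of the
higher utility, from the others.  An equilibrium for positive budgets is therefore described by an
`EqCert`: every agent `i` buys liked goods, all at its cheapest liked price `q i`, one unit if
`q i ≤ b i` and for its whole budget otherwise.  Goods that are not sold out are free, and they are
handed out arbitrarily (`fillUp`) to the agents that still lack something.
`EqCert.isHZEquilibrium` shows that the result is a Hylland-Zeckhauser equilibrium.

*Rounds.*  The scheme starts with budgets `ε / 2`, computes equilibrium prices, derives the next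
budgets from these prices, and so on.  Equilibrium prices are not unique, and nothing forces those
of the next round to lie above those of the last one.  But the budgets grow with the prices, and by
`EqCert.max` the pointwise maximum of equilibrium prices for budgets `b ≤ b'` is an equilibrium for
`b'`.  So taking maxima makes the prices increase.  The scheme stops as soon as every budget is at
least `1 - ε` times the current value of the endowment.  Otherwise the total price has risen by
more than `ε / 2` in this round (`Endowed.sum_price_lt`); since it never exceeds `n`, at most
`2 n / ε` rounds are followed by another one.

*One round.*  Equilibrium prices for fixed budgets are found by divide and conquer (`Blocks`).  The
agents and goods are divided into blocks, and all goods of a block have the same tentative price.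
That price is chosen such that the budgets which the agents of the block can spend at it, at most
the price of one unit each, add up to the value of its goods (`scanPrice_spec`).  A maximum flow of
money (of shares, where the price is zero) from agents to liked goods of their own block is
computed.  If it meets all demands, the prices are equilibrium prices (`Blocks.eqCert`).  If not, a
minimum cut splits a block into agents and goods whose prices have to be at least the tentative one
and others whose prices have to be at most that (`Blocks.split`).  The first step starts from the
price zero and may leave all agents together; each later one separates two of them
(`Blocks.exists_split`), so at most `n ^ 2 + 1` steps are needed.

*Flows.*  The maximum flow is found by pushes and relabellings, where a dummy agent holds the
capacity that nobody has bought, and an agent with unmet demand takes shares of a good from a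
holder with a lower label.  Each operation raises `Flow.pot`, which stays below `(n + 3) ^ 5`, so
that many sweeps reach a stable state.  In a stable state the agents with unmet demand have the top
label, and the vertices with the top label form the minimum cut.

*Cost.*  `Reaches` expresses total correctness of a program together with a bound `N` for the
iterations of each loop entry and a bound `β` for the encoding length of all numbers that are ever
stored.  The number of operations is then at most `Program.cost N`, a polynomial in `N` that
depends only on the program text, and the bit cost is at most a constant times `β` per operation.
To bound `β`, note that a flow in a network with data in `(1 / D) ℤ` stays in `(1 / D) ℤ` (`Fine`),
that block prices have a denominator at most `n` over the budgets, and that going from prices to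
budgets costs a factor `2 * den ε * ∏ den e`.  Hence `D` grows by a fixed factor per round, and the
encoding lengths stay polynomial.

*Memory.*  Matrices are stored row by row.  Natural-number arrays: `0` the size `n`, `1` the liked
goods, `2` and `3` the block numbers of agents and goods, `4` and `5` their labels, `10` to `13` the
loop variables, `14` and `18` the flags of the two outer loops, `15` to `17` minima and counters.
Rational arrays: `0` the input `ε`, `1` the utilities, `2` the endowments, `3` the allocation, `4`
the prices, `5` the budgets, `6` and `7` the tentative prices of agents and goods, `11` and `12`
their upper prices, `8` the shares, `9` the unmet demands, `10` and `13` auxiliary values.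
-/

namespace ADHZ

/-! ### Sizes of numbers -/

theorem natBits_pos (k : ℕ) : 1 ≤ natBits k := by simp [natBits]

theorem natBits_mono {a b : ℕ} (h : a ≤ b) : natBits a ≤ natBits b := by
  unfold natBits; have := Nat.size_le_size h; omega

theorem size_mul_le (a b : ℕ) : Nat.size (a * b) ≤ Nat.size a + Nat.size b := by
  rw [Nat.size_le, pow_add]
  exact Nat.mul_lt_mul'' (Nat.lt_size_self a) (Nat.lt_size_self b)

theorem size_add_le (a b : ℕ) : Nat.size (a + b) ≤ Nat.size a + Nat.size b + 1 := by
  rw [Nat.size_le]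
  have h1 := Nat.lt_size_self a
  have h2 := Nat.lt_size_self b
  have h3 : 2 ^ Nat.size a ≤ 2 ^ (Nat.size a + Nat.size b) := Nat.pow_le_pow_right (by norm_num) (by omega)
  have h4 : 2 ^ Nat.size b ≤ 2 ^ (Nat.size a + Nat.size b) := Nat.pow_le_pow_right (by norm_num) (by omega)
  rw [pow_succ]; omega

theorem natBits_add_le (a b : ℕ) : natBits (a + b) ≤ natBits a + natBits b := by
  have := size_add_le a b; unfold natBits; omega

theorem natBits_mul_le (a b : ℕ) : natBits (a * b) ≤ natBits a + natBits b := by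
  have := size_mul_le a b; unfold natBits; omega

/-- A fraction in lowest terms is no longer than any other representation of it. -/
theorem ratBits_le_of_eq_div {q : ℚ} {a : ℤ} {b : ℕ} (hb : b ≠ 0) (h : q = (a : ℚ) / b) :
    ratBits q ≤ Nat.size a.natAbs + Nat.size b + 1 := by
  have hb' : (b : ℤ) ≠ 0 := by exact_mod_cast hb
  have hd : q.den ∣ b := by
    have := Rat.den_dvd a b
    have e : ((a : ℚ) / ((b : ℤ) : ℚ)) = q := by rw [h]; simp
    rw [Rat.divInt_eq_div, e] at this
    exact_mod_cast this
  obtain ⟨c, hc⟩ := hd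
  have hn : a = q.num * c := by
    have h1 : (q.num : ℚ) / q.den = a / b := by rw [Rat.num_div_den, h]
    have hq : (q.den : ℚ) ≠ 0 := by exact_mod_cast q.den_nz
    have hc0 : (c : ℚ) ≠ 0 := by
      rintro h0; have : c = 0 := by exact_mod_cast h0
      simp [this] at hc; exact hb hc
    rw [hc] at h1; push_cast at h1
    field_simp at h1
    exact_mod_cast h1.symm
  have hc1 : 1 ≤ c := by
    rcases Nat.eq_zero_or_pos c with h0 | h0
    · simp [h0] at hc; exact absurd hc hb
    · exact h0
  have l1 : Nat.size q.num.natAbs ≤ Nat.size a.natAbs := by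
    apply Nat.size_le_size; rw [hn, Int.natAbs_mul]
    exact Nat.le_mul_of_pos_right _ (by simp; omega)
  have l2 : Nat.size q.den ≤ Nat.size b := by
    apply Nat.size_le_size; rw [hc]; exact Nat.le_mul_of_pos_right _ hc1
  unfold ratBits; omega

theorem ratBits_neg (q : ℚ) : ratBits (-q) = ratBits q := by simp [ratBits]

theorem ratBits_add_le (p q : ℚ) : ratBits (p + q) ≤ 2 * (ratBits p + ratBits q) := by
  have hp : (p.den : ℚ) ≠ 0 := by exact_mod_cast p.den_nz
  have hq : (q.den : ℚ) ≠ 0 := by exact_mod_cast q.den_nz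
  have h : p + q = ((p.num * q.den + q.num * p.den : ℤ) : ℚ) / ((p.den * q.den : ℕ) : ℚ) := by
    conv_lhs => rw [← Rat.num_div_den p, ← Rat.num_div_den q]
    push_cast; field_simp
  have := ratBits_le_of_eq_div (Nat.mul_ne_zero p.den_nz q.den_nz) h
  have h1 := size_mul_le p.den q.den
  have h2 : Nat.size (p.num * q.den + q.num * p.den).natAbs ≤
      Nat.size (p.num.natAbs * q.den) + Nat.size (q.num.natAbs * p.den) + 1 := by
    refine le_trans (Nat.size_le_size ?_) (size_add_le _ _)
    refine (Int.natAbs_add_le _ _).trans ?_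
    simp [Int.natAbs_mul]
  have h3 := size_mul_le p.num.natAbs q.den
  have h4 := size_mul_le q.num.natAbs p.den
  unfold ratBits at *; omega

theorem ratBits_mul_le (p q : ℚ) : ratBits (p * q) ≤ ratBits p + ratBits q := by
  have hp : (p.den : ℚ) ≠ 0 := by exact_mod_cast p.den_nz
  have hq : (q.den : ℚ) ≠ 0 := by exact_mod_cast q.den_nz
  have h : p * q = ((p.num * q.num : ℤ) : ℚ) / ((p.den * q.den : ℕ) : ℚ) := by
    conv_lhs => rw [← Rat.num_div_den p, ← Rat.num_div_den q]
    push_cast; field_simp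
  have := ratBits_le_of_eq_div (Nat.mul_ne_zero p.den_nz q.den_nz) h
  have h1 := size_mul_le p.den q.den
  have h2 := size_mul_le p.num.natAbs q.num.natAbs
  rw [Int.natAbs_mul] at this
  unfold ratBits at *; omega

theorem ratBits_inv_le (q : ℚ) : ratBits q⁻¹ ≤ ratBits q := by
  by_cases h0 : q = 0
  · simp [h0]
  have hn : q.num.natAbs ≠ 0 := by simpa using h0
  have h : q⁻¹ = ((q.num.sign * q.den : ℤ) : ℚ) / (q.num.natAbs : ℚ) := by
    conv_lhs => rw [← Rat.num_div_den q]
    have e : ((q.num.sign : ℤ) : ℚ) * (q.num.natAbs : ℚ) = q.num := by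
      rw [show ((q.num.natAbs : ℕ) : ℚ) = ((q.num.natAbs : ℤ) : ℚ) by simp]
      rw [← Int.cast_mul, Int.sign_mul_natAbs]
    have hn' : (q.num.natAbs : ℚ) ≠ 0 := by exact_mod_cast hn
    have s2 : ((q.num.sign : ℤ) : ℚ) * ((q.num.sign : ℤ) : ℚ) = 1 := by
      rcases lt_trichotomy q.num 0 with h | h | h
      · simp [Int.sign_eq_neg_one_of_neg h]
      · exact absurd (Rat.num_eq_zero.mp h) h0
      · simp [Int.sign_eq_one_of_pos h]
    have hd : (q.den : ℚ) ≠ 0 := by exact_mod_cast q.den_nz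
    have hq : (q.num : ℚ) ≠ 0 := by simpa using h0
    rw [inv_div, div_eq_div_iff hq hn']
    push_cast
    rw [← e]
    linear_combination (-(q.den : ℚ) * (q.num.natAbs : ℚ)) * s2
  have := ratBits_le_of_eq_div hn h
  have hs : (q.num.sign * q.den).natAbs ≤ q.den := by
    rw [Int.natAbs_mul]
    rcases lt_trichotomy q.num 0 with h | h | h
    · simp [Int.sign_eq_neg_one_of_neg h]
    · simp [h]
    · simp [Int.sign_eq_one_of_pos h]
  have := Nat.size_le_size hs
  unfold ratBits at *; omega

theorem ratBits_natCast (k : ℕ) : ratBits (k : ℚ) = natBits k + 1 := by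
  simp [ratBits, natBits]

/-! ### Static bounds for the cost of expressions and programs -/

/-- Bounds the encoding length of the value, in units of the encoding length of the memory. -/
def NExp.valWeight : NExp → ℕ
  | .const k => natBits k
  | .get _ _ => 1
  | .add l r => l.valWeight + r.valWeight
  | .sub l _ => l.valWeight
  | .mul l r => l.valWeight + r.valWeight

/-- Bounds the logarithmic cost, in units of the encoding length of the memory. -/
def NExp.weight : NExp → ℕ
  | .const k => natBits k
  | .get _ i => i.weight + 1
  | .add l r => l.weight + r.weight + (l.valWeight + r.valWeight)
  | .sub l r => l.weight + r.weight + l.valWeight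
  | .mul l r => l.weight + r.weight + (l.valWeight + r.valWeight)

/-- Bounds the encoding length of the value of a rational expression, in units of the encoding
length of the memory. -/
def QExp.valWeight : QExp → ℕ
  | .const q => ratBits q
  | .ofNat i => 2 * i.valWeight
  | .get _ _ => 1
  | .add l r => 2 * (l.valWeight + r.valWeight)
  | .sub l r => 2 * (l.valWeight + r.valWeight)
  | .mul l r => l.valWeight + r.valWeight
  | .div l r => l.valWeight + r.valWeight

/-- Bounds the logarithmic cost of an evaluation, in units of the encoding length of the memory. -/
def QExp.weight : QExp → ℕ
  | .const q => ratBits q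
  | .ofNat i => i.weight + 2 * i.valWeight
  | .get _ i => i.weight + 1
  | .add l r => l.weight + r.weight + 2 * (l.valWeight + r.valWeight)
  | .sub l r => l.weight + r.weight + 2 * (l.valWeight + r.valWeight)
  | .mul l r => l.weight + r.weight + (l.valWeight + r.valWeight)
  | .div l r => l.weight + r.weight + (l.valWeight + r.valWeight)

/-- Bounds the logarithmic cost of a test, in units of the encoding length of the memory. -/
def Test.weight : Test → ℕ
  | .natLE l r => l.weight + r.weight + 1
  | .ratLE l r => l.weight + r.weight + 1
  | .neg c => c.weight + 1
  | .both c d => c.weight + d.weight + 1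

/-- Bounds the logarithmic cost of each assignment and each test of the program, executed once, in
units of the encoding length of the memory. -/
def Program.weight : Program → ℕ
  | .skip => 1
  | .setNat _ i e => i.weight + e.weight + 1
  | .setRat _ i e => i.weight + e.weight + 1
  | .seq P Q => P.weight + Q.weight
  | .cond c P Q => c.weight + P.weight + Q.weight
  | .loop c P => c.weight + P.weight

/-- Bounds the uniform cost of a run in which no loop makes more than `N` iterations each time it
is entered. -/
def Program.cost (N : ℕ) : Program → ℕ
  | .skip => 1
  | .setNat _ i e => i.steps + e.steps + 1
  | .setRat _ i e => i.steps + e.steps + 1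
  | .seq P Q => P.cost N + Q.cost N
  | .cond c P Q => c.steps + P.cost N + Q.cost N
  | .loop c P => N * (c.steps + P.cost N) + c.steps

/-- Whether the program text contains an assignment to the natural-number array `a`. -/
def Program.writesNat (a : ℕ) : Program → Bool
  | .skip => false
  | .setNat a' _ _ => a' == a
  | .setRat _ _ _ => false
  | .seq P Q => P.writesNat a || Q.writesNat a
  | .cond _ P Q => P.writesNat a || Q.writesNat a
  | .loop _ P => P.writesNat a

/-- Whether the program text contains an assignment to the rational array `a`. -/
def Program.writesRat (a : ℕ) : Program → Bool
  | .skip => false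
  | .setNat _ _ _ => false
  | .setRat a' _ _ => a' == a
  | .seq P Q => P.writesRat a || Q.writesRat a
  | .cond _ P Q => P.writesRat a || Q.writesRat a
  | .loop _ P => P.writesRat a

theorem Program.exists_cost_le (P : Program) :
    ∃ C d : ℕ, ∀ N, P.cost N ≤ C * (N + 1) ^ d := by
  have mono : ∀ (C d d' N : ℕ), d ≤ d' → C * (N + 1) ^ d ≤ C * (N + 1) ^ d' := fun C d d' N h =>
    Nat.mul_le_mul_left _ (Nat.pow_le_pow_right (by omega) h)
  have one : ∀ (d N : ℕ), 1 ≤ (N + 1) ^ d := fun d N => Nat.one_le_pow _ _ (by omega)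
  induction P with
  | skip => exact ⟨1, 0, fun N => by simp [Program.cost]⟩
  | setNat a i e => exact ⟨i.steps + e.steps + 1, 0, fun N => by simp [Program.cost]⟩
  | setRat a i e => exact ⟨i.steps + e.steps + 1, 0, fun N => by simp [Program.cost]⟩
  | seq P Q hP hQ =>
    obtain ⟨C, d, h⟩ := hP
    obtain ⟨C', d', h'⟩ := hQ
    refine ⟨C + C', d + d', fun N => ?_⟩
    rw [Program.cost, add_mul]
    exact add_le_add ((h N).trans (mono _ _ _ _ (by omega))) ((h' N).trans (mono _ _ _ _ (by omega)))
  | cond c P Q hP hQ =>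
    obtain ⟨C, d, h⟩ := hP
    obtain ⟨C', d', h'⟩ := hQ
    refine ⟨c.steps + C + C', d + d', fun N => ?_⟩
    rw [Program.cost, add_mul, add_mul]
    exact add_le_add (add_le_add (Nat.le_mul_of_pos_right _ (one _ _))
      ((h N).trans (mono _ _ _ _ (by omega)))) ((h' N).trans (mono _ _ _ _ (by omega)))
  | loop c P hP =>
    obtain ⟨C, d, h⟩ := hP
    refine ⟨c.steps + C + c.steps, d + 1, fun N => ?_⟩
    have h1 := h N
    have h2 := one d N
    have h3 : c.steps ≤ c.steps * (N + 1) ^ d := Nat.le_mul_of_pos_right _ h2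
    have h4 : c.steps ≤ c.steps * (N + 1) ^ (d + 1) := Nat.le_mul_of_pos_right _ (one _ _)
    calc Program.cost N (.loop c P) = N * (c.steps + P.cost N) + c.steps := rfl
      _ ≤ (N + 1) * (c.steps * (N + 1) ^ d + C * (N + 1) ^ d) + c.steps * (N + 1) ^ (d + 1) :=
          add_le_add (Nat.mul_le_mul (by omega) (add_le_add h3 h1)) h4
      _ = _ := by ring

/-! ### A program logic for total correctness with cost bounds -/

/-- All memory cells hold numbers of encoding length at most `β`. -/
def Small (β : ℕ) (s : State) : Prop :=
  (∀ a k, natBits (s.nat a k) ≤ β) ∧ ∀ a k, ratBits (s.rat a k) ≤ β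

theorem Small.one_le {β : ℕ} {s : State} (h : Small β s) : 1 ≤ β := (natBits_pos _).trans (h.1 0 0)

theorem Small.mono {β γ : ℕ} {s : State} (h : Small β s) (hβ : β ≤ γ) : Small γ s :=
  ⟨fun a k => (h.1 a k).trans hβ, fun a k => (h.2 a k).trans hβ⟩

theorem NExp.natBits_eval_le {β : ℕ} {s : State} (hs : Small β s) (e : NExp) :
    natBits (e.eval s) ≤ e.valWeight * β := by
  induction e with
  | const k => exact Nat.le_mul_of_pos_right _ hs.one_le
  | get a i _ => simpa [NExp.valWeight, NExp.eval] using hs.1 a _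
  | add l r hl hr => rw [NExp.valWeight, add_mul]; exact (natBits_add_le _ _).trans (add_le_add hl hr)
  | sub l r hl hr => exact (natBits_mono (Nat.sub_le _ _)).trans hl
  | mul l r hl hr => rw [NExp.valWeight, add_mul]; exact (natBits_mul_le _ _).trans (add_le_add hl hr)

theorem NExp.bits_le {β : ℕ} {s : State} (hs : Small β s) (e : NExp) :
    e.bits s ≤ e.weight * β := by
  have hv := fun e : NExp => e.natBits_eval_le hs
  induction e with
  | const k => exact Nat.le_mul_of_pos_right _ hs.one_le
  | get a i hi => simp only [NExp.bits, NExp.weight, add_mul, one_mul]; exact add_le_add hi (hs.1 _ _)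
  | add l r hl hr =>
    simp only [NExp.bits, NExp.weight, add_mul]
    have := hv (.add l r); simp only [NExp.valWeight, NExp.eval, add_mul] at this; omega
  | sub l r hl hr =>
    simp only [NExp.bits, NExp.weight, add_mul]
    have := hv (.sub l r); simp only [NExp.valWeight, NExp.eval] at this; omega
  | mul l r hl hr =>
    simp only [NExp.bits, NExp.weight, add_mul]
    have := hv (.mul l r); simp only [NExp.valWeight, NExp.eval, add_mul] at this; omega

theorem QExp.ratBits_eval_le {β : ℕ} {s : State} (hs : Small β s) (e : QExp) :
    ratBits (e.eval s) ≤ e.valWeight * β := by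
  induction e with
  | const k => exact Nat.le_mul_of_pos_right _ hs.one_le
  | ofNat i =>
    have h1 := i.natBits_eval_le hs
    have h2 := natBits_pos (i.eval s)
    simp only [QExp.eval, QExp.valWeight, ratBits_natCast, mul_assoc]; omega
  | get a i => simpa [QExp.valWeight, QExp.eval] using hs.2 a _
  | add l r hl hr =>
    have := ratBits_add_le (l.eval s) (r.eval s)
    simp only [QExp.eval, QExp.valWeight, add_mul, mul_assoc]; omega
  | sub l r hl hr =>
    have := ratBits_add_le (l.eval s) (-r.eval s)
    rw [ratBits_neg, ← sub_eq_add_neg] at this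
    simp only [QExp.eval, QExp.valWeight, add_mul, mul_assoc]; omega
  | mul l r hl hr =>
    rw [QExp.valWeight, add_mul]; exact (ratBits_mul_le _ _).trans (add_le_add hl hr)
  | div l r hl hr =>
    have h1 := ratBits_mul_le (l.eval s) (r.eval s)⁻¹
    have h2 := ratBits_inv_le (r.eval s)
    rw [← div_eq_mul_inv] at h1
    simp only [QExp.eval, QExp.valWeight, add_mul]; omega

theorem QExp.bits_le {β : ℕ} {s : State} (hs : Small β s) (e : QExp) :
    e.bits s ≤ e.weight * β := by
  have hv := fun e : QExp => e.ratBits_eval_le hs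
  induction e with
  | const k => exact Nat.le_mul_of_pos_right _ hs.one_le
  | ofNat i =>
    have h1 := i.bits_le hs
    have := hv (.ofNat i)
    simp only [QExp.bits, QExp.weight, add_mul]
    simp only [QExp.eval, QExp.valWeight] at this; omega
  | get a i =>
    have h1 := i.bits_le hs
    simp only [QExp.bits, QExp.weight, add_mul, one_mul]; exact add_le_add h1 (hs.2 _ _)
  | add l r hl hr =>
    simp only [QExp.bits, QExp.weight, add_mul]
    have := hv (.add l r); simp only [QExp.valWeight, QExp.eval] at this; omega
  | sub l r hl hr =>
    simp only [QExp.bits, QExp.weight, add_mul]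
    have := hv (.sub l r); simp only [QExp.valWeight, QExp.eval] at this; omega
  | mul l r hl hr =>
    simp only [QExp.bits, QExp.weight, add_mul]
    have := hv (.mul l r); simp only [QExp.valWeight, QExp.eval, add_mul] at this; omega
  | div l r hl hr =>
    simp only [QExp.bits, QExp.weight, add_mul]
    have := hv (.div l r); simp only [QExp.valWeight, QExp.eval, add_mul] at this; omega

theorem Test.bits_le {β : ℕ} {s : State} (hs : Small β s) (c : Test) :
    c.bits s ≤ c.weight * β := by
  have h1 := hs.one_le
  induction c with
  | natLE l r =>
    have := l.bits_le hs; have := r.bits_le hs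
    simp only [Test.bits, Test.weight, add_mul]; omega
  | ratLE l r =>
    have := l.bits_le hs; have := r.bits_le hs
    simp only [Test.bits, Test.weight, add_mul]; omega
  | neg c hc => simp only [Test.bits, Test.weight, add_mul]; omega
  | both c d hc hd => simp only [Test.bits, Test.weight, add_mul]; omega

theorem Test.one_le_steps (c : Test) : 1 ≤ c.steps := by cases c <;> simp [Test.steps]

/-- Total correctness: started in `s`, the program `P` halts in a state that satisfies `Q`, every
loop makes at most `N` iterations each time it is entered, and no cell ever gets a number of
encoding length above `β`.  The bounds on the two costs are what follows from this. -/
def Reaches (N β : ℕ) (P : Program) (s : State) (Q : State → Prop) : Prop :=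
  Small β s → ∃ s' t w, Exec P s s' t w ∧ t ≤ P.cost N ∧ w ≤ t * (P.weight * β) ∧
    Small β s' ∧ Q s'

section Rules

variable {N β : ℕ} {P P' : Program} {s : State} {Q R : State → Prop}

theorem Reaches.mono (h : Reaches N β P s Q) (hQ : ∀ s', Q s' → R s') : Reaches N β P s R := by
  intro hs
  obtain ⟨s', t, w, h1, h2, h3, h4, h5⟩ := h hs
  exact ⟨s', t, w, h1, h2, h3, h4, hQ _ h5⟩

theorem Small.setNat {a k v : ℕ} (h : Small β s) (hv : natBits v ≤ β) :
    Small β (s.setNat a k v) := by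
  refine ⟨fun a' k' => ?_, h.2⟩
  by_cases ha : a' = a
  · subst ha
    by_cases hk : k' = k
    · subst hk; simpa [State.setNat] using hv
    · simpa [State.setNat, hk] using h.1 a' k'
  · simpa [State.setNat, ha] using h.1 a' k'

theorem Small.setRat {a k : ℕ} {v : ℚ} (h : Small β s) (hv : ratBits v ≤ β) :
    Small β (s.setRat a k v) := by
  refine ⟨h.1, fun a' k' => ?_⟩
  by_cases ha : a' = a
  · subst ha
    by_cases hk : k' = k
    · subst hk; simpa [State.setRat] using hv
    · simpa [State.setRat, hk] using h.2 a' k'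
  · simpa [State.setRat, ha] using h.2 a' k'

theorem Reaches.skip (h : Q s) : Reaches N β .skip s Q := fun hs =>
  ⟨s, 1, 1, .skip s, le_rfl, by simpa [Program.weight] using hs.one_le, hs, h⟩

theorem Reaches.setNat {a : ℕ} {i e : NExp} (hv : natBits (e.eval s) ≤ β)
    (h : Q (s.setNat a (i.eval s) (e.eval s))) : Reaches N β (.setNat a i e) s Q := by
  intro hs
  refine ⟨_, _, _, .setNat s a i e, le_rfl, ?_, hs.setNat hv, h⟩
  refine le_trans ?_ (Nat.le_mul_of_pos_left _ (by omega))
  have := i.bits_le hs; have := e.bits_le hs; have := hs.one_le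
  simp only [Program.weight, add_mul]; omega

theorem Reaches.setRat {a : ℕ} {i : NExp} {e : QExp} (hv : ratBits (e.eval s) ≤ β)
    (h : Q (s.setRat a (i.eval s) (e.eval s))) : Reaches N β (.setRat a i e) s Q := by
  intro hs
  refine ⟨_, _, _, .setRat s a i e, le_rfl, ?_, hs.setRat hv, h⟩
  refine le_trans ?_ (Nat.le_mul_of_pos_left _ (by omega))
  have := i.bits_le hs; have := e.bits_le hs; have := hs.one_le
  simp only [Program.weight, add_mul]; omega

theorem Reaches.seq (h : Reaches N β P s (fun s' => Reaches N β P' s' Q)) :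
    Reaches N β (.seq P P') s Q := by
  intro hs
  obtain ⟨s', t, w, h1, h2, h3, h4, h5⟩ := h hs
  obtain ⟨s'', t', w', g1, g2, g3, g4, g5⟩ := h5 h4
  refine ⟨s'', _, _, .seq h1 g1, add_le_add h2 g2, ?_, g4, g5⟩
  simp only [Program.weight]
  calc w + w' ≤ t * (P.weight * β) + t' * (P'.weight * β) := add_le_add h3 g3
    _ ≤ t * ((P.weight + P'.weight) * β) + t' * ((P.weight + P'.weight) * β) := by gcongr <;> omega
    _ = _ := by ring

theorem Reaches.cond {c : Test} (h : c.holds s → Reaches N β P s Q)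
    (h' : ¬ c.holds s → Reaches N β P' s Q) : Reaches N β (.cond c P P') s Q := by
  intro hs
  have hc := c.bits_le hs
  have key : ∀ t w W, w ≤ t * (W * β) → W ≤ P.weight + P'.weight →
      c.bits s + w ≤ (c.steps + t) * ((c.weight + P.weight + P'.weight) * β) := by
    intro t w W hw hW
    calc c.bits s + w ≤ 1 * (c.weight * β) + t * (W * β) := by simpa using add_le_add hc hw
      _ ≤ c.steps * ((c.weight + P.weight + P'.weight) * β) +
          t * ((c.weight + P.weight + P'.weight) * β) := by
        gcongr
        · exact c.one_le_steps
        · omega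
        · omega
      _ = _ := by ring
  by_cases hb : c.holds s
  · obtain ⟨s', t, w, h1, h2, h3, h4, h5⟩ := h hb hs
    exact ⟨s', _, _, .condTrue hb h1, by simp only [Program.cost]; omega,
      key _ _ _ h3 (by omega), h4, h5⟩
  · obtain ⟨s', t, w, h1, h2, h3, h4, h5⟩ := h' hb hs
    exact ⟨s', _, _, .condFalse hb h1, by simp only [Program.cost]; omega,
      key _ _ _ h3 (by omega), h4, h5⟩

/-- The rule for loops: `I k` holds after `k` iterations, and can hold before another iteration
only while `k < N`. -/
theorem Reaches.loop {c : Test} (I : ℕ → State → Prop) (h0 : I 0 s)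
    (hstep : ∀ k s, I k s → c.holds s → k < N ∧ Reaches N β P s (I (k + 1)))
    (hQ : ∀ k s, I k s → ¬ c.holds s → Q s) : Reaches N β (.loop c P) s Q := by
  have key : ∀ m k s, N - k = m → I k s → Small β s → ∃ s' t w, Exec (.loop c P) s s' t w ∧
      t ≤ m * (c.steps + P.cost N) + c.steps ∧ w ≤ t * ((c.weight + P.weight) * β) ∧
      Small β s' ∧ Q s' := by
    intro m
    induction m with
    | zero =>
      intro k s hm hI hs
      by_cases hb : c.holds s
      · have := (hstep k s hI hb).1; omega
      · refine ⟨s, _, _, .loopDone hb, by simp, ?_, hs, hQ k s hI hb⟩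
        refine (c.bits_le hs).trans ((Nat.mul_le_mul_right β (by omega)).trans
          (Nat.le_mul_of_pos_left _ c.one_le_steps))
    | succ m ih =>
      intro k s hm hI hs
      by_cases hb : c.holds s
      · obtain ⟨hk, hP⟩ := hstep k s hI hb
        obtain ⟨s', t, w, h1, h2, h3, h4, h5⟩ := hP hs
        obtain ⟨s'', t', w', g1, g2, g3, g4, g5⟩ := ih (k + 1) s' (by omega) h5 h4
        refine ⟨s'', _, _, .loopStep hb h1 g1, ?_, ?_, g4, g5⟩
        · rw [add_mul, one_mul]; omega
        · have hc := c.bits_le hs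
          calc c.bits s + w + w' ≤ 1 * (c.weight * β) + t * (P.weight * β) +
                t' * ((c.weight + P.weight) * β) := by omega
            _ ≤ c.steps * ((c.weight + P.weight) * β) + t * ((c.weight + P.weight) * β) +
                t' * ((c.weight + P.weight) * β) := by
              gcongr
              · exact c.one_le_steps
              · omega
              · omega
            _ = _ := by ring
      · refine ⟨s, _, _, .loopDone hb, by simp, ?_, hs, hQ k s hI hb⟩
        refine (c.bits_le hs).trans ((Nat.mul_le_mul_right β (by omega)).trans
          (Nat.le_mul_of_pos_left _ c.one_le_steps))
  intro hs
  obtain ⟨s', t, w, h1, h2, h3, h4, h5⟩ := key N 0 s rfl h0 hs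
  exact ⟨s', t, w, h1, h2, h3, h4, h5⟩

/-- `s'` differs from `s` only in arrays to which the text of `P` contains assignments. -/
def Frame (P : Program) (s s' : State) : Prop :=
  (∀ a, P.writesNat a = false → s'.nat a = s.nat a) ∧
    ∀ a, P.writesRat a = false → s'.rat a = s.rat a

theorem Frame.refl (P : Program) (s : State) : Frame P s s := ⟨fun _ _ => rfl, fun _ _ => rfl⟩

theorem Frame.trans {s' s'' : State} (h : Frame P s s') (h' : Frame P s' s'') : Frame P s s'' :=
  ⟨fun a ha => (h'.1 a ha).trans (h.1 a ha), fun a ha => (h'.2 a ha).trans (h.2 a ha)⟩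

theorem Exec.frame {s' : State} {t w : ℕ} (h : Exec P s s' t w) : Frame P s s' := by
  induction h with
  | skip s => exact Frame.refl _ _
  | setNat s a i e =>
    refine ⟨fun a' ha => ?_, fun _ _ => rfl⟩
    have : a' ≠ a := by rintro rfl; simp [Program.writesNat] at ha
    simp [State.setNat, this]
  | setRat s a i e =>
    refine ⟨fun _ _ => rfl, fun a' ha => ?_⟩
    have : a' ≠ a := by rintro rfl; simp [Program.writesRat] at ha
    simp [State.setRat, this]
  | seq _ _ h1 h2 =>
    constructor
    · intro a ha; simp only [Program.writesNat, Bool.or_eq_false_iff] at ha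
      rw [h2.1 a ha.2, h1.1 a ha.1]
    · intro a ha; simp only [Program.writesRat, Bool.or_eq_false_iff] at ha
      rw [h2.2 a ha.2, h1.2 a ha.1]
  | condTrue _ _ h1 =>
    constructor
    · intro a ha; simp only [Program.writesNat, Bool.or_eq_false_iff] at ha; exact h1.1 a ha.1
    · intro a ha; simp only [Program.writesRat, Bool.or_eq_false_iff] at ha; exact h1.2 a ha.1
  | condFalse _ _ h1 =>
    constructor
    · intro a ha; simp only [Program.writesNat, Bool.or_eq_false_iff] at ha; exact h1.1 a ha.2
    · intro a ha; simp only [Program.writesRat, Bool.or_eq_false_iff] at ha; exact h1.2 a ha.2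
  | loopDone _ => exact Frame.refl _ _
  | loopStep _ _ _ h1 h2 =>
    constructor
    · intro a ha
      rw [h2.1 a ha, h1.1 a (by simpa [Program.writesNat] using ha)]
    · intro a ha
      rw [h2.2 a ha, h1.2 a (by simpa [Program.writesRat] using ha)]

theorem Reaches.frame (h : Reaches N β P s Q) :
    Reaches N β P s (fun s' => Frame P s s' ∧ Q s') := by
  intro hs
  obtain ⟨s', t, w, h1, h2, h3, h4, h5⟩ := h hs
  exact ⟨s', t, w, h1, h2, h3, h4, h1.frame, h5⟩

/-- Sequencing in which the first program is known through a specification. -/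
theorem Reaches.seq_of (h : Reaches N β P s R)
    (h' : ∀ s', Frame P s s' → R s' → Reaches N β P' s' Q) : Reaches N β (.seq P P') s Q :=
  .seq (h.frame.mono fun s' hs' => h' s' hs'.1 hs'.2)

end Rules

/-! ### Counting loops -/

/-- The natural-number variable that is stored in cell `0` of array `v`. -/
abbrev nvar (v : ℕ) : NExp := .get v (.const 0)

/-- The rational variable that is stored in cell `0` of array `v`. -/
abbrev qvar (v : ℕ) : QExp := .get v (.const 0)

/-- `for v := 0, 1, …, bd - 1 do P`. -/
def forLoop (v : ℕ) (bd : NExp) (P : Program) : Program :=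
  .seq (.setNat v (.const 0) (.const 0))
    (.loop (.neg (.natLE bd (nvar v)))
      (.seq P (.setNat v (.const 0) (.add (nvar v) (.const 1)))))

theorem setNat_nat_ne {s : State} {a k v b : ℕ} (h : b ≠ a) : (s.setNat a k v).nat b = s.nat b := by
  simp [State.setNat, h]

theorem setNat_nat_self {s : State} {a k v : ℕ} :
    (s.setNat a k v).nat a = Function.update (s.nat a) k v := by
  simp [State.setNat]

theorem setNat_rat {s : State} {a k v : ℕ} : (s.setNat a k v).rat = s.rat := rfl

theorem setRat_rat_ne {s : State} {a k b : ℕ} {v : ℚ} (h : b ≠ a) :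
    (s.setRat a k v).rat b = s.rat b := by
  simp [State.setRat, h]

theorem setRat_rat_self {s : State} {a k : ℕ} {v : ℚ} :
    (s.setRat a k v).rat a = Function.update (s.rat a) k v := by
  simp [State.setRat]

theorem setRat_nat {s : State} {a k : ℕ} {v : ℚ} : (s.setRat a k v).nat = s.nat := rfl

/-- The rule for counting loops: `I k` holds before the iteration in which the loop variable has
the value `k`. -/
theorem Reaches.forLoop {N β v M : ℕ} {bd : NExp} {P : Program} {s : State} {Q : State → Prop}
    (I : ℕ → State → Prop) (hv : P.writesNat v = false)
    (hM : ∀ s', Frame (forLoop v bd P) s s' → bd.eval s' = M) (hMN : M ≤ N) (hMβ : natBits M ≤ β)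
    (h0 : I 0 (s.setNat v 0 0))
    (hstep : ∀ k s', k < M → Frame (ADHZ.forLoop v bd P) s s' → s'.nat v 0 = k → I k s' →
      Reaches N β P s' fun s'' => I (k + 1) (s''.setNat v 0 (k + 1)))
    (hQ : ∀ s', Frame (ADHZ.forLoop v bd P) s s' → I M s' → Q s') :
    Reaches N β (ADHZ.forLoop v bd P) s Q := by
  have hvw : (ADHZ.forLoop v bd P).writesNat v = true := by simp [ADHZ.forLoop, Program.writesNat]
  have hfs : ∀ s' k, Frame (ADHZ.forLoop v bd P) s s' →
      Frame (ADHZ.forLoop v bd P) s (s'.setNat v 0 k) := by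
    intro s' k h
    refine ⟨fun a ha => ?_, h.2⟩
    have : a ≠ v := by rintro rfl; rw [hvw] at ha; cases ha
    rw [setNat_nat_ne this]; exact h.1 a ha
  have hfP : ∀ s' s'', Frame P s' s'' → Frame (ADHZ.forLoop v bd P) s' s'' := by
    intro s' s'' h
    refine ⟨fun a ha => h.1 a ?_, fun a ha => h.2 a ?_⟩
    · simp [ADHZ.forLoop, Program.writesNat] at ha; exact ha.2.1
    · simp [ADHZ.forLoop, Program.writesRat] at ha; exact ha
  unfold ADHZ.forLoop
  refine .seq (.setNat (by simpa [NExp.eval] using (natBits_mono (Nat.zero_le M)).trans hMβ) ?_)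
  refine .loop (fun k s' => Frame (ADHZ.forLoop v bd P) s s' ∧ s'.nat v 0 = k ∧ k ≤ M ∧ I k s')
    ⟨hfs _ _ (Frame.refl _ _), by simp [State.setNat, NExp.eval], Nat.zero_le _, h0⟩ ?_ ?_
  · rintro k s' ⟨hf, hk, hkM, hI⟩ hc
    have hlt : k < M := by
      simp only [Test.holds, hM s' hf, NExp.eval, hk] at hc; omega
    refine ⟨by omega, .seq ?_⟩
    refine ((hstep k s' hlt hf hk hI).frame).mono ?_
    rintro s'' ⟨hf', hI'⟩
    have hk' : s''.nat v 0 = k := by rw [hf'.1 v hv, hk]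
    refine .setNat ?_ ?_
    · simp only [NExp.eval, hk']; exact (natBits_mono hlt).trans hMβ
    · simp only [NExp.eval, hk']
      exact ⟨hfs _ _ (hf.trans (hfP _ _ hf')), by simp [State.setNat], hlt, hI'⟩
  · rintro k s' ⟨hf, hk, hkM, hI⟩ hc
    have : k = M := by
      simp only [Test.holds, hM s' hf, NExp.eval, hk, not_not] at hc; omega
    subst this
    exact hQ s' hf hI

end ADHZ

namespace ADHZ

open Finset

/-! ### Maximum flow by local pushes and relabellings -/

/-- A flow with labels.  Rows `0, …, n - 1` of `f` belong to the agents; row `n` belongs to a dummy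
agent that holds the free capacity of the goods.  `r` is the unmet demand, `h` and `l` are the
labels of agents and goods. -/
@[ext]
structure Flow where
  f : ℕ → ℕ → ℚ
  r : ℕ → ℚ
  h : ℕ → ℕ
  l : ℕ → ℕ

/-- The invariant of the flow algorithm for edges `E`, demands `d` and capacities `c`.  Labels are
lower bounds for the distance to the dummy agent in the residual graph, cut off at `n + 1`. -/
structure Flow.Inv (n : ℕ) (E : ℕ → ℕ → Prop) (d c : ℕ → ℚ) (σ : Flow) : Prop where
  nonneg : ∀ i ≤ n, ∀ j < n, 0 ≤ σ.f i j
  supp : ∀ i < n, ∀ j < n, σ.f i j ≠ 0 → E i j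
  col : ∀ j < n, ∑ i ∈ range (n + 1), σ.f i j = c j
  r_nonneg : ∀ i ≤ n, 0 ≤ σ.r i
  row : ∀ i ≤ n, ∑ j ∈ range n, σ.f i j + σ.r i = d i
  edge : ∀ i < n, ∀ j < n, E i j → σ.h i ≤ σ.l j
  holder : ∀ i ≤ n, ∀ j < n, σ.f i j ≠ 0 → σ.l j ≤ σ.h i + 1
  h_dummy : σ.h n = 0
  h_le : ∀ i ≤ n, σ.h i ≤ n + 1
  l_pos : ∀ j < n, 1 ≤ σ.l j
  l_le : ∀ j < n, σ.l j ≤ n + 1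

/-- Agent `i` can take shares of good `j` from holder `k`. -/
def Flow.CanPush (E : ℕ → ℕ → Prop) (σ : Flow) (i j k : ℕ) : Prop :=
  E i j ∧ 0 < σ.r i ∧ 0 < σ.f k j ∧ σ.h i = σ.l j ∧ σ.l j = σ.h k + 1

/-- `σ'` arises from `σ` when agent `i` takes `δ` of good `j` from holder `k`. -/
structure Flow.IsPush (n i j k : ℕ) (δ : ℚ) (σ σ' : Flow) : Prop where
  f : ∀ a ≤ n, ∀ b < n, σ'.f a b =
    σ.f a b + (if a = i ∧ b = j then δ else 0) - (if a = k ∧ b = j then δ else 0)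
  r : ∀ a ≤ n, σ'.r a = σ.r a - (if a = i then δ else 0) + (if a = k then δ else 0)
  h : σ'.h = σ.h
  l : σ'.l = σ.l

/-- No push and no relabelling is possible. -/
structure Flow.Stable (n : ℕ) (E : ℕ → ℕ → Prop) (σ : Flow) : Prop where
  push : ∀ i < n, ∀ j < n, ∀ k ≤ n, ¬ σ.CanPush E i j k
  h : ∀ i < n, σ.h i = n + 1 ∨ ∃ j < n, E i j ∧ σ.l j = σ.h i
  l : ∀ j < n, σ.l j = n + 1 ∨ ∃ k ≤ n, σ.f k j ≠ 0 ∧ σ.l j = σ.h k + 1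

/-- Contribution of a pair to the potential.  It grows whenever holder `i` loses its last share of
good `j`, and it never decreases: a pair that is emptied can be filled again only after agent `i`
was relabelled. -/
def Flow.pairPot (σ : Flow) (i j : ℕ) : ℕ :=
  σ.h i + if σ.f i j = 0 ∧ σ.h i < σ.l j then 1 else 0

/-- Contribution of an agent to the potential: unmet demand is better placed at a low label. -/
def Flow.agentPot (n : ℕ) (σ : Flow) (i : ℕ) : ℕ :=
  if 0 < σ.r i then n + 1 - σ.h i else n + 2

/-- The potential that grows with every push and every relabelling. -/
def Flow.pot (n : ℕ) (σ : Flow) : ℕ :=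
  (n + 3) * (∑ p ∈ range (n + 1) ×ˢ range n, σ.pairPot p.1 p.2 + ∑ i ∈ range (n + 1), σ.h i +
    ∑ j ∈ range n, σ.l j) + ∑ i ∈ range n, σ.agentPot n i

section

variable {n : ℕ} {E : ℕ → ℕ → Prop} {d c : ℕ → ℚ} {σ σ' : Flow}

theorem Flow.Inv.pot_lt (H : σ.Inv n E d c) : σ.pot n < (n + 3) ^ 5 := by
  have h1 : ∑ p ∈ range (n + 1) ×ˢ range n, σ.pairPot p.1 p.2 ≤ ((n + 1) * n) * (n + 2) := by
    have := sum_le_card_nsmul (range (n + 1) ×ˢ range n) (fun p => σ.pairPot p.1 p.2) (n + 2) ?_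
    · simpa using this
    · intro p hp
      simp only [mem_product, mem_range] at hp
      have := H.h_le p.1 (by omega)
      unfold Flow.pairPot
      split_ifs <;> omega
  have h2 : ∑ i ∈ range (n + 1), σ.h i ≤ (n + 1) * (n + 1) := by
    have := sum_le_card_nsmul (range (n + 1)) σ.h (n + 1) (fun i hi => H.h_le i (by
      simp at hi; omega))
    simpa using this
  have h3 : ∑ j ∈ range n, σ.l j ≤ n * (n + 1) := by
    have := sum_le_card_nsmul (range n) σ.l (n + 1) (fun i hi => H.l_le i (by simpa using hi))
    simpa using this
  have h4 : ∑ i ∈ range n, σ.agentPot n i ≤ n * (n + 2) := by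
    have := sum_le_card_nsmul (range n) (σ.agentPot n) (n + 2) ?_
    · simpa using this
    · intro i _; unfold Flow.agentPot; split_ifs <;> omega
  unfold Flow.pot
  calc _ ≤ (n + 3) * ((n + 1) * n * (n + 2) + (n + 1) * (n + 1) + n * (n + 1)) + n * (n + 2) := by
        gcongr
    _ < _ := by
        ring_nf
        nlinarith [Nat.zero_le n, Nat.zero_le (n ^ 2), Nat.zero_le (n ^ 3), Nat.zero_le (n ^ 4),
          Nat.zero_le (n ^ 5)]

/-- A push raises the potential: if the holder loses its last share, then the pair of holder and
good gains one, which outweighs the loss of the agents; otherwise the pushing agent is satisfied,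
and only the holder, whose label is lower, may become unsatisfied. -/
theorem Flow.Inv.push {i j k : ℕ} (H : σ.Inv n E d c) (hi : i < n) (hj : j < n) (hk : k ≤ n)
    (hc : σ.CanPush E i j k) (hp : Flow.IsPush n i j k (min (σ.r i) (σ.f k j)) σ σ') :
    σ'.Inv n E d c ∧ σ.pot n < σ'.pot n := by
  obtain ⟨hE, hr, hf, hij, hjk⟩ := hc
  have hik : i ≠ k := by rintro rfl; omega
  set δ := min (σ.r i) (σ.f k j) with hδ
  have δ0 : 0 < δ := lt_min hr hf
  have δr : δ ≤ σ.r i := min_le_left _ _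
  have δf : δ ≤ σ.f k j := min_le_right _ _
  have fnn : ∀ a ≤ n, ∀ b < n, 0 ≤ σ'.f a b := by
    intro a ha b hb
    rw [hp.f a ha b hb]
    have := H.nonneg a ha b hb
    by_cases h1 : a = k ∧ b = j
    · obtain ⟨rfl, rfl⟩ := h1
      simp [hik.symm]; linarith
    · simp only [h1, if_false]; split_ifs <;> linarith
  have rnn : ∀ a ≤ n, 0 ≤ σ'.r a := by
    intro a ha
    rw [hp.r a ha]
    have := H.r_nonneg a ha
    by_cases h1 : a = i
    · subst h1; simp [hik]; linarith
    · simp only [h1, if_false]; split_ifs <;> linarith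
  constructor
  · refine ⟨fnn, ?_, ?_, rnn, ?_, ?_, ?_, ?_, ?_, ?_, ?_⟩
    · intro a ha b hb hne
      by_cases h1 : a = i ∧ b = j
      · rw [h1.1, h1.2]; exact hE
      · refine H.supp a ha b hb fun h0 => hne ?_
        have h2 := fnn a ha.le b hb
        rw [hp.f a ha.le b hb, h0] at h2 ⊢
        simp only [h1, if_false] at h2 ⊢
        split_ifs at h2 ⊢ <;> linarith
    · intro b hb
      rw [sum_congr rfl (fun a ha => hp.f a (by simp at ha; omega) b hb), sum_sub_distrib,
        sum_add_distrib, H.col b hb]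
      by_cases h1 : b = j
      · simp [h1]; rw [if_pos (by omega), if_pos (by omega)]; ring
      · simp [h1]
    · intro a ha
      rw [sum_congr rfl (fun b hb => hp.f a ha b (by simpa using hb)), sum_sub_distrib,
        sum_add_distrib, hp.r a ha, ← H.row a ha]
      have : ∀ x : ℕ, ∑ b ∈ range n, (if a = x ∧ b = j then δ else 0) = if a = x then δ else 0 := by
        intro x; by_cases h : a = x <;> simp [h, hj]
      rw [this, this]; ring
    · intro a ha b hb hab; rw [hp.h, hp.l]; exact H.edge a ha b hb hab
    · intro a ha b hb hab
      rw [hp.h, hp.l]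
      by_cases h1 : a = i ∧ b = j
      · rw [h1.1, h1.2]; omega
      · refine H.holder a ha b hb fun h0 => hab ?_
        have h2 := fnn a ha b hb
        rw [hp.f a ha b hb, h0] at h2 ⊢
        simp only [h1, if_false] at h2 ⊢
        split_ifs at h2 ⊢ <;> linarith
    · rw [hp.h]; exact H.h_dummy
    · rw [hp.h]; exact H.h_le
    · rw [hp.l]; exact H.l_pos
    · rw [hp.l]; exact H.l_le
  · have hpair : ∀ a ≤ n, ∀ b < n, σ.pairPot a b ≤ σ'.pairPot a b := by
      intro a ha b hb
      unfold Flow.pairPot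
      rw [hp.h, hp.l]
      by_cases h1 : a = i ∧ b = j
      · obtain ⟨rfl, rfl⟩ := h1
        rw [if_neg (by omega)]; omega
      · by_cases h2 : a = k ∧ b = j
        · obtain ⟨rfl, rfl⟩ := h2
          rw [if_neg (fun h => hf.ne' h.1)]; omega
        · have : σ'.f a b = σ.f a b := by rw [hp.f a ha b hb]; simp [h1, h2]
          rw [this]
    -- a push that takes the last share raises the contribution of the pair `(k, j)`
    have hpairs : ∑ p ∈ range (n + 1) ×ˢ range n, σ.pairPot p.1 p.2 +
        (if σ.f k j ≤ σ.r i then 1 else 0) ≤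
        ∑ p ∈ range (n + 1) ×ˢ range n, σ'.pairPot p.1 p.2 := by
      have hle : ∀ p ∈ range (n + 1) ×ˢ range n, σ.pairPot p.1 p.2 ≤ σ'.pairPot p.1 p.2 := by
        intro p hp
        simp only [mem_product, mem_range] at hp
        exact hpair _ (by omega) _ hp.2
      split_ifs with hsat
      · refine sum_lt_sum hle ⟨(k, j), by simp; omega, ?_⟩
        have hδ' : δ = σ.f k j := min_eq_right hsat
        have : σ'.f k j = 0 := by
          rw [hp.f k hk j hj]; simp [hik.symm, hδ']
        simp only [Flow.pairPot, hp.h, hp.l, this]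
        rw [if_neg (fun h => hf.ne' h.1), if_pos ⟨by trivial, by omega⟩]; omega
      · exact sum_le_sum hle
    -- agent `i` gains if it is satisfied; the holder loses at most `σ.h k + 1 = σ.h i`
    have hag : ∑ a ∈ range n, σ.agentPot n a + (if σ.f k j ≤ σ.r i then 0 else σ.h i + 1) ≤
        ∑ a ∈ range n, σ'.agentPot n a + (σ.h k + 1) := by
      have e1 : (if σ.f k j ≤ σ.r i then 0 else σ.h i + 1) = ∑ a ∈ range n,
          (if a = i then (if σ.f k j ≤ σ.r i then 0 else σ.h i + 1) else 0) := by simp [hi]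
      have e2 : ∑ a ∈ range n, (if a = k then σ.h k + 1 else 0) ≤ σ.h k + 1 := by
        rw [sum_ite_eq']; split_ifs <;> omega
      refine le_trans ?_ (add_le_add_right e2 _)
      rw [e1, ← sum_add_distrib, ← sum_add_distrib]
      refine sum_le_sum fun a ha => ?_
      have ha' : a < n := by simpa using ha
      have hla := H.h_le a ha'.le
      unfold Flow.agentPot
      rw [hp.h]
      by_cases h1 : a = i
      · subst h1
        simp only [hik, if_true, if_false, hr]
        have hra : σ'.r a = σ.r a - δ := by rw [hp.r a ha'.le]; simp [hik]
        by_cases hsat : σ.f k j ≤ σ.r a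
        · rw [if_pos hsat]; split_ifs <;> omega
        · rw [if_neg hsat, if_neg]
          · omega
          · rw [hra, hδ, min_eq_left (by linarith)]; simp
      · by_cases h2 : a = k
        · subst h2
          simp only [h1, if_true, if_false]
          split_ifs <;> omega
        · have : σ'.r a = σ.r a := by rw [hp.r a ha'.le]; simp [h1, h2]
          simp [h1, h2, this]
    have hkn := H.h_le k hk
    unfold Flow.pot
    rw [hp.h, hp.l]
    set A := ∑ p ∈ range (n + 1) ×ˢ range n, σ.pairPot p.1 p.2
    set A' := ∑ p ∈ range (n + 1) ×ˢ range n, σ'.pairPot p.1 p.2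
    have hin := H.h_le i hi.le
    split_ifs at hpairs hag with hsat
    · have : (n + 3) * (A + 1) ≤ (n + 3) * A' := Nat.mul_le_mul_left _ hpairs
      simp only [mul_add] at this ⊢
      omega
    · have : (n + 3) * A ≤ (n + 3) * A' := Nat.mul_le_mul_left _ (by omega)
      simp only [mul_add] at this ⊢
      omega

/-- The label enters the potential with weight `n + 3`, so its rise outweighs the loss in the
contribution of the agent. -/
theorem Flow.Inv.relabelAgent {i v : ℕ} (H : σ.Inv n E d c) (hi : i < n) (hv : σ.h i < v)
    (hvn : v ≤ n + 1) (hE : ∀ j < n, E i j → v ≤ σ.l j)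
    (hf : σ'.f = σ.f) (hr : σ'.r = σ.r) (hh : σ'.h = Function.update σ.h i v) (hl : σ'.l = σ.l) :
    σ'.Inv n E d c ∧ σ.pot n < σ'.pot n := by
  have hle : ∀ a, σ.h a ≤ σ'.h a := by
    intro a; rw [hh]
    by_cases h : a = i
    · subst h; simp; omega
    · simp [h]
  have hi' : σ'.h i = v := by simp [hh]
  have hne : ∀ a, a ≠ i → σ'.h a = σ.h a := fun a h => by simp [hh, h]
  constructor
  · refine ⟨by rw [hf]; exact H.nonneg, by rw [hf]; exact H.supp, by rw [hf]; exact H.col,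
      by rw [hr]; exact H.r_nonneg, by rw [hf, hr]; exact H.row, ?_, ?_, ?_, ?_,
      by rw [hl]; exact H.l_pos, by rw [hl]; exact H.l_le⟩
    · intro a ha b hb hab
      rw [hl]
      by_cases h : a = i
      · subst h; rw [hi']; exact hE b hb hab
      · rw [hne a h]; exact H.edge a ha b hb hab
    · intro a ha b hb hab
      rw [hf] at hab; rw [hl]
      have := H.holder a ha b hb hab
      have := hle a; omega
    · rw [hne n (by omega)]; exact H.h_dummy
    · intro a ha
      by_cases h : a = i
      · rw [h, hi']; exact hvn
      · rw [hne a h]; exact H.h_le a ha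
  · have h1 : ∑ p ∈ range (n + 1) ×ˢ range n, σ.pairPot p.1 p.2 ≤
        ∑ p ∈ range (n + 1) ×ˢ range n, σ'.pairPot p.1 p.2 := by
      refine sum_le_sum fun p _ => ?_
      unfold Flow.pairPot
      rw [hf, hl]
      by_cases h : p.1 = i
      · rw [h, hi']; split_ifs <;> omega
      · rw [hne _ h]
    have h2 : ∑ a ∈ range (n + 1), σ'.h a = ∑ a ∈ range (n + 1), σ.h a + (v - σ.h i) := by
      have e : ∀ a ∈ range (n + 1), σ'.h a = σ.h a + if a = i then v - σ.h i else 0 := by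
        intro a _
        by_cases h : a = i
        · subst h; rw [hi']; simp; omega
        · simp [hne a h, h]
      rw [sum_congr rfl e, sum_add_distrib]
      simp; omega
    have h3 : ∑ a ∈ range n, σ.agentPot n a ≤ ∑ a ∈ range n, σ'.agentPot n a + (v - σ.h i) := by
      have e : ∑ a ∈ range n, (if a = i then v - σ.h i else 0) = v - σ.h i := by simp [hi]
      rw [← e, ← sum_add_distrib]
      refine sum_le_sum fun a _ => ?_
      unfold Flow.agentPot
      rw [hr]
      by_cases h : a = i
      · subst h; rw [hi']; simp; split_ifs <;> omega
      · rw [hne a h]; simp [h]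
    unfold Flow.pot
    rw [h2, hl]
    obtain ⟨t, ht⟩ : ∃ t, v - σ.h i = t + 1 := ⟨v - σ.h i - 1, by omega⟩
    rw [ht] at h3 ⊢
    have := Nat.mul_le_mul_left (n + 3) h1
    simp only [mul_add]
    have : t ≤ (n + 3) * t := Nat.le_mul_of_pos_left _ (by omega)
    omega

theorem Flow.Inv.relabelGood {j v : ℕ} (H : σ.Inv n E d c) (hj : j < n) (hv : σ.l j < v)
    (hvn : v ≤ n + 1) (hF : ∀ k ≤ n, σ.f k j ≠ 0 → v ≤ σ.h k + 1)
    (hf : σ'.f = σ.f) (hr : σ'.r = σ.r) (hh : σ'.h = σ.h) (hl : σ'.l = Function.update σ.l j v) :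
    σ'.Inv n E d c ∧ σ.pot n < σ'.pot n := by
  have hle : ∀ a, σ.l a ≤ σ'.l a := by
    intro a; rw [hl]
    by_cases h : a = j
    · subst h; simp; omega
    · simp [h]
  have hj' : σ'.l j = v := by simp [hl]
  have hne : ∀ a, a ≠ j → σ'.l a = σ.l a := fun a h => by simp [hl, h]
  constructor
  · refine ⟨by rw [hf]; exact H.nonneg, by rw [hf]; exact H.supp, by rw [hf]; exact H.col,
      by rw [hr]; exact H.r_nonneg, by rw [hf, hr]; exact H.row, ?_, ?_, by rw [hh]; exact H.h_dummy,
      by rw [hh]; exact H.h_le, fun b hb => (H.l_pos b hb).trans (hle b), ?_⟩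
    · intro a ha b hb hab
      rw [hh]; exact (H.edge a ha b hb hab).trans (hle b)
    · intro a ha b hb hab
      rw [hf] at hab; rw [hh]
      by_cases h : b = j
      · subst h; rw [hj']; exact hF a ha hab
      · rw [hne b h]; exact H.holder a ha b hb hab
    · intro a ha
      by_cases h : a = j
      · rw [h, hj']; exact hvn
      · rw [hne a h]; exact H.l_le a ha
  · have h1 : ∑ p ∈ range (n + 1) ×ˢ range n, σ.pairPot p.1 p.2 ≤
        ∑ p ∈ range (n + 1) ×ˢ range n, σ'.pairPot p.1 p.2 := by
      refine sum_le_sum fun p _ => ?_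
      unfold Flow.pairPot
      rw [hf, hh]
      have := hle p.2
      by_cases h0 : σ.f p.1 p.2 = 0
      · simp only [h0, true_and]; split_ifs <;> omega
      · simp [h0]
    have h2 : ∑ a ∈ range n, σ.l a < ∑ a ∈ range n, σ'.l a :=
      sum_lt_sum (fun a _ => hle a) ⟨j, by simpa using hj, by rw [hj']; exact hv⟩
    have h3 : ∑ a ∈ range n, σ'.agentPot n a = ∑ a ∈ range n, σ.agentPot n a := by
      refine sum_congr rfl fun a _ => ?_
      unfold Flow.agentPot
      rw [hr, hh]
    unfold Flow.pot
    rw [h3, hh]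
    refine Nat.add_lt_add_right (Nat.mul_lt_mul_of_pos_left ?_ (by omega)) _
    omega

/-- In a stable state every label value from the top downwards that occurs forces the next lower
one to occur, so the `n` agents cannot use both the values `n` and `n + 1`. -/
theorem Flow.Inv.label_ne_of_stable (H : σ.Inv n E d c) (hs : σ.Stable n E)
    (htop : ∃ i < n, σ.h i = n + 1) : ∀ i < n, σ.h i ≠ n := by
  intro i hi hin
  have step : ∀ v, 1 ≤ v → v + 1 ≤ n → (∃ a < n, σ.h a = v + 1) → ∃ a < n, σ.h a = v := by
    rintro v hv hvn ⟨a, ha, hav⟩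
    rcases hs.h a ha with h | ⟨j, hj, -, hl⟩
    · omega
    · rcases hs.l j hj with h | ⟨k, hk, -, hl'⟩
      · omega
      · refine ⟨k, lt_of_le_of_ne hk ?_, by omega⟩
        rintro rfl
        have := H.h_dummy; omega
  have all : ∀ t, t < n → ∃ a < n, σ.h a = n - t := by
    intro t
    induction t with
    | zero => exact fun _ => ⟨i, hi, by omega⟩
    | succ t ih =>
      intro ht
      obtain ⟨a, ha, hat⟩ := ih (by omega)
      exact step _ (by omega) (by omega) ⟨a, ha, by omega⟩
  have hsub : Icc 1 (n + 1) ⊆ (range n).image σ.h := by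
    intro v hv
    rw [mem_Icc] at hv
    rw [mem_image]
    by_cases h : v = n + 1
    · obtain ⟨a, ha, hat⟩ := htop
      exact ⟨a, by simpa using ha, by omega⟩
    · obtain ⟨a, ha, hat⟩ := all (n - v) (by omega)
      exact ⟨a, by simpa using ha, by omega⟩
  have h1 := card_le_card hsub
  have h2 := card_image_le (s := range n) (f := σ.h)
  simp at h1 h2
  omega

theorem Flow.Inv.good_top (H : σ.Inv n E d c) {i j : ℕ} (hi : i < n) (hj : j < n) (hE : E i j)
    (h : σ.h i = n + 1) : σ.l j = n + 1 :=
  le_antisymm (H.l_le j hj) (h ▸ H.edge i hi j hj hE)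

theorem Flow.Inv.holder_top (H : σ.Inv n E d c) (hs : σ.Stable n E)
    (htop : ∃ i < n, σ.h i = n + 1) {k j : ℕ} (hk : k ≤ n) (hj : j < n) (hf : σ.f k j ≠ 0)
    (h : σ.l j = n + 1) : k < n ∧ σ.h k = n + 1 := by
  have h1 := H.holder k hk j hj hf
  have h2 := H.h_le k hk
  have hkn : k < n := by
    refine lt_of_le_of_ne hk ?_
    rintro rfl
    have := H.h_dummy
    obtain ⟨i, hi, -⟩ := htop
    omega
  have h3 := H.label_ne_of_stable hs htop k hkn
  exact ⟨hkn, by omega⟩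

theorem Flow.Inv.active_top (H : σ.Inv n E d c) (hs : σ.Stable n E) {i : ℕ} (hi : i < n)
    (hr : 0 < σ.r i) : σ.h i = n + 1 := by
  by_contra hne
  rcases hs.h i hi with h | ⟨j, hj, hE, hl⟩
  · exact hne h
  · rcases hs.l j hj with h | ⟨k, hk, hf, hl'⟩
    · omega
    · exact hs.push i hi j hj k hk
        ⟨hE, hr, lt_of_le_of_ne (H.nonneg k hk j hj) (Ne.symm hf), hl.symm, hl'⟩

/-- In a part of the market that no edge leaves, the total capacity of the top goods equals what the
top agents hold. -/
theorem Flow.Inv.sum_top (H : σ.Inv n E d c) (hs : σ.Stable n E)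
    (htop : ∃ i < n, σ.h i = n + 1) (A G : ℕ → Prop)
    [DecidablePred A] [DecidablePred G]
    (hAG : ∀ i < n, ∀ j < n, E i j → (A i ↔ G j)) :
    ∑ j ∈ range n with G j ∧ σ.l j = n + 1, c j =
      ∑ i ∈ range n with A i ∧ σ.h i = n + 1, (d i - σ.r i) := by
  have e1 : ∀ j ∈ range n, G j ∧ σ.l j = n + 1 →
      c j = ∑ i ∈ range n with A i ∧ σ.h i = n + 1, σ.f i j := by
    intro j hj ⟨hG, hl⟩
    have hj' : j < n := by simpa using hj
    rw [← H.col j hj', sum_filter, sum_range_succ]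
    have : σ.f n j = 0 := by
      by_contra h
      exact absurd (H.holder_top hs htop le_rfl hj' h hl).1 (lt_irrefl _)
    rw [this, add_zero]
    refine sum_congr rfl fun i hi => ?_
    have hi' : i < n := by simpa using hi
    split_ifs with h
    · rfl
    · by_contra h'
      exact h ⟨(hAG i hi' j hj' (H.supp i hi' j hj' h')).mpr hG,
        (H.holder_top hs htop hi'.le hj' h' hl).2⟩
  have e2 : ∀ i ∈ range n, A i ∧ σ.h i = n + 1 →
      d i - σ.r i = ∑ j ∈ range n with G j ∧ σ.l j = n + 1, σ.f i j := by
    intro i hi ⟨hA, hh⟩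
    have hi' : i < n := by simpa using hi
    rw [← H.row i hi'.le, add_sub_cancel_right, sum_filter]
    refine sum_congr rfl fun j hj => ?_
    have hj' : j < n := by simpa using hj
    split_ifs with h
    · rfl
    · by_contra h'
      have hE := H.supp i hi' j hj' h'
      exact h ⟨(hAG i hi' j hj' hE).mp hA, H.good_top hi' hj' hE hh⟩
  rw [sum_congr rfl (fun j hj => e1 j (mem_filter.mp hj).1 (mem_filter.mp hj).2),
    sum_congr rfl (fun i hi => e2 i (mem_filter.mp hi).1 (mem_filter.mp hi).2), sum_comm]

/-- If, in a part of the market that no edge leaves, all demands can be met at all, then a stable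
flow meets them. -/
theorem Flow.Inv.r_eq_zero (H : σ.Inv n E d c) (hs : σ.Stable n E) (A G : ℕ → Prop)
    [DecidablePred A] [DecidablePred G]
    (hAG : ∀ i < n, ∀ j < n, E i j → (A i ↔ G j)) {z : ℕ → ℕ → ℚ}
    (z0 : ∀ i < n, ∀ j < n, 0 ≤ z i j) (zE : ∀ i < n, ∀ j < n, z i j ≠ 0 → A i → E i j)
    (zd : ∀ i < n, A i → ∑ j ∈ range n, z i j = d i)
    (zc : ∀ j < n, G j → ∑ i ∈ range n, z i j ≤ c j) : ∀ i < n, A i → σ.r i = 0 := by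
  intro i0 hi0 hA0
  by_contra hne
  have hpos : 0 < σ.r i0 := lt_of_le_of_ne (H.r_nonneg i0 hi0.le) (Ne.symm hne)
  have hi0top := H.active_top hs hi0 hpos
  have key := H.sum_top hs ⟨i0, hi0, hi0top⟩ A G hAG
  have h1 : ∑ i ∈ range n with A i ∧ σ.h i = n + 1, d i ≤
      ∑ j ∈ range n with G j ∧ σ.l j = n + 1, c j := by
    calc ∑ i ∈ range n with A i ∧ σ.h i = n + 1, d i
        = ∑ i ∈ range n with A i ∧ σ.h i = n + 1,
            ∑ j ∈ range n with G j ∧ σ.l j = n + 1, z i j := by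
          refine sum_congr rfl fun i hi => ?_
          obtain ⟨hi1, hA, hi2⟩ := mem_filter.mp hi
          have hi' : i < n := by simpa using hi1
          rw [← zd i hi' hA, sum_filter]
          refine sum_congr rfl fun j hj => ?_
          have hj' : j < n := by simpa using hj
          split_ifs with h
          · rfl
          · by_contra h'
            have hE := zE i hi' j hj' h' hA
            exact h ⟨(hAG i hi' j hj' hE).mp hA, H.good_top hi' hj' hE hi2⟩
      _ = ∑ j ∈ range n with G j ∧ σ.l j = n + 1,
            ∑ i ∈ range n with A i ∧ σ.h i = n + 1, z i j := sum_comm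
      _ ≤ ∑ j ∈ range n with G j ∧ σ.l j = n + 1, c j := by
          refine sum_le_sum fun j hj => ?_
          have hj' : j < n := by simpa using (mem_filter.mp hj).1
          refine le_trans (sum_le_sum_of_subset_of_nonneg (filter_subset _ _) ?_)
            (zc j hj' (mem_filter.mp hj).2.1)
          intro i hi _
          exact z0 i (by simpa using hi) j hj'
  have h2 : ∑ i ∈ range n with A i ∧ σ.h i = n + 1, (d i - σ.r i) <
      ∑ i ∈ range n with A i ∧ σ.h i = n + 1, d i := by
    refine sum_lt_sum ?_ ⟨i0, by simp [hi0, hi0top, hA0], by linarith⟩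
    intro i hi
    have hi' : i < n := by simpa using (mem_filter.mp hi).1
    have := H.r_nonneg i hi'.le
    linarith
  linarith

/-- If, in a part of the market that no edge leaves, total demand equals total capacity and all
demands are met, then no capacity is left. -/
theorem Flow.Inv.dummy_eq_zero (H : σ.Inv n E d c) (A G : ℕ → Prop)
    [DecidablePred A] [DecidablePred G]
    (hAG : ∀ i < n, ∀ j < n, E i j → (A i ↔ G j)) (hr : ∀ i < n, σ.r i = 0)
    (hsum : ∑ i ∈ range n with A i, d i = ∑ j ∈ range n with G j, c j) :
    ∀ j < n, G j → σ.f n j = 0 := by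
  have h1 : ∑ i ∈ range n with A i, d i =
      ∑ j ∈ range n with G j, ∑ i ∈ range n, σ.f i j := by
    have e : ∀ i ∈ range n, A i → d i = ∑ j ∈ range n with G j, σ.f i j := by
      intro i hi hA
      have hi' : i < n := by simpa using hi
      rw [← H.row i hi'.le, hr i hi', add_zero, sum_filter]
      refine sum_congr rfl fun j hj => ?_
      have hj' : j < n := by simpa using hj
      split_ifs with h
      · rfl
      · by_contra h'
        exact h ((hAG i hi' j hj' (H.supp i hi' j hj' h')).mp hA)
    rw [sum_congr rfl fun i hi => e i (mem_filter.mp hi).1 (mem_filter.mp hi).2, sum_comm]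
    refine sum_congr rfl fun j hj => ?_
    have hj' : j < n := by simpa using (mem_filter.mp hj).1
    rw [sum_filter]
    refine sum_congr rfl fun i hi => ?_
    have hi' : i < n := by simpa using hi
    split_ifs with h
    · rfl
    · by_contra h'
      exact h ((hAG i hi' j hj' (H.supp i hi' j hj' (Ne.symm h'))).mpr (mem_filter.mp hj).2)
  have h2 : ∑ j ∈ range n with G j, σ.f n j = 0 := by
    have : ∑ j ∈ range n with G j, c j =
        ∑ j ∈ range n with G j, (∑ i ∈ range n, σ.f i j + σ.f n j) := by
      refine sum_congr rfl fun j hj => ?_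
      rw [← H.col j (by simpa using (mem_filter.mp hj).1), sum_range_succ]
    rw [sum_add_distrib] at this
    linarith
  intro j hj hG
  refine (sum_eq_zero_iff_of_nonneg fun j hj => ?_).mp h2 j (by simp [hj, hG])
  exact H.nonneg n le_rfl j (by simpa using (mem_filter.mp hj).1)

end

end ADHZ

namespace ADHZ

open Finset

/-! ### Equilibria of markets with two utility levels -/

/-- A certificate for an equilibrium with prices `p` and budgets `b`, where `L i j` says that agent
`i` likes good `j`: `q i` is the price at which agent `i` buys liked goods, and `y` says how much of
them.  The rest of the goods costs nothing and can be handed out arbitrarily. -/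
structure EqCert (n : ℕ) (L : ℕ → ℕ → Prop) (b p q : ℕ → ℚ) (y : ℕ → ℕ → ℚ) : Prop where
  price_nonneg : ∀ j < n, 0 ≤ p j
  nonneg : ∀ i < n, ∀ j < n, 0 ≤ y i j
  supp : ∀ i < n, ∀ j < n, y i j ≠ 0 → L i j ∧ p j = q i
  liked : ∀ i < n, ∀ j < n, L i j → q i ≤ p j
  full : ∀ i < n, q i ≤ b i → ∑ j ∈ range n, y i j = 1
  part : ∀ i < n, b i < q i → q i * ∑ j ∈ range n, y i j = b i
  col_le : ∀ j < n, ∑ i ∈ range n, y i j ≤ 1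
  col_eq : ∀ j < n, 0 < p j → ∑ i ∈ range n, y i j = 1

/-- The allocation that belongs to a certificate: the leftovers of the goods are distributed in
proportion to what the agents still lack. -/
def fillUp (n : ℕ) (y : ℕ → ℕ → ℚ) (i j : ℕ) : ℚ :=
  y i j + (1 - ∑ j' ∈ range n, y i j') * (1 - ∑ i' ∈ range n, y i' j) /
    ∑ j' ∈ range n, (1 - ∑ i' ∈ range n, y i' j')

section Cert

variable {n : ℕ} {L : ℕ → ℕ → Prop} {b b' p p' q q' : ℕ → ℚ} {y y' : ℕ → ℕ → ℚ}

theorem EqCert.row_le (H : EqCert n L b p q y) (hb : ∀ i < n, 0 < b i) {i : ℕ} (hi : i < n) :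
    ∑ j ∈ range n, y i j ≤ 1 := by
  rcases le_or_gt (q i) (b i) with h | h
  · exact (H.full i hi h).le
  · have h1 := H.part i hi h
    have h2 := hb i hi
    by_contra h3
    push Not at h3
    nlinarith

theorem EqCert.fillUp_nonneg (H : EqCert n L b p q y) (hb : ∀ i < n, 0 < b i) {i j : ℕ}
    (hi : i < n) (hj : j < n) : 0 ≤ fillUp n y i j := by
  have h1 := H.row_le hb hi
  have h2 := H.col_le j hj
  have h3 : 0 ≤ ∑ j' ∈ range n, (1 - ∑ i' ∈ range n, y i' j') :=
    sum_nonneg fun j' hj' => sub_nonneg.mpr (H.col_le j' (by simpa using hj'))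
  exact add_nonneg (H.nonneg i hi j hj)
    (div_nonneg (mul_nonneg (sub_nonneg.mpr h1) (sub_nonneg.mpr h2)) h3)

theorem sum_leftover_eq (n : ℕ) (y : ℕ → ℕ → ℚ) :
    ∑ j ∈ range n, (1 - ∑ i ∈ range n, y i j) = ∑ i ∈ range n, (1 - ∑ j ∈ range n, y i j) := by
  rw [sum_sub_distrib, sum_sub_distrib, sum_comm]

theorem EqCert.fillUp_row (H : EqCert n L b p q y) (hb : ∀ i < n, 0 < b i) {i : ℕ}
    (hi : i < n) : ∑ j ∈ range n, fillUp n y i j = 1 := by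
  unfold fillUp
  rw [sum_add_distrib, ← sum_div, ← mul_sum]
  by_cases hR : ∑ j' ∈ range n, (1 - ∑ i' ∈ range n, y i' j') = 0
  · have h0 : ∀ a ∈ range n, 0 ≤ 1 - ∑ j ∈ range n, y a j := fun a ha =>
      sub_nonneg.mpr (H.row_le hb (by simpa using ha))
    have := (sum_eq_zero_iff_of_nonneg h0).mp (by rw [← sum_leftover_eq, hR]) i (by simpa using hi)
    rw [this, zero_mul, zero_div]; linarith
  · rw [mul_div_assoc, div_self hR]; ring

theorem EqCert.fillUp_col (H : EqCert n L b p q y) {j : ℕ} (hj : j < n) :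
    ∑ i ∈ range n, fillUp n y i j = 1 := by
  unfold fillUp
  rw [sum_add_distrib, ← sum_div, ← sum_mul, ← sum_leftover_eq]
  by_cases hR : ∑ j' ∈ range n, (1 - ∑ i' ∈ range n, y i' j') = 0
  · have h0 : ∀ a ∈ range n, 0 ≤ 1 - ∑ i ∈ range n, y i a := fun a ha =>
      sub_nonneg.mpr (H.col_le a (by simpa using ha))
    have := (sum_eq_zero_iff_of_nonneg h0).mp hR j (by simpa using hj)
    rw [this, mul_zero, zero_div]; linarith
  · rw [mul_comm, mul_div_assoc, div_self hR]; ring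

/-- An agent that lacks something has no free good among the liked ones. -/
theorem EqCert.fillUp_of_liked (H : EqCert n L b p q y) (hb : ∀ i < n, 0 < b i) {i j : ℕ}
    (hi : i < n) (hj : j < n) (hL : L i j) : fillUp n y i j = y i j := by
  unfold fillUp
  rcases le_or_gt (q i) (b i) with h | h
  · rw [H.full i hi h]; simp
  · have : 0 < p j := ((hb i hi).trans h).trans_le (H.liked i hi j hj hL)
    rw [H.col_eq j hj this]; simp

theorem EqCert.sum_price_mul (H : EqCert n L b p q y) {i : ℕ} (hi : i < n) :
    ∑ j ∈ range n, p j * fillUp n y i j = q i * ∑ j ∈ range n, y i j := by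
  rw [mul_sum]
  refine sum_congr rfl fun j hj => ?_
  have hj' : j < n := by simpa using hj
  have h1 : p j * y i j = q i * y i j := by
    by_cases h : y i j = 0
    · simp [h]
    · rw [(H.supp i hi j hj' h).2]
  have h2 : p j * (1 - ∑ i' ∈ range n, y i' j) = 0 := by
    rcases (H.price_nonneg j hj').eq_or_lt with h | h
    · rw [← h, zero_mul]
    · rw [H.col_eq j hj' h]; simp
  unfold fillUp
  rw [mul_add, h1, mul_div_assoc', mul_left_comm, h2, mul_zero, zero_div, add_zero]

theorem EqCert.spending_le (H : EqCert n L b p q y) {i : ℕ} (hi : i < n) :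
    q i * ∑ j ∈ range n, y i j ≤ b i := by
  rcases le_or_gt (q i) (b i) with h | h
  · rw [H.full i hi h, mul_one]; exact h
  · exact (H.part i hi h).le

theorem EqCert.sum_price_le (H : EqCert n L b p q y) :
    ∑ j ∈ range n, p j ≤ ∑ i ∈ range n, b i := by
  calc ∑ j ∈ range n, p j = ∑ j ∈ range n, ∑ i ∈ range n, p j * fillUp n y i j := by
        refine sum_congr rfl fun j hj => ?_
        rw [← mul_sum, H.fillUp_col (by simpa using hj), mul_one]
    _ = ∑ i ∈ range n, ∑ j ∈ range n, p j * fillUp n y i j := sum_comm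
    _ ≤ ∑ i ∈ range n, b i := by
        refine sum_le_sum fun i hi => ?_
        have hi' : i < n := by simpa using hi
        rw [H.sum_price_mul hi']
        exact H.spending_le hi'

/-- If the budgets do not decrease, then the pointwise maximum of the old and the new equilibrium
prices is again an equilibrium.  The agents that used to buy the goods whose price would fall would
be willing to buy at least as much of these goods now; as they bought them completely, they get
the same amounts, which is possible only if they can afford a full unit of liked goods even at the
old prices.  So they can stay with their old bundles. -/
theorem EqCert.max (H : EqCert n L b p q y) (H' : EqCert n L b' p' q' y')
    (hb : ∀ i < n, 0 < b i) (hbb : ∀ i < n, b i ≤ b' i) :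
    ∃ q'' y'', EqCert n L b' (fun j => Max.max (p j) (p' j)) q'' y'' := by
  classical
  let S : ℕ → Prop := fun i => ∃ j < n, p' j < p j ∧ y i j ≠ 0
  have hb' : ∀ i < n, 0 < b' i := fun i hi => (hb i hi).trans_le (hbb i hi)
  have hSq : ∀ i < n, S i → q' i < q i := by
    rintro i hi ⟨j, hj, hpj, hy⟩
    obtain ⟨hL, hq⟩ := H.supp i hi j hj hy
    exact (H'.liked i hi j hj hL).trans_lt (hq ▸ hpj)
  have hSq' : ∀ i < n, S i → ∀ j < n, y' i j ≠ 0 → p' j < p j := by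
    intro i hi hS j hj hy
    obtain ⟨hL, hq⟩ := H'.supp i hi j hj hy
    have := H.liked i hi j hj hL
    have := hSq i hi hS
    rw [hq]; linarith
  -- members of `S` buy at lower prices now, so they buy at least as much as before
  have hα : ∀ i < n, S i → ∑ j ∈ range n, y i j ≤ ∑ j ∈ range n, y' i j := by
    intro i hi hS
    rcases le_or_gt (q' i) (b' i) with h | h
    · rw [H'.full i hi h]; exact H.row_le hb hi
    · have h1 := H'.part i hi h
      have h2 := hSq i hi hS
      have h3 := H.part i hi (((hbb i hi).trans_lt h).trans h2)
      have h4 := hb i hi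
      have h5 := hbb i hi
      by_contra hc
      push Not at hc
      have h6 : 0 < ∑ j ∈ range n, y' i j := by
        have : 0 < q' i := (hb' i hi).trans h
        by_contra h7
        push Not at h7
        have := mul_nonpos_of_nonneg_of_nonpos this.le h7
        linarith
      nlinarith
  -- `∑_S y ≤ ∑_S y'` is at most the number of goods whose price falls, and these goods were sold
  -- completely to `S`, so that the number is at most `∑_S y`; hence equality holds throughout
  have c1 : ∑ i ∈ range n with S i, ∑ j ∈ range n, y' i j =
      ∑ j ∈ range n with p' j < p j, ∑ i ∈ range n with S i, y' i j := by
    rw [sum_comm (s := (range n).filter fun j => p' j < p j)]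
    refine sum_congr rfl fun i hi => ?_
    obtain ⟨hi1, hS⟩ := mem_filter.mp hi
    rw [sum_filter]
    refine sum_congr rfl fun j hj => ?_
    split_ifs with h
    · rfl
    · by_contra h'
      exact h (hSq' i (by simpa using hi1) hS j (by simpa using hj) h')
  have c2 : ∀ j ∈ (range n).filter (fun j => p' j < p j),
      ∑ i ∈ range n with S i, y' i j ≤ ∑ i ∈ range n, y' i j := by
    intro j hj
    refine sum_le_sum_of_subset_of_nonneg (filter_subset _ _) fun i hi _ => ?_
    exact H'.nonneg i (by simpa using hi) j (by simpa using (mem_filter.mp hj).1)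
  have c3 : ∀ j ∈ (range n).filter (fun j => p' j < p j),
      ∑ i ∈ range n with S i, y i j = 1 := by
    intro j hj
    obtain ⟨hj1, hj2⟩ := mem_filter.mp hj
    have hj' : j < n := by simpa using hj1
    rw [← H.col_eq j hj' ((H'.price_nonneg j hj').trans_lt hj2), sum_filter]
    refine sum_congr rfl fun i hi => ?_
    split_ifs with h
    · rfl
    · by_contra h'
      exact h ⟨j, hj', hj2, Ne.symm h'⟩
  have c4 : ∀ i ∈ (range n).filter S, ∑ j ∈ range n with p' j < p j, y i j ≤
      ∑ j ∈ range n, y i j := by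
    intro i hi
    refine sum_le_sum_of_subset_of_nonneg (filter_subset _ _) fun j hj _ => ?_
    exact H.nonneg i (by simpa using (mem_filter.mp hi).1) j (by simpa using hj)
  have hcol' : ∀ j ∈ (range n).filter (fun j => p' j < p j), ∑ i ∈ range n, y' i j ≤ 1 :=
    fun j hj => H'.col_le j (by simpa using (mem_filter.mp hj).1)
  have hα' : ∀ i ∈ (range n).filter S, ∑ j ∈ range n, y i j ≤ ∑ j ∈ range n, y' i j :=
    fun i hi => hα i (by simpa using (mem_filter.mp hi).1) (mem_filter.mp hi).2
  have d1 := sum_le_sum c2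
  have d2 := sum_le_sum hcol'
  have d3 : ∑ j ∈ range n with p' j < p j, (1 : ℚ) =
      ∑ i ∈ range n with S i, ∑ j ∈ range n with p' j < p j, y i j := by
    rw [sum_comm]; exact (sum_congr rfl c3).symm
  have d4 := sum_le_sum c4
  have d5 := sum_le_sum hα'
  have f2 := (sum_eq_sum_iff_of_le c2).mp (by linarith)
  have f4 := (sum_eq_sum_iff_of_le c4).mp (by linarith)
  have f5 := (sum_eq_sum_iff_of_le hα').mp (by linarith)
  -- by the equalities, only members of `S` buy goods whose price falls, they used to buy nothing
  -- else, and each of them gets the same amount as before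
  have g2 : ∀ i < n, ¬ S i → ∀ j < n, p' j < p j → y' i j = 0 := by
    intro i hi hS j hj hpj
    have h1 := f2 j (by simp [hj, hpj])
    rw [sum_filter] at h1
    have h2 := (sum_eq_sum_iff_of_le (s := range n)
      (f := fun a => if S a then y' a j else 0) (g := fun a => y' a j) ?_).mp h1 i (by simpa using hi)
    · simpa [hS] using h2.symm
    · intro a ha
      have := H'.nonneg a (by simpa using ha) j hj
      split_ifs <;> simp [this]
  have g4 : ∀ i < n, S i → ∀ j < n, ¬ p' j < p j → y i j = 0 := by
    intro i hi hS j hj hpj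
    have h1 := f4 i (by simp [hi, hS])
    rw [sum_filter] at h1
    have h2 := (sum_eq_sum_iff_of_le (s := range n)
      (f := fun a => if p' a < p a then y i a else 0) (g := fun a => y i a) ?_).mp h1 j
        (by simpa using hj)
    · simpa [hpj] using h2.symm
    · intro a ha
      have := H.nonneg i hi a (by simpa using ha)
      split_ifs <;> simp [this]
  -- a member of `S` that had spent its whole budget could buy strictly more at the lower price
  have g5 : ∀ i < n, S i → q i ≤ b i := by
    intro i hi hS
    by_contra hc
    push Not at hc
    have h1 := f5 i (by simp [hi, hS])
    have h2 := H.part i hi hc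
    have h3 := hSq i hi hS
    have h4 := hb i hi
    have h5 := hbb i hi
    have hpos : 0 < ∑ j ∈ range n, y i j := by
      by_contra h7
      push Not at h7
      have := mul_nonpos_of_nonneg_of_nonpos (h4.trans hc).le h7
      linarith
    rcases le_or_gt (q' i) (b' i) with h | h
    · rw [H'.full i hi h] at h1
      rw [h1, mul_one] at h2
      linarith
    · have h6 := H'.part i hi h
      rw [← h1] at h6
      nlinarith
  -- members of `S` keep their old bundles, and all others take their new ones
  refine ⟨fun i => if S i then q i else q' i, fun i j => if S i then y i j else y' i j, ?_⟩
  refine ⟨fun j hj => le_max_of_le_left (H.price_nonneg j hj), ?_, ?_, ?_, ?_, ?_, ?_, ?_⟩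
  · intro i hi j hj
    by_cases hS : S i
    · simpa [hS] using H.nonneg i hi j hj
    · simpa [hS] using H'.nonneg i hi j hj
  · intro i hi j hj hne
    by_cases hS : S i
    · simp only [hS, if_true] at hne ⊢
      have hpj : p' j < p j := by
        by_contra h; exact hne (g4 i hi hS j hj h)
      rw [max_eq_left hpj.le]
      exact H.supp i hi j hj hne
    · simp only [hS, if_false] at hne ⊢
      have hpj : ¬ p' j < p j := fun h => hne (g2 i hi hS j hj h)
      rw [max_eq_right (not_lt.mp hpj)]
      exact H'.supp i hi j hj hne
  · intro i hi j hj hL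
    by_cases hS : S i
    · simpa [hS] using Or.inl (H.liked i hi j hj hL)
    · simpa [hS] using Or.inr (H'.liked i hi j hj hL)
  · intro i hi hq
    by_cases hS : S i
    · simp only [hS, if_true] at hq ⊢
      exact H.full i hi (g5 i hi hS)
    · simp only [hS, if_false] at hq ⊢
      exact H'.full i hi hq
  · intro i hi hq
    by_cases hS : S i
    · simp only [hS, if_true] at hq ⊢
      have := g5 i hi hS
      have := hbb i hi
      linarith
    · simp only [hS, if_false] at hq ⊢
      exact H'.part i hi hq
  all_goals
    intro j hj
    have hsum : ∑ i ∈ range n, (if S i then y i j else y' i j) =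
        if p' j < p j then 1 else ∑ i ∈ range n, y' i j := by
      split_ifs with hpj
      · rw [← c3 j (by simp [hj, hpj]), sum_filter]
        refine sum_congr rfl fun i hi => ?_
        by_cases hS : S i
        · simp [hS]
        · simp [hS, g2 i (by simpa using hi) hS j hj hpj]
      · refine sum_congr rfl fun i hi => ?_
        have hi' : i < n := by simpa using hi
        by_cases hS : S i
        · simp only [hS, if_true]
          rw [g4 i hi' hS j hj hpj]
          by_contra h
          exact hpj (hSq' i hi' hS j hj (Ne.symm h))
        · simp [hS]
    simp only [hsum]
  · split_ifs
    · exact le_rfl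
    · exact H'.col_le j hj
  · intro hpos
    split_ifs with hpj
    · rfl
    · rw [max_eq_right (not_lt.mp hpj)] at hpos
      exact H'.col_eq j hj hpos

end Cert

/-- Good `j` is among the goods that agent `i` likes best. -/
def Market.Likes {n : ℕ} (M : Market n) (i j : ℕ) : Prop :=
  ∃ (hi : i < n) (hj : j < n), ∀ j', M.u ⟨i, hi⟩ j' ≤ M.u ⟨i, hi⟩ ⟨j, hj⟩

theorem Market.IsBivalued.exists_values {n : ℕ} {M : Market n} (hM : M.IsBivalued) (i : Fin n) :
    ∃ v w : ℚ, w < v ∧ (∀ j : Fin n, M.Likes i j → M.u i j = v) ∧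
      ∀ j : Fin n, ¬ M.Likes i j → M.u i j = w := by
  obtain ⟨lo, hi, -, hlt, hu⟩ := hM i
  have hL : ∀ j : Fin n, M.Likes i j ↔ ∀ j', M.u i j' ≤ M.u i j := fun j =>
    ⟨fun ⟨_, _, h⟩ => h, fun h => ⟨i.2, j.2, h⟩⟩
  by_cases hex : ∃ j, M.u i j = hi
  · obtain ⟨j0, h0⟩ := hex
    refine ⟨hi, lo, hlt, fun j hj => ?_, fun j hj => ?_⟩
    · have := (hL j).mp hj j0
      rcases hu j with h | h
      · rw [h, h0] at this; linarith
      · exact h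
    · rcases hu j with h | h
      · exact h
      · refine absurd ((hL j).mpr fun j' => ?_) hj
        rcases hu j' with h' | h' <;> rw [h, h']
        exact hlt.le
  · push Not at hex
    have hlo : ∀ j, M.u i j = lo := fun j => (hu j).resolve_right (hex j)
    exact ⟨lo, lo - 1, by linarith, fun j _ => hlo j, fun j hj =>
      absurd ((hL j).mpr fun j' => by rw [hlo, hlo]) hj⟩

theorem exists_likes {n : ℕ} (M : Market n) {i : ℕ} (hi : i < n) :
    ∃ j < n, M.Likes i j := by
  have : Nonempty (Fin n) := ⟨⟨i, hi⟩⟩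
  obtain ⟨j, hj⟩ := Finite.exists_max (M.u ⟨i, hi⟩)
  exact ⟨j, j.2, hi, j.2, hj⟩

/-- A certificate yields a Hylland-Zeckhauser equilibrium. -/
theorem EqCert.isHZEquilibrium {n : ℕ} {M : Market n} (hM : M.IsBivalued) {b p q : ℕ → ℚ}
    {y : ℕ → ℕ → ℚ} (H : EqCert n M.Likes b p q y) (hb : ∀ i < n, 0 < b i) :
    IsHZEquilibrium M.utility (fun i => (b i : ℝ)) (fun i j => (fillUp n y i j : ℝ))
      (fun j => (p j : ℝ)) := by
  classical
  have pnn : ∀ j : Fin n, (0 : ℝ) ≤ (p j : ℝ) := fun j => by exact_mod_cast H.price_nonneg j j.2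
  have xnn : ∀ i j : Fin n, (0 : ℝ) ≤ (fillUp n y i j : ℝ) := fun i j => by
    exact_mod_cast H.fillUp_nonneg hb i.2 j.2
  have xrow : ∀ i : Fin n, ∑ j : Fin n, (fillUp n y i j : ℝ) = 1 := fun i => by
    have := H.fillUp_row hb i.2
    rw [sum_range] at this
    exact_mod_cast this
  have xcol : ∀ j : Fin n, ∑ i : Fin n, (fillUp n y i j : ℝ) = 1 := fun j => by
    have := H.fillUp_col j.2
    rw [sum_range] at this
    exact_mod_cast this
  have cost : ∀ i : Fin n, ∑ j : Fin n, (p j : ℝ) * (fillUp n y i j : ℝ) =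
      (q i : ℝ) * ((∑ j ∈ range n, y i j : ℚ) : ℝ) := fun i => by
    have := H.sum_price_mul i.2
    rw [sum_range] at this
    exact_mod_cast this
  have spend : ∀ i : Fin n, (q i : ℝ) * ((∑ j ∈ range n, y i j : ℚ) : ℝ) ≤ (b i : ℝ) := fun i => by
    exact_mod_cast H.spending_le i.2
  refine ⟨pnn, ⟨xnn, xrow, xcol⟩, fun i => (cost i).trans_le (spend i), fun i => ?_⟩
  obtain ⟨v, w, hwv, hv, hw⟩ := hM.exists_values i
  set α : ℝ := ((∑ j ∈ range n, y i j : ℚ) : ℝ) with hα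
  -- utility and cost of a bundle in terms of the share of liked goods
  have util : ∀ z : Fin n → ℝ, ∑ j, z j = 1 → ∑ j, M.utility i j * z j =
      w + (v - w) * ∑ j : Fin n, (if M.Likes i j then z j else 0) := by
    intro z hz
    have : ∀ j : Fin n, M.utility i j * z j =
        w * z j + (v - w) * (if M.Likes i j then z j else 0) := by
      intro j
      unfold Market.utility
      split_ifs with h
      · rw [hv j h]; ring
      · rw [hw j h]; ring
    rw [sum_congr rfl fun j _ => this j, sum_add_distrib, ← mul_sum, ← mul_sum, hz, mul_one]
  have low : ∀ z : Fin n → ℝ, IsBundle z →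
      (q i : ℝ) * ∑ j : Fin n, (if M.Likes i j then z j else 0) ≤ ∑ j : Fin n, (p j : ℝ) * z j := by
    intro z hz
    rw [mul_sum]
    refine sum_le_sum fun j _ => ?_
    split_ifs with h
    · have : (q i : ℝ) ≤ p j := by exact_mod_cast H.liked i i.2 j j.2 h
      exact mul_le_mul_of_nonneg_right this (hz.1 j)
    · rw [mul_zero]; exact mul_nonneg (pnn j) (hz.1 j)
  have share_le : ∀ z : Fin n → ℝ, IsBundle z →
      ∑ j : Fin n, (if M.Likes i j then z j else 0) ≤ 1 := by
    intro z hz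
    rw [← hz.2]
    refine sum_le_sum fun j _ => ?_
    split_ifs
    · exact le_rfl
    · exact hz.1 j
  have share : ∑ j : Fin n, (if M.Likes i j then (fillUp n y i j : ℝ) else 0) = α := by
    rw [hα, sum_range]
    push_cast
    refine sum_congr rfl fun j _ => ?_
    split_ifs with h
    · rw [H.fillUp_of_liked hb i.2 j.2 h]
    · by_contra h'
      exact h (H.supp i i.2 j j.2 (fun h0 => h' (by rw [h0]; simp))).1
  have hwv' : (0 : ℝ) < v - w := by exact_mod_cast sub_pos.mpr hwv
  have bx : IsBundle (fun j : Fin n => (fillUp n y i j : ℝ)) := ⟨xnn i, xrow i⟩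
  refine ⟨⟨⟨_, bx, (cost i).trans_le (spend i), rfl⟩, ?_⟩, ⟨_, bx, le_rfl, rfl⟩, ?_⟩
  · rintro _ ⟨z, hz, hcost, rfl⟩
    rw [util z hz.2, util _ bx.2, share]
    have : ∑ j : Fin n, (if M.Likes i j then z j else 0) ≤ α := by
      rcases le_or_gt (q i) (b i) with h | h
      · have : α = 1 := by rw [hα, H.full i i.2 h]; simp
        rw [this]; exact share_le z hz
      · have h1 : (q i : ℝ) * α = b i := by
          rw [hα]; exact_mod_cast H.part i i.2 h
        have h2 : (0 : ℝ) < q i := by exact_mod_cast (hb i i.2).trans h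
        exact le_of_mul_le_mul_left (((low z hz).trans hcost).trans h1.ge) h2
    nlinarith
  · rintro _ ⟨z, hz, hutil, rfl⟩
    rw [util z hz.2, util _ bx.2, share] at hutil
    have h1 : α ≤ ∑ j : Fin n, (if M.Likes i j then z j else 0) := by
      by_contra hc
      push Not at hc
      nlinarith
    rw [cost i]
    refine le_trans ?_ (low z hz)
    rcases le_or_gt 0 (q i) with h | h
    · exact mul_le_mul_of_nonneg_left h1 (by exact_mod_cast h)
    · -- a negative reference price would mean that the agent buys, at that price, a full unit
      have h2 := H.full i i.2 (h.le.trans (hb i i.2).le)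
      obtain ⟨j, hj, hne⟩ : ∃ j ∈ range n, y i j ≠ 0 := by
        by_contra hc
        push Not at hc
        rw [sum_eq_zero hc] at h2
        exact zero_ne_one h2
      have hj' : j < n := by simpa using hj
      have := (H.supp i i.2 j hj' hne).2
      have := H.price_nonneg j hj'
      linarith

end ADHZ

namespace ADHZ

open Finset

/-! ### Certificates from flows -/

/-- The capacity of a good of price `q`, in money; a free good counts in units instead. -/
def cap (q : ℚ) : ℚ := if q = 0 then 1 else q

/-- The demand, in money, of an agent with budget `b` whose liked goods cost `q`; it counts in units
if they are free. -/
def dem (b q : ℚ) : ℚ := if q = 0 then 1 else min b q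

theorem cap_pos {q : ℚ} (h : 0 ≤ q) : 0 < cap q := by
  unfold cap; split_ifs with h0
  · norm_num
  · exact lt_of_le_of_ne h (Ne.symm h0)

theorem dem_nonneg {b q : ℚ} (hb : 0 < b) (hq : 0 ≤ q) : 0 ≤ dem b q := by
  unfold dem; split_ifs
  · norm_num
  · exact le_min hb.le hq

theorem dem_of_le {b q : ℚ} (h : q ≤ b) : dem b q = cap q := by
  unfold dem cap; split_ifs
  · rfl
  · exact min_eq_right h

theorem dem_of_lt {b q : ℚ} (hb : 0 < b) (h : b < q) : dem b q = b := by
  unfold dem; rw [if_neg (hb.trans h).ne', min_eq_left h.le]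

theorem dem_le_cap (b q : ℚ) : dem b q ≤ cap q := by
  unfold dem cap; split_ifs
  · exact le_rfl
  · exact min_le_right _ _

section

variable {n : ℕ} {L E : ℕ → ℕ → Prop} {b p q d c : ℕ → ℚ} {σ : Flow}

theorem Flow.Inv.eqCert (H : σ.Inv n E d c) (hb : ∀ i < n, 0 < b i)
    (hE : ∀ i < n, ∀ j < n, E i j → L i j ∧ p j = q i)
    (hd : ∀ i < n, d i = dem (b i) (q i)) (hc : ∀ j < n, c j = cap (p j))
    (hr : ∀ i < n, σ.r i = 0) (hp : ∀ j < n, 0 ≤ p j)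
    (hL : ∀ i < n, ∀ j < n, L i j → q i ≤ p j)
    (hsat : ∀ j < n, 0 < p j → σ.f n j = 0) :
    EqCert n L b p q fun i j => σ.f i j / cap (p j) := by
  have hne : ∀ i < n, ∀ j < n, σ.f i j / cap (p j) ≠ 0 → E i j := fun i hi j hj h =>
    H.supp i hi j hj fun h0 => h (by rw [h0, zero_div])
  have hrow : ∀ i < n, ∑ j ∈ range n, σ.f i j / cap (p j) = dem (b i) (q i) / cap (q i) := by
    intro i hi
    have h1 := H.row i hi.le
    rw [hr i hi, add_zero, hd i hi] at h1
    rw [← h1, sum_div]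
    refine sum_congr rfl fun j hj => ?_
    by_cases h : σ.f i j = 0
    · rw [h, zero_div, zero_div]
    · rw [(hE i hi j (by simpa using hj) (H.supp i hi j (by simpa using hj) h)).2]
  have hcol : ∀ j < n, ∑ i ∈ range n, σ.f i j / cap (p j) = 1 - σ.f n j / cap (p j) := by
    intro j hj
    have h1 := H.col j hj
    rw [sum_range_succ, hc j hj] at h1
    have h2 := (cap_pos (hp j hj)).ne'
    rw [← sum_div, eq_sub_iff_add_eq, ← add_div, h1, div_self h2]
  refine ⟨hp, ?_, fun i hi j hj h => hE i hi j hj (hne i hi j hj h), hL, ?_, ?_, ?_, ?_⟩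
  · intro i hi j hj
    exact div_nonneg (H.nonneg i hi.le j hj) (cap_pos (hp j hj)).le
  · intro i hi h
    -- a negative reference price cannot occur, since the demand is met by priced goods
    rw [hrow i hi, dem_of_le h]
    refine div_self fun h0 => ?_
    unfold cap at h0
    split_ifs at h0 with h1
    · exact one_ne_zero h0
    · exact h1 h0
  · intro i hi h
    have h0 : 0 < q i := (hb i hi).trans h
    rw [hrow i hi, dem_of_lt (hb i hi) h, cap, if_neg h0.ne', mul_div_assoc', mul_comm,
      mul_div_assoc, div_self h0.ne', mul_one]
  · intro j hj
    rw [hcol j hj]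
    have := div_nonneg (H.nonneg n le_rfl j hj) (cap_pos (hp j hj)).le
    linarith
  · intro j hj h
    rw [hcol j hj, hsat j hj h, zero_div, sub_zero]

/-- At equilibrium prices, a stable flow along the edges to the cheapest liked goods is a
certificate. -/
theorem Flow.Inv.eqCert_of_eqCert (H : σ.Inv n E d c) (hs : σ.Stable n E)
    (hb : ∀ i < n, 0 < b i) (hE : ∀ i < n, ∀ j < n, E i j ↔ L i j ∧ p j = q i)
    (hd : ∀ i < n, d i = dem (b i) (q i)) (hc : ∀ j < n, c j = cap (p j))
    (hL : ∀ i < n, ∀ j < n, L i j → q i ≤ p j) (hq : ∀ i < n, ∃ j < n, L i j ∧ q i = p j)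
    {q' : ℕ → ℚ} {y : ℕ → ℕ → ℚ} (C : EqCert n L b p q' y) :
    (∀ i < n, σ.r i = 0) ∧ EqCert n L b p q fun i j => σ.f i j / cap (p j) := by
  have hp := C.price_nonneg
  -- an agent with a positive budget buys something, hence it buys at its cheapest liked price
  have hqq : ∀ i < n, q' i = q i := by
    intro i hi
    obtain ⟨j, hj, hLj, hqj⟩ := hq i hi
    refine le_antisymm (hqj ▸ C.liked i hi j hj hLj) ?_
    obtain ⟨k, hk, hne⟩ : ∃ k ∈ range n, y i k ≠ 0 := by
      by_contra hcon
      push Not at hcon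
      have h0 := sum_eq_zero hcon
      rcases le_or_gt (q' i) (b i) with h | h
      · have := C.full i hi h
        rw [h0] at this; exact zero_ne_one this
      · have := C.part i hi h
        rw [h0, mul_zero] at this
        exact (hb i hi).ne this
    have hk' : k < n := by simpa using hk
    obtain ⟨h1, h2⟩ := C.supp i hi k hk' hne
    rw [← h2]; exact hL i hi k hk' h1
  have hq0 : ∀ i < n, 0 ≤ q i := by
    intro i hi
    obtain ⟨j, hj, -, hqj⟩ := hq i hi
    rw [hqj]; exact hp j hj
  -- the money flow of the given equilibrium meets all demands, so the stable flow does as well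
  have z0 : ∀ i < n, ∀ j < n, 0 ≤ y i j * cap (p j) := fun i hi j hj =>
    mul_nonneg (C.nonneg i hi j hj) (cap_pos (hp j hj)).le
  have zE : ∀ i < n, ∀ j < n, y i j * cap (p j) ≠ 0 → E i j := by
    intro i hi j hj h
    obtain ⟨h1, h2⟩ := C.supp i hi j hj (left_ne_zero_of_mul h)
    exact (hE i hi j hj).mpr ⟨h1, by rw [h2, hqq i hi]⟩
  have zd : ∀ i < n, ∑ j ∈ range n, y i j * cap (p j) = d i := by
    intro i hi
    have : ∀ j ∈ range n, y i j * cap (p j) = y i j * cap (q i) := by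
      intro j hj
      by_cases h : y i j = 0
      · rw [h, zero_mul, zero_mul]
      · rw [(C.supp i hi j (by simpa using hj) h).2, hqq i hi]
    rw [sum_congr rfl this, ← sum_mul, hd i hi]
    rcases le_or_gt (q i) (b i) with h | h
    · rw [C.full i hi (by rw [hqq i hi]; exact h), one_mul, dem_of_le h]
    · have h1 := C.part i hi (by rw [hqq i hi]; exact h)
      rw [hqq i hi] at h1
      rw [dem_of_lt (hb i hi) h, cap, if_neg ((hb i hi).trans h).ne', mul_comm, h1]
  have zc : ∀ j < n, ∑ i ∈ range n, y i j * cap (p j) ≤ c j := by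
    intro j hj
    rw [← sum_mul, hc j hj]
    exact mul_le_of_le_one_left (cap_pos (hp j hj)).le (C.col_le j hj)
  have hr : ∀ i < n, σ.r i = 0 := fun i hi => H.r_eq_zero hs (fun _ => True) (fun _ => True)
    (by simp) z0 (fun i hi j hj h _ => zE i hi j hj h) (fun i hi _ => zd i hi)
    (fun j hj _ => zc j hj) i hi trivial
  refine ⟨hr, H.eqCert hb (fun i hi j hj => (hE i hi j hj).mp) hd hc hr hp hL ?_⟩
  have hAG : ∀ i < n, ∀ j < n, E i j → (0 < q i ↔ 0 < p j) := by
    intro i hi j hj h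
    rw [((hE i hi j hj).mp h).2]
  refine H.dummy_eq_zero (fun i => 0 < q i) (fun j => 0 < p j) hAG hr ?_
  -- at equilibrium, all of the goods with a positive price are sold
  have e1 : ∀ i ∈ range n, 0 < q i → d i = ∑ j ∈ range n with 0 < p j, y i j * cap (p j) := by
    intro i hi hpos
    have hi' : i < n := by simpa using hi
    rw [← zd i hi', sum_filter]
    refine sum_congr rfl fun j hj => ?_
    split_ifs with h
    · rfl
    · by_contra h'
      exact h ((hAG i hi' j (by simpa using hj) (zE i hi' j (by simpa using hj) h')).mp hpos)
  rw [sum_congr rfl fun i hi => e1 i (mem_filter.mp hi).1 (mem_filter.mp hi).2, sum_comm]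
  refine sum_congr rfl fun j hj => ?_
  obtain ⟨hj1, hpos⟩ := mem_filter.mp hj
  have hj' : j < n := by simpa using hj1
  have hcj : c j = ∑ i ∈ range n, y i j * cap (p j) := by
    rw [← sum_mul, C.col_eq j hj' hpos, one_mul, hc j hj']
  rw [hcj, sum_filter]
  refine sum_congr rfl fun i hi => ?_
  have hi' : i < n := by simpa using hi
  split_ifs with h
  · rfl
  · by_contra h'
    exact h ((hAG i hi' j hj' (zE i hi' j hj' (Ne.symm h'))).mpr hpos)

end

/-! ### The decomposition into blocks -/

/-- The number of goods of block `k`. -/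
def numGoods (n : ℕ) (idG : ℕ → ℕ) (k : ℕ) : ℕ := #{j ∈ range n | idG j = k}

/-- The number of agents of block `k` with a budget above `β`. -/
def numRich (n : ℕ) (b : ℕ → ℚ) (idA : ℕ → ℕ) (k : ℕ) (β : ℚ) : ℕ :=
  #{i ∈ range n | idA i = k ∧ β < b i}

/-- The total budget of the agents of block `k` with budgets up to `β`. -/
def poorBudget (n : ℕ) (b : ℕ → ℚ) (idA : ℕ → ℕ) (k : ℕ) (β : ℚ) : ℚ :=
  ∑ i ∈ range n with idA i = k ∧ b i ≤ β, b i

/-- The price at which the agents with budgets up to `β` spend everything, each other agent pays for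
a full unit, and the goods of the block are just paid for. -/
def blockCand (n : ℕ) (b : ℕ → ℚ) (idA idG : ℕ → ℕ) (k : ℕ) (β : ℚ) : ℚ :=
  poorBudget n b idA k β / ((numGoods n idG k - numRich n b idA k β : ℕ) : ℚ)

/-- The minimum of `hi` and the prices `blockCand` for the budgets of the first agents. -/
def scanPrice (n : ℕ) (b : ℕ → ℚ) (idA idG : ℕ → ℕ) (k : ℕ) (hi : ℚ) : ℕ → ℚ
  | 0 => hi
  | i + 1 => if idA i = k ∧ numRich n b idA k (b i) < numGoods n idG k ∧
        blockCand n b idA idG k (b i) < scanPrice n b idA idG k hi i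
      then blockCand n b idA idG k (b i) else scanPrice n b idA idG k hi i

section

variable {n : ℕ} {b : ℕ → ℚ} {idA idG : ℕ → ℕ} {k : ℕ} {hi : ℚ}

theorem scanPrice_le (m : ℕ) : scanPrice n b idA idG k hi m ≤ hi := by
  induction m with
  | zero => exact le_rfl
  | succ m ih =>
    rw [scanPrice]
    split_ifs with h
    · exact h.2.2.le.trans ih
    · exact ih

theorem scanPrice_le_cand {m i : ℕ} (him : i < m) (hid : idA i = k)
    (hc : numRich n b idA k (b i) < numGoods n idG k) :
    scanPrice n b idA idG k hi m ≤ blockCand n b idA idG k (b i) := by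
  induction m with
  | zero => omega
  | succ m ih =>
    rw [scanPrice]
    rcases Nat.lt_succ_iff_lt_or_eq.mp him with h | rfl
    · split_ifs with h'
      · exact h'.2.2.le.trans (ih h)
      · exact ih h
    · split_ifs with h'
      · exact le_rfl
      · by_contra hcon
        push Not at hcon
        exact h' ⟨hid, hc, hcon⟩

theorem scanPrice_eq (m : ℕ) : scanPrice n b idA idG k hi m = hi ∨ ∃ i < m, idA i = k ∧
    numRich n b idA k (b i) < numGoods n idG k ∧
    scanPrice n b idA idG k hi m = blockCand n b idA idG k (b i) := by
  induction m with
  | zero => exact Or.inl rfl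
  | succ m ih =>
    rw [scanPrice]
    split_ifs with h
    · exact Or.inr ⟨m, by omega, h.1, h.2.1, rfl⟩
    · rcases ih with h' | ⟨i, hi', h'⟩
      · exact Or.inl h'
      · exact Or.inr ⟨i, by omega, h'⟩

theorem sum_min_le (n : ℕ) (b : ℕ → ℚ) (idA : ℕ → ℕ) (k : ℕ) (β q : ℚ) :
    ∑ i ∈ range n with idA i = k, min (b i) q ≤
      poorBudget n b idA k β + numRich n b idA k β * q := by
  have h1 : (numRich n b idA k β : ℚ) * q = ∑ i ∈ range n with idA i = k ∧ β < b i, q := by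
    rw [sum_const, nsmul_eq_mul]; rfl
  rw [h1, poorBudget, sum_filter, sum_filter, sum_filter, ← sum_add_distrib]
  refine sum_le_sum fun i _ => ?_
  by_cases hk : idA i = k
  · rcases le_or_gt (b i) β with h | h
    · simp [hk, h, not_lt.mpr h]
    · simp [hk, h, not_le.mpr h]
  · simp [hk]

/-- The price of a block balances the spending of its agents with the value of its goods, provided
that its goods could be sold at the lower price `lo` and that its agents do not overspend at the
upper price `hi`. -/
theorem scanPrice_spec {lo : ℚ} (hb : ∀ i < n, 0 < b i) (hlo : 0 ≤ lo) (hlh : lo ≤ hi)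
    (hhi : 0 < hi)
    (hU : cap lo * numGoods n idG k ≤ ∑ i ∈ range n with idA i = k, dem (b i) lo)
    (hO : ∑ i ∈ range n with idA i = k, dem (b i) hi ≤ cap hi * numGoods n idG k) :
    0 < scanPrice n b idA idG k hi n ∧ lo ≤ scanPrice n b idA idG k hi n ∧
      ∑ i ∈ range n with idA i = k, min (b i) (scanPrice n b idA idG k hi n) =
        scanPrice n b idA idG k hi n * numGoods n idG k := by
  set p := scanPrice n b idA idG k hi n with hp
  set m := numGoods n idG k with hm
  have hbpos : ∀ i ∈ (range n).filter (fun i => idA i = k), 0 < b i := fun i hi' =>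
    hb i (by simpa using (mem_filter.mp hi').1)
  have hcpos : ∀ i < n, idA i = k → numRich n b idA k (b i) < m →
      0 < ((m - numRich n b idA k (b i) : ℕ) : ℚ) ∧
      ((m - numRich n b idA k (b i) : ℕ) : ℚ) = m - numRich n b idA k (b i) ∧
      0 < poorBudget n b idA k (b i) := by
    intro i hi' hid hc
    refine ⟨by exact_mod_cast Nat.sub_pos_of_lt hc, Nat.cast_sub hc.le, ?_⟩
    refine sum_pos (fun a ha => hb a (by simpa using (mem_filter.mp ha).1)) ⟨i, ?_⟩
    simp [hi', hid]
  have hppos : 0 < p := by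
    rcases scanPrice_eq (n := n) (b := b) (idA := idA) (idG := idG) (k := k) (hi := hi) n with
      h | ⟨i, hi', hid, hc, h⟩
    · rw [hp, h]; exact hhi
    · rw [hp, h]
      obtain ⟨h1, -, h3⟩ := hcpos i hi' hid hc
      exact div_pos h3 h1
  -- as the goods can be sold at the lower price, there are at least as many agents as goods
  have hmcard : (m : ℚ) ≤ #{i ∈ range n | idA i = k} := by
    have h1 : cap lo * m ≤ cap lo * #{i ∈ range n | idA i = k} := by
      refine hU.trans ?_
      rw [mul_comm, ← nsmul_eq_mul]
      exact sum_le_card_nsmul _ _ _ fun i _ => dem_le_cap _ _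
    exact le_of_mul_le_mul_left h1 (cap_pos hlo)
  -- the spending at any price is at most the bound in `sum_min_le`, with equality when the poor are
  -- those who spend everything; the candidates are where these bounds meet the value of the goods
  refine ⟨hppos, ?_, le_antisymm ?_ ?_⟩
  · rcases scanPrice_eq (n := n) (b := b) (idA := idA) (idG := idG) (k := k) (hi := hi) n with
      h | ⟨i, hi', hid, hc, h⟩
    · rw [hp, h]; exact hlh
    · rcases hlo.eq_or_lt with h0 | h0
      · rw [← h0]; exact hppos.le
      · obtain ⟨h1, h2, h3⟩ := hcpos i hi' hid hc
        rw [hp, h, blockCand, le_div_iff₀ h1, h2]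
        have h4 := sum_min_le n b idA k (b i) lo
        simp only [dem, cap, h0.ne', if_false] at hU
        linarith
  · rcases scanPrice_eq (n := n) (b := b) (idA := idA) (idG := idG) (k := k) (hi := hi) n with
      h | ⟨i, hi', hid, hc, h⟩
    · rw [hp, h]
      simpa only [dem, cap, hhi.ne', if_false] using hO
    · obtain ⟨h1, h2, h3⟩ := hcpos i hi' hid hc
      have h4 := sum_min_le n b idA k (b i) p
      have h5 : p * (m - numRich n b idA k (b i)) = poorBudget n b idA k (b i) := by
        rw [← h2, hp, h, blockCand, div_mul_cancel₀ _ h1.ne']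
      linarith
  · by_cases hex : ∃ i < n, idA i = k ∧ b i < p
    · -- the agents that spend everything are those up to the richest one among them
      obtain ⟨a, ha, hmax⟩ := exists_max_image ((range n).filter fun i => idA i = k ∧ b i < p) b
        (by obtain ⟨i, hi', h⟩ := hex; exact ⟨i, by simp [hi', h]⟩)
      obtain ⟨ha1, hid, hap⟩ := mem_filter.mp ha
      have ha' : a < n := by simpa using ha1
      have hsum : ∑ i ∈ range n with idA i = k, min (b i) p =
          poorBudget n b idA k (b a) + numRich n b idA k (b a) * p := by
        have h1 : (numRich n b idA k (b a) : ℚ) * p =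
            ∑ i ∈ range n with idA i = k ∧ b a < b i, p := by
          rw [sum_const, nsmul_eq_mul]; rfl
        rw [h1, poorBudget, sum_filter, sum_filter, sum_filter, ← sum_add_distrib]
        refine sum_congr rfl fun i hi' => ?_
        by_cases hk : idA i = k
        · rcases le_or_gt (b i) (b a) with h | h
          · simp [hk, h, not_lt.mpr h, (h.trans_lt hap).le]
          · have : p ≤ b i := by
              by_contra hcon
              push Not at hcon
              have := hmax i (mem_filter.mpr ⟨hi', hk, hcon⟩)
              linarith
            simp [hk, h, not_le.mpr h, this]
        · simp [hk]
      rw [hsum]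
      rcases lt_or_ge (numRich n b idA k (b a)) m with hc | hc
      · obtain ⟨h1, h2, h3⟩ := hcpos a ha' hid hc
        have h4 := scanPrice_le_cand (hi := hi) ha' hid hc
        rw [← hp, blockCand, le_div_iff₀ h1, h2] at h4
        linarith
      · have h1 : (m : ℚ) ≤ numRich n b idA k (b a) := by exact_mod_cast hc
        have h2 : 0 ≤ poorBudget n b idA k (b a) :=
          sum_nonneg fun i hi' => (hb i (by simpa using (mem_filter.mp hi').1)).le
        nlinarith
    · push Not at hex
      have : ∑ i ∈ range n with idA i = k, min (b i) p = #{i ∈ range n | idA i = k} * p := by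
        rw [← nsmul_eq_mul, ← sum_const]
        refine sum_congr rfl fun i hi' => ?_
        obtain ⟨h1, h2⟩ := mem_filter.mp hi'
        exact min_eq_right (hex i (by simpa using h1) h2)
      rw [this, mul_comm]
      exact mul_le_mul_of_nonneg_right hmcard hppos.le

end

/-- The invariant of the decomposition.  Agents and goods are grouped into blocks, which are
numbered by `idA` and `idG`.  The final prices in block `k` lie between `lo k` and `hi k`.  At the upper
price all agents can be served within their block (`meet`); at the lower price all goods of the
blocks in `pos` can be sold within their block (`sell`). -/
structure Blocks (n : ℕ) (L : ℕ → ℕ → Prop) (b : ℕ → ℚ) (idA idG : ℕ → ℕ) (lo hi : ℕ → ℚ)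
    (pos : ℕ → Prop) : Prop where
  lo_nonneg : ∀ k, 0 ≤ lo k
  lo_le : ∀ k, lo k ≤ hi k
  ord : ∀ i < n, ∀ j < n, L i j → idA i ≠ idG j → hi (idA i) ≤ lo (idG j)
  meet : ∃ z : ℕ → ℕ → ℚ, (∀ i < n, ∀ j < n, 0 ≤ z i j) ∧
    (∀ i < n, ∀ j < n, z i j ≠ 0 → L i j ∧ idA i = idG j) ∧
    (∀ i < n, ∑ j ∈ range n, z i j = dem (b i) (hi (idA i))) ∧
    ∀ j < n, ∑ i ∈ range n, z i j ≤ cap (hi (idG j))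
  sell : ∃ y : ℕ → ℕ → ℚ, (∀ i < n, ∀ j < n, 0 ≤ y i j) ∧
    (∀ i < n, ∀ j < n, y i j ≠ 0 → L i j ∧ idA i = idG j) ∧
    (∀ i < n, ∑ j ∈ range n, y i j ≤ dem (b i) (lo (idA i))) ∧
    ∀ j < n, pos (idG j) → ∑ i ∈ range n, y i j = cap (lo (idG j))

/-- In block `k` the agents spend exactly the value of the goods at the positive price `q`. -/
def Balanced (n : ℕ) (b : ℕ → ℚ) (idA idG : ℕ → ℕ) (k : ℕ) (q : ℚ) : Prop :=
  0 < q ∧ ∑ i ∈ range n with idA i = k, min (b i) q = q * numGoods n idG k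

section

variable {n : ℕ} {L : ℕ → ℕ → Prop} {b : ℕ → ℚ} {idA idG : ℕ → ℕ} {lo hi pr : ℕ → ℚ}
  {pos : ℕ → Prop}

theorem Blocks.hi_nonneg (B : Blocks n L b idA idG lo hi pos) (k : ℕ) : 0 ≤ hi k :=
  (B.lo_nonneg k).trans (B.lo_le k)

/-- Pricing of the blocks. -/
theorem Blocks.price (B : Blocks n L b idA idG lo hi fun k => hi k ≠ 0) (hb : ∀ i < n, 0 < b i) :
    (∀ k, lo k ≤ scanPrice n b idA idG k (hi k) n) ∧
    ∀ k, (hi k = 0 ∧ scanPrice n b idA idG k (hi k) n = 0) ∨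
      Balanced n b idA idG k (scanPrice n b idA idG k (hi k) n) := by
  have key : ∀ k, (hi k = 0 ∧ scanPrice n b idA idG k (hi k) n = 0) ∨
      (lo k ≤ scanPrice n b idA idG k (hi k) n ∧
        Balanced n b idA idG k (scanPrice n b idA idG k (hi k) n)) := by
    intro k
    rcases (B.hi_nonneg k).eq_or_lt with h0 | h0
    · left
      refine ⟨h0.symm, ?_⟩
      rcases scanPrice_eq (n := n) (b := b) (idA := idA) (idG := idG) (k := k) (hi := hi k) n with
        h | ⟨i, hi', hid, hc, h⟩
      · rw [h, h0]
      · refine le_antisymm ((scanPrice_le n).trans h0.symm.le) ?_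
        rw [h]
        exact div_nonneg (sum_nonneg fun i hi' => (hb i (by simpa using (mem_filter.mp hi').1)).le)
          (Nat.cast_nonneg _)
    · right
      obtain ⟨z, z0, zE, zd, zc⟩ := B.meet
      obtain ⟨y, y0, yE, yd, yc⟩ := B.sell
      -- summing the flow at the lower price over the block: its goods can be paid for
      have h1 : cap (lo k) * numGoods n idG k ≤ ∑ i ∈ range n with idA i = k, dem (b i) (lo k) := by
        calc cap (lo k) * numGoods n idG k = ∑ j ∈ range n with idG j = k, cap (lo k) := by
              rw [sum_const, nsmul_eq_mul, mul_comm]; rfl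
          _ = ∑ j ∈ range n with idG j = k, ∑ i ∈ range n with idA i = k, y i j := by
              refine sum_congr rfl fun j hj => ?_
              obtain ⟨hj1, hj2⟩ := mem_filter.mp hj
              have hj' : j < n := by simpa using hj1
              rw [← hj2, ← yc j hj' (by rw [hj2]; exact h0.ne'), sum_filter]
              refine sum_congr rfl fun i hi' => ?_
              split_ifs with h
              · rfl
              · by_contra h'
                exact h (yE i (by simpa using hi') j hj' h').2
          _ = ∑ i ∈ range n with idA i = k, ∑ j ∈ range n with idG j = k, y i j := sum_comm
          _ ≤ _ := by
              refine sum_le_sum fun i hi' => ?_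
              obtain ⟨hi1, hi2⟩ := mem_filter.mp hi'
              have hi'' : i < n := by simpa using hi1
              rw [← hi2]
              refine le_trans ?_ (yd i hi'')
              exact sum_le_sum_of_subset_of_nonneg (filter_subset _ _) fun j hj _ =>
                y0 i hi'' j (by simpa using hj)
      -- summing the flow at the upper price over the block: its agents do not overspend
      have h2 : ∑ i ∈ range n with idA i = k, dem (b i) (hi k) ≤ cap (hi k) * numGoods n idG k := by
        calc ∑ i ∈ range n with idA i = k, dem (b i) (hi k)
            = ∑ i ∈ range n with idA i = k, ∑ j ∈ range n with idG j = k, z i j := by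
              refine sum_congr rfl fun i hi' => ?_
              obtain ⟨hi1, hi2⟩ := mem_filter.mp hi'
              have hi'' : i < n := by simpa using hi1
              rw [← hi2, ← zd i hi'', sum_filter]
              refine sum_congr rfl fun j hj => ?_
              split_ifs with h
              · rfl
              · by_contra h'
                exact h (zE i hi'' j (by simpa using hj) h').2.symm
          _ = ∑ j ∈ range n with idG j = k, ∑ i ∈ range n with idA i = k, z i j := sum_comm
          _ ≤ ∑ j ∈ range n with idG j = k, cap (hi k) := by
              refine sum_le_sum fun j hj => ?_
              obtain ⟨hj1, hj2⟩ := mem_filter.mp hj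
              have hj' : j < n := by simpa using hj1
              rw [← hj2]
              refine le_trans ?_ (zc j hj')
              exact sum_le_sum_of_subset_of_nonneg (filter_subset _ _) fun i hi' _ =>
                z0 i (by simpa using hi') j hj'
          _ = _ := by rw [sum_const, nsmul_eq_mul, mul_comm]; rfl
      obtain ⟨g1, g2, g3⟩ := scanPrice_spec hb (B.lo_nonneg k) (B.lo_le k) h0 h1 h2
      exact ⟨g2, g1, g3⟩
  refine ⟨fun k => ?_, fun k => (key k).imp id And.right⟩
  rcases key k with ⟨h1, h2⟩ | h
  · rw [h2, ← h1]; exact B.lo_le k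
  · exact h.1

variable {E : ℕ → ℕ → Prop} {d c : ℕ → ℚ} {σ : Flow}

/-- Splitting the blocks along a stable flow for the prices `pr`.  The top agents and goods of block
`k` form block `2 * k + 1`, whose prices are at least `pr k`; the others form block `2 * k`, whose
prices are at most `pr k`. -/
theorem Blocks.split (B : Blocks n L b idA idG lo hi fun k => pr k ≠ 0)
    (hpr : ∀ k, lo k ≤ pr k ∧ pr k ≤ hi k) (H : σ.Inv n E d c) (hs : σ.Stable n E)
    (hE : ∀ i < n, ∀ j < n, E i j ↔ L i j ∧ idA i = idG j)
    (hd : ∀ i < n, d i = dem (b i) (pr (idA i))) (hc : ∀ j < n, c j = cap (pr (idG j)))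
    (htop : ∃ i < n, σ.h i = n + 1) :
    Blocks n L b (fun i => 2 * idA i + if σ.h i = n + 1 then 1 else 0)
      (fun j => 2 * idG j + if σ.l j = n + 1 then 1 else 0)
      (fun k => if k % 2 = 1 then pr (k / 2) else lo (k / 2))
      (fun k => if k % 2 = 1 then hi (k / 2) else pr (k / 2))
      fun k => (if k % 2 = 1 then hi (k / 2) else pr (k / 2)) ≠ 0 := by
  have e1 : ∀ k, (2 * k + 1) % 2 = 1 := fun k => by omega
  have e2 : ∀ k, (2 * k + 1) / 2 = k := fun k => by omega
  have e3 : ∀ k, 2 * k % 2 = 0 := fun k => by omega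
  have e4 : ∀ k, 2 * k / 2 = k := fun k => by omega
  -- edges lead from top agents to top goods only, and top goods are held by top agents only
  have top_of_edge : ∀ i < n, ∀ j < n, E i j → σ.h i = n + 1 → σ.l j = n + 1 :=
    fun i hi j hj h h' => H.good_top hi hj h h'
  have top_of_flow : ∀ i < n, ∀ j < n, σ.f i j ≠ 0 → (σ.h i = n + 1 ↔ σ.l j = n + 1) :=
    fun i hi j hj h => ⟨top_of_edge i hi j hj (H.supp i hi j hj h),
      fun h' => (H.holder_top hs htop hi.le hj h h').2⟩
  have flow_le : ∀ i < n, ∑ j ∈ range n, σ.f i j ≤ d i := fun i hi => by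
    rw [← H.row i hi.le]; have := H.r_nonneg i hi.le; linarith
  refine ⟨?_, ?_, ?_, ?_, ?_⟩
  · intro k
    split_ifs
    · exact (B.lo_nonneg _).trans (hpr _).1
    · exact B.lo_nonneg _
  · intro k
    split_ifs
    · exact (hpr _).2
    · exact (hpr _).1
  · intro i hi j hj hL hne
    by_cases hid : idA i = idG j
    · have hEij : E i j := (hE i hi j hj).mpr ⟨hL, hid⟩
      have hi0 : σ.h i ≠ n + 1 := fun h => hne (by
        simp [h, top_of_edge i hi j hj hEij h, hid])
      have hj0 : σ.l j = n + 1 := by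
        by_contra h
        exact hne (by simp [hi0, h, hid])
      simp [hi0, hj0, e1, e2, hid]
    · have := B.ord i hi j hj hL hid
      have h1 := hpr (idA i)
      have h2 := hpr (idG j)
      by_cases h3 : σ.h i = n + 1 <;> by_cases h4 : σ.l j = n + 1 <;> simp [h3, h4, e1, e2] <;>
        linarith
  · obtain ⟨z, z0, zE, zd, zc⟩ := B.meet
    -- top agents keep the old flow at the upper price; the others are served by the stable flow,
    -- whose prices become their upper prices
    refine ⟨fun i j => if σ.h i = n + 1 then z i j else σ.f i j, ?_, ?_, ?_, ?_⟩
    · intro i hi j hj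
      dsimp only
      split_ifs
      · exact z0 i hi j hj
      · exact H.nonneg i hi.le j hj
    · intro i hi j hj h
      by_cases hi0 : σ.h i = n + 1
      · simp only [hi0, if_true] at h ⊢
        obtain ⟨h1, h2⟩ := zE i hi j hj h
        rw [top_of_edge i hi j hj ((hE i hi j hj).mpr ⟨h1, h2⟩) hi0]
        simp [h1, h2]
      · simp only [hi0, if_false] at h ⊢
        obtain ⟨h1, h2⟩ := (hE i hi j hj).mp (H.supp i hi j hj h)
        have := mt (top_of_flow i hi j hj h).mpr hi0
        simp [h1, h2, this]
    · intro i hi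
      by_cases hi0 : σ.h i = n + 1
      · simp only [hi0, if_true, e1, e2]; exact zd i hi
      · have hr : σ.r i = 0 := by
          by_contra h
          exact hi0 (H.active_top hs hi (lt_of_le_of_ne (H.r_nonneg i hi.le) (Ne.symm h)))
        have := H.row i hi.le
        rw [hr, add_zero, hd i hi] at this
        simp [hi0, this]
    · intro j hj
      by_cases hj0 : σ.l j = n + 1
      · simp only [hj0, if_true, e1, e2]
        refine le_trans (sum_le_sum fun i hi => ?_) (zc j hj)
        have hi' : i < n := by simpa using hi
        split_ifs with hi0
        · exact le_rfl
        · have : σ.f i j = 0 := by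
            by_contra h
            exact hi0 ((top_of_flow i hi' j hj h).mpr hj0)
          rw [this]; exact z0 i hi' j hj
      · simp only [hj0, if_false, add_zero, e3, e4, zero_ne_one]
        rw [← hc j hj, ← H.col j hj, sum_range_succ]
        have hn := H.nonneg n le_rfl j hj
        refine le_trans (sum_le_sum fun i hi => ?_) (le_add_of_nonneg_right hn)
        have hi' : i < n := by simpa using hi
        split_ifs with hi0
        · have : z i j = 0 := by
            by_contra h
            exact hj0 (top_of_edge i hi' j hj ((hE i hi' j hj).mpr (zE i hi' j hj h)) hi0)
          rw [this]; exact H.nonneg i hi'.le j hj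
        · exact le_rfl
  · obtain ⟨y, y0, yE, yd, yc⟩ := B.sell
    -- top goods are sold out in the stable flow, whose prices become their lower prices; the others
    -- keep the old flow at the lower price
    refine ⟨fun i j => if σ.l j = n + 1 then σ.f i j else y i j, ?_, ?_, ?_, ?_⟩
    · intro i hi j hj
      dsimp only
      split_ifs
      · exact H.nonneg i hi.le j hj
      · exact y0 i hi j hj
    · intro i hi j hj h
      by_cases hj0 : σ.l j = n + 1
      · simp only [hj0, if_true] at h ⊢
        obtain ⟨h1, h2⟩ := (hE i hi j hj).mp (H.supp i hi j hj h)
        rw [(top_of_flow i hi j hj h).mpr hj0]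
        simp [h1, h2]
      · simp only [hj0, if_false] at h ⊢
        obtain ⟨h1, h2⟩ := yE i hi j hj h
        have := mt (top_of_edge i hi j hj ((hE i hi j hj).mpr ⟨h1, h2⟩)) hj0
        simp [h1, h2, this]
    · intro i hi
      by_cases hi0 : σ.h i = n + 1
      · simp only [hi0, if_true, e1, e2]
        rw [← hd i hi]
        refine le_trans (sum_le_sum fun j hj => ?_) (flow_le i hi)
        have hj' : j < n := by simpa using hj
        split_ifs with hj0
        · exact le_rfl
        · have : y i j = 0 := by
            by_contra h
            exact hj0 (top_of_edge i hi j hj' ((hE i hi j hj').mpr (yE i hi j hj' h)) hi0)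
          rw [this]; exact H.nonneg i hi.le j hj'
      · simp only [hi0, if_false, add_zero, e3, e4, zero_ne_one]
        refine le_trans (sum_le_sum fun j hj => ?_) (yd i hi)
        have hj' : j < n := by simpa using hj
        split_ifs with hj0
        · have : σ.f i j = 0 := by
            by_contra h
            exact hi0 ((top_of_flow i hi j hj' h).mpr hj0)
          rw [this]; exact y0 i hi j hj'
        · exact le_rfl
    · intro j hj hpos
      by_cases hj0 : σ.l j = n + 1
      · simp only [hj0, if_true, e1, e2]
        rw [← hc j hj, ← H.col j hj, sum_range_succ]
        have : σ.f n j = 0 := by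
          by_contra h
          exact absurd (H.holder_top hs htop le_rfl hj h hj0).1 (lt_irrefl _)
        rw [this, add_zero]
      · simp only [hj0, if_false, add_zero, e3, e4, zero_ne_one] at hpos ⊢
        exact yc j hj hpos

/-- If some demand is not met, then some balanced block is properly split. -/
theorem Blocks.exists_split (B : Blocks n L b idA idG lo hi fun k => pr k ≠ 0)
    (hbal : ∀ k, (hi k = 0 ∧ pr k = 0) ∨ Balanced n b idA idG k (pr k))
    (H : σ.Inv n E d c) (hs : σ.Stable n E)
    (hE : ∀ i < n, ∀ j < n, E i j ↔ L i j ∧ idA i = idG j)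
    (hd : ∀ i < n, d i = dem (b i) (pr (idA i))) (hc : ∀ j < n, c j = cap (pr (idG j)))
    {i0 : ℕ} (hi0 : i0 < n) (hr : 0 < σ.r i0) :
    ∃ i < n, ∃ i' < n, idA i = idA i' ∧ σ.h i = n + 1 ∧ σ.h i' ≠ n + 1 := by
  have htop := H.active_top hs hi0 hr
  refine ⟨i0, hi0, ?_⟩
  by_contra hcon
  push Not at hcon
  -- otherwise all agents of the block of `i0` are top agents
  have hall : ∀ i < n, idA i = idA i0 → σ.h i = n + 1 := fun i hi h => hcon i hi h.symm htop
  have hAG : ∀ i < n, ∀ j < n, E i j → (idA i = idA i0 ↔ idG j = idA i0) := by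
    intro i hi j hj h
    rw [((hE i hi j hj).mp h).2]
  rcases hbal (idA i0) with ⟨h1, h2⟩ | ⟨hpos, hbal⟩
  -- at the price zero, which is also the upper price, all demands can be met
  · obtain ⟨z, z0, zE, zd, zc⟩ := B.meet
    refine hr.ne' (H.r_eq_zero hs (fun i => idA i = idA i0) (fun j => idG j = idA i0) hAG z0
      (fun i hi j hj h _ => (hE i hi j hj).mpr (zE i hi j hj h)) ?_ ?_ i0 hi0 rfl)
    · intro i hi h
      rw [zd i hi, hd i hi, h, h1, h2]
    · intro j hj h
      rw [hc j hj, h, h2, ← h1, ← h]; exact zc j hj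
  -- at a balanced price all goods are top goods, and agent `i0` would spend less than it can
  · have key := H.sum_top hs ⟨i0, hi0, htop⟩ (fun i => idA i = idA i0) (fun j => idG j = idA i0) hAG
    obtain ⟨y, y0, yE, yd, yc⟩ := B.sell
    have htopG : ∀ j < n, idG j = idA i0 → σ.l j = n + 1 := by
      intro j hj h
      have h1 := yc j hj (by rw [h]; exact hpos.ne')
      have h2 := cap_pos (B.lo_nonneg (idG j))
      rw [← h1] at h2
      obtain ⟨i, hi, hne⟩ := exists_ne_zero_of_sum_ne_zero h2.ne'
      have hi' : i < n := by simpa using hi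
      obtain ⟨h3, h4⟩ := yE i hi' j hj hne
      exact H.good_top hi' hj ((hE i hi' j hj).mpr ⟨h3, h4⟩) (hall i hi' (h4.trans h))
    have s1 : ∑ j ∈ range n with idG j = idA i0 ∧ σ.l j = n + 1, c j =
        pr (idA i0) * numGoods n idG (idA i0) := by
      have : ∑ j ∈ range n with idG j = idA i0 ∧ σ.l j = n + 1, c j =
          ∑ j ∈ range n with idG j = idA i0, pr (idA i0) := by
        rw [sum_filter, sum_filter]
        refine sum_congr rfl fun j hj => ?_
        have hj' : j < n := by simpa using hj
        by_cases h : idG j = idA i0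
        · simp [h, htopG j hj' h, hc j hj', cap, hpos.ne']
        · simp [h]
      rw [this, sum_const, nsmul_eq_mul, mul_comm]; rfl
    have s2 : ∑ i ∈ range n with idA i = idA i0 ∧ σ.h i = n + 1, (d i - σ.r i) <
        ∑ i ∈ range n with idA i = idA i0, min (b i) (pr (idA i0)) := by
      have : ∑ i ∈ range n with idA i = idA i0 ∧ σ.h i = n + 1, (d i - σ.r i) =
          ∑ i ∈ range n with idA i = idA i0, (min (b i) (pr (idA i0)) - σ.r i) := by
        rw [sum_filter, sum_filter]
        refine sum_congr rfl fun i hi => ?_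
        have hi' : i < n := by simpa using hi
        by_cases h : idA i = idA i0
        · simp [h, hall i hi' h, hd i hi', dem, hpos.ne']
        · simp [h]
      rw [this]
      refine sum_lt_sum (fun i hi => ?_) ⟨i0, by simp [hi0], by linarith⟩
      have := H.r_nonneg i (by simp at hi; omega)
      linarith
    linarith

/-- Once all demands are met, the prices of the blocks are equilibrium prices. -/
theorem Blocks.eqCert (B : Blocks n L b idA idG lo hi fun k => pr k ≠ 0)
    (hb : ∀ i < n, 0 < b i) (hpr : ∀ k, lo k ≤ pr k ∧ pr k ≤ hi k)
    (hbal : ∀ k, pr k = 0 ∨ Balanced n b idA idG k (pr k))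
    (H : σ.Inv n E d c) (hE : ∀ i < n, ∀ j < n, E i j ↔ L i j ∧ idA i = idG j)
    (hd : ∀ i < n, d i = dem (b i) (pr (idA i))) (hc : ∀ j < n, c j = cap (pr (idG j)))
    (hr : ∀ i < n, σ.r i = 0) :
    EqCert n L b (fun j => pr (idG j)) (fun i => pr (idA i))
      fun i j => σ.f i j / cap (pr (idG j)) := by
  refine H.eqCert hb (fun i hi j hj h => ?_) hd hc hr
    (fun j _ => (B.lo_nonneg _).trans (hpr _).1) ?_ ?_
  · obtain ⟨h1, h2⟩ := (hE i hi j hj).mp h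
    exact ⟨h1, by rw [h2]⟩
  · intro i hi j hj hL
    by_cases h : idA i = idG j
    · rw [h]
    · exact ((hpr _).2.trans (B.ord i hi j hj hL h)).trans (hpr _).1
  · intro j hj hpos
    rcases hbal (idG j) with h | ⟨h0, h⟩
    · exact absurd h hpos.ne'
    · refine H.dummy_eq_zero (fun i => idA i = idG j) (fun j' => idG j' = idG j) ?_ hr ?_ j hj rfl
      · intro i hi j' hj' hEij
        rw [((hE i hi j' hj').mp hEij).2]
      · have s1 : ∑ i ∈ range n with idA i = idG j, d i =
            ∑ i ∈ range n with idA i = idG j, min (b i) (pr (idG j)) := by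
          refine sum_congr rfl fun i hi => ?_
          obtain ⟨h1, h2⟩ := mem_filter.mp hi
          rw [hd i (by simpa using h1), h2, dem, if_neg h0.ne']
        have s2 : ∑ j' ∈ range n with idG j' = idG j, c j' =
            ∑ j' ∈ range n with idG j' = idG j, pr (idG j) := by
          refine sum_congr rfl fun j' hj' => ?_
          obtain ⟨h1, h2⟩ := mem_filter.mp hj'
          rw [hc j' (by simpa using h1), h2, cap, if_neg h0.ne']
        rw [s1, s2, h, sum_const, nsmul_eq_mul, mul_comm]; rfl

/-- At the start there is one block, and an upper price that is at least the total budget. -/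
theorem Blocks.start {U : ℚ} (hU : ∑ i ∈ range n, b i ≤ U) (hb : ∀ i < n, 0 < b i)
    (hU0 : 0 < U) (hL : ∀ i < n, ∃ j < n, L i j) :
    Blocks n L b (fun _ => 0) (fun _ => 0) (fun _ => 0) (fun _ => U) (fun _ => (0 : ℚ) ≠ 0) := by
  choose! g hg hgL using hL
  refine ⟨fun _ => le_rfl, fun _ => hU0.le, fun _ _ _ _ _ h => absurd rfl h,
    ⟨fun i j => if j = g i then b i else 0, ?_, ?_, ?_, ?_⟩,
    ⟨fun _ _ => 0, fun _ _ _ _ => le_rfl, fun _ _ _ _ h => absurd rfl h, ?_,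
      fun _ _ h => absurd rfl h⟩⟩
  · intro i hi j hj
    dsimp only
    split_ifs
    · exact (hb i hi).le
    · exact le_rfl
  · intro i hi j hj h
    dsimp only at h
    split_ifs at h with h'
    · exact ⟨h' ▸ hgL i hi, rfl⟩
    · exact absurd rfl h
  · intro i hi
    have : b i ≤ U := le_trans (single_le_sum (f := b)
      (fun a ha => (hb a (by simpa using ha)).le) (by simpa using hi)) hU
    simp [hg i hi, dem, hU0.ne', this]
  · intro j hj
    rw [cap, if_neg hU0.ne']
    refine le_trans (sum_le_sum fun i hi => ?_) hU
    dsimp only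
    split_ifs
    · exact le_rfl
    · exact (hb i (by simpa using hi)).le
  · intro i _
    simp [dem]

end

end ADHZ

namespace ADHZ

open Finset

/-! ### The program for flows -/

/-- `v` is a multiple of `1 / D`. -/
def Fine (D : ℕ) (v : ℚ) : Prop := ∃ z : ℤ, v * D = z

namespace Fine

variable {D : ℕ} {v w : ℚ}

theorem zero (D : ℕ) : Fine D 0 := ⟨0, by simp⟩

theorem natCast (D k : ℕ) : Fine D k := ⟨k * D, by push_cast; ring⟩

theorem one (D : ℕ) : Fine D 1 := by simpa using natCast D 1

theorem add (hv : Fine D v) (hw : Fine D w) : Fine D (v + w) := by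
  obtain ⟨a, ha⟩ := hv
  obtain ⟨b, hb⟩ := hw
  exact ⟨a + b, by push_cast; rw [add_mul, ha, hb]⟩

theorem sub (hv : Fine D v) (hw : Fine D w) : Fine D (v - w) := by
  obtain ⟨a, ha⟩ := hv
  obtain ⟨b, hb⟩ := hw
  exact ⟨a - b, by push_cast; rw [sub_mul, ha, hb]⟩

theorem mul {D' : ℕ} (hv : Fine D v) (hw : Fine D' w) : Fine (D * D') (v * w) := by
  obtain ⟨a, ha⟩ := hv
  obtain ⟨b, hb⟩ := hw
  exact ⟨a * b, by push_cast; rw [← ha, ← hb]; ring⟩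

theorem sum {ι : Type*} {t : Finset ι} {f : ι → ℚ} (h : ∀ i ∈ t, Fine D (f i)) :
    Fine D (∑ i ∈ t, f i) := by
  classical
  induction t using Finset.induction_on with
  | empty => simpa using zero D
  | insert a t ha ih =>
    rw [sum_insert ha]
    exact (h a (mem_insert_self _ _)).add (ih fun i hi => h i (mem_insert_of_mem hi))

theorem of_dvd {D' : ℕ} (hv : Fine D v) (h : D ∣ D') : Fine D' v := by
  obtain ⟨a, ha⟩ := hv
  obtain ⟨k, rfl⟩ := h
  exact ⟨a * k, by push_cast; rw [← ha]; ring⟩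

theorem min (hv : Fine D v) (hw : Fine D w) : Fine D (min v w) := by
  rcases min_choice v w with h | h <;> rw [h] <;> assumption

theorem max (hv : Fine D v) (hw : Fine D w) : Fine D (max v w) := by
  rcases max_choice v w with h | h <;> rw [h] <;> assumption

theorem div {k : ℕ} (hv : Fine D v) (hk : 0 < k) : Fine (D * k) (v / k) := by
  obtain ⟨a, ha⟩ := hv
  have : (k : ℚ) ≠ 0 := by exact_mod_cast hk.ne'
  exact ⟨a, by push_cast; rw [← ha]; field_simp⟩

end Fine

/-- The resources that the programs need for instances with `n` agents: the loop bound `N`, and the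
encoding length `β` of counters, block numbers, and multiples of `1 / D` of absolute value at most
`Q`. -/
structure Limits (n N β D Q : ℕ) : Prop where
  one_le : 1 ≤ n
  loops : (n + 3) ^ 5 ≤ N
  nat : ∀ v ≤ (n + 3) ^ 5, natBits v ≤ β
  ids : ∀ v ≤ 2 ^ (n ^ 2 + 3), natBits v ≤ β
  rat : ∀ v : ℚ, Fine D v → 0 ≤ v → v ≤ Q → ratBits v ≤ β
  range : n * (n + 1) ≤ Q

theorem Limits.le_pow {n N β D Q : ℕ} (lim : Limits n N β D Q) : n + 2 ≤ (n + 3) ^ 5 ∧ n + 2 ≤ N := by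
  have : n + 3 ≤ (n + 3) ^ 5 := Nat.le_self_pow (by norm_num) _
  have := lim.loops
  omega

theorem Limits.small {n N β D Q : ℕ} (lim : Limits n N β D Q) {v : ℕ} (h : v ≤ n + 2) :
    natBits v ≤ β := lim.nat v (h.trans lim.le_pow.1)

/-- The expression for `n`. -/
abbrev vn : NExp := nvar 0

/-- The address of the entry in row `i` and column `j` of a matrix with `n` columns. -/
abbrev ix (i j : NExp) : NExp := .add (.mul i vn) j

/-- Counting loops with the bound `n`. -/
theorem Reaches.forN {n N β D Q v : ℕ} (lim : Limits n N β D Q) {P : Program} {s : State}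
    {R : State → Prop} (hn : s.nat 0 0 = n) (I : ℕ → State → Prop) (hv : P.writesNat v = false)
    (hv0 : v ≠ 0) (hP0 : P.writesNat 0 = false)
    (h0 : I 0 (s.setNat v 0 0))
    (hstep : ∀ k s', k < n → Frame (ADHZ.forLoop v vn P) s s' → s'.nat 0 0 = n → s'.nat v 0 = k →
      I k s' → Reaches N β P s' fun s'' => I (k + 1) (s''.setNat v 0 (k + 1)))
    (hQ : ∀ s', Frame (ADHZ.forLoop v vn P) s s' → s'.nat 0 0 = n → I n s' → R s') :
    Reaches N β (ADHZ.forLoop v vn P) s R := by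
  have hw : (ADHZ.forLoop v vn P).writesNat 0 = false := by
    simp [ADHZ.forLoop, Program.writesNat, hv0, hP0]
  have hfr : ∀ s', Frame (ADHZ.forLoop v vn P) s s' → s'.nat 0 0 = n := fun s' h => by
    rw [h.1 0 hw, hn]
  exact .forLoop I hv (fun s' h => by simp [NExp.eval, hfr s' h]) (by have := lim.le_pow; omega)
    (lim.small (by omega)) h0 (fun k s' hk hf => hstep k s' hk hf (hfr s' hf))
    (fun s' hf => hQ s' hf (hfr s' hf))

/-- Counting loops with the bound `n + 1`. -/
theorem Reaches.forN1 {n N β D Q v : ℕ} (lim : Limits n N β D Q) {P : Program} {s : State}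
    {R : State → Prop} (hn : s.nat 0 0 = n) (I : ℕ → State → Prop) (hv : P.writesNat v = false)
    (hv0 : v ≠ 0) (hP0 : P.writesNat 0 = false)
    (h0 : I 0 (s.setNat v 0 0))
    (hstep : ∀ k s', k ≤ n → s'.nat 0 0 = n → s'.nat v 0 = k →
      I k s' → Reaches N β P s' fun s'' => I (k + 1) (s''.setNat v 0 (k + 1)))
    (hQ : ∀ s', s'.nat 0 0 = n → I (n + 1) s' → R s') :
    Reaches N β (ADHZ.forLoop v (.add vn (.const 1)) P) s R := by
  have hw : (ADHZ.forLoop v (.add vn (.const 1)) P).writesNat 0 = false := by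
    simp [ADHZ.forLoop, Program.writesNat, hv0, hP0]
  have hfr : ∀ s', Frame (ADHZ.forLoop v (.add vn (.const 1)) P) s s' → s'.nat 0 0 = n :=
    fun s' h => by rw [h.1 0 hw, hn]
  exact .forLoop I hv (fun s' h => by simp [NExp.eval, hfr s' h]) (by have := lim.le_pow; omega)
    (lim.small (by omega)) h0 (fun k s' hk hf => hstep k s' (by omega) (hfr s' hf))
    (fun s' hf => hQ s' (hfr s' hf))

/-- `l = r` for natural-number expressions. -/
def Test.natEQ (l r : NExp) : Test := .both (.natLE l r) (.natLE r l)

/-- `l < r` for rational expressions. -/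
def Test.ratLT (l r : QExp) : Test := .neg (.ratLE r l)

/-- `l = r` for rational expressions. -/
def Test.ratEQ (l r : QExp) : Test := .both (.ratLE l r) (.ratLE r l)

theorem Test.holds_natEQ {l r : NExp} {s : State} :
    (Test.natEQ l r).holds s ↔ l.eval s = r.eval s := by
  simp only [Test.natEQ, Test.holds]; omega

theorem Test.holds_ratLT {l r : QExp} {s : State} :
    (Test.ratLT l r).holds s ↔ l.eval s < r.eval s := by
  simp [Test.ratLT, Test.holds]

theorem Test.holds_ratEQ {l r : QExp} {s : State} :
    (Test.ratEQ l r).holds s ↔ l.eval s = r.eval s := by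
  simp only [Test.ratEQ, Test.holds]; exact le_antisymm_iff.symm

/-- The loop variable of outer loops. -/
abbrev vi : NExp := nvar 10
/-- The loop variable of loops nested once. -/
abbrev vj : NExp := nvar 11
/-- The loop variable of loops nested twice. -/
abbrev vk : NExp := nvar 12

/-- The test whether the market has an edge between agent `i` and good `j`.  Natural-number array
`1` says which goods are liked, the arrays `2` and `3` hold the block numbers of agents and goods,
and the rational arrays `6` and `7` hold their prices. -/
def edgeTest (i j : NExp) : Test :=
  .both (.natEQ (.get 1 (ix i j)) (.const 1))
    (.both (.natEQ (.get 2 i) (.get 3 j)) (.ratEQ (.get 6 i) (.get 7 j)))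

/-- The edges of the market. -/
def edgeOf (n : ℕ) (s : State) (i j : ℕ) : Prop :=
  s.nat 1 (i * n + j) = 1 ∧ s.nat 2 i = s.nat 3 j ∧ s.rat 6 i = s.rat 7 j

/-- The flow in the memory: shares in rational array `8`, unmet demand in `9`, and the labels of
agents and goods in the natural-number arrays `4` and `5`. -/
def flowOf (n : ℕ) (s : State) : Flow where
  f i j := s.rat 8 (i * n + j)
  r i := s.rat 9 i
  h i := s.nat 4 i
  l j := s.nat 5 j

/-- Agent `i` takes as much as possible of good `j` from holder `k`. -/
def pushProg : Program :=
  .cond (.both (edgeTest vi vj) (.both (.ratLT (.const 0) (.get 9 vi))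
      (.both (.ratLT (.const 0) (.get 8 (ix vk vj))) (.both (.natEQ (.get 4 vi) (.get 5 vj))
        (.natEQ (.get 5 vj) (.add (.get 4 vk) (.const 1)))))))
    (.seq (.cond (.ratLE (.get 9 vi) (.get 8 (ix vk vj)))
      (.setRat 10 (.const 0) (.get 9 vi)) (.setRat 10 (.const 0) (.get 8 (ix vk vj))))
    (.seq (.setRat 8 (ix vi vj) (.add (.get 8 (ix vi vj)) (qvar 10)))
    (.seq (.setRat 8 (ix vk vj) (.sub (.get 8 (ix vk vj)) (qvar 10)))
    (.seq (.setRat 9 vi (.sub (.get 9 vi) (qvar 10)))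
      (.setRat 9 vk (.add (.get 9 vk) (qvar 10)))))))
    .skip

/-- Relabelling of agent `i`. -/
def relabelAgentProg : Program :=
  .seq (.setNat 15 (.const 0) (.add vn (.const 1)))
  (.seq (forLoop 11 vn (.cond (.both (edgeTest vi vj) (.neg (.natLE (nvar 15) (.get 5 vj))))
      (.setNat 15 (.const 0) (.get 5 vj)) .skip))
    (.setNat 4 vi (nvar 15)))

/-- Relabelling of good `j`. -/
def relabelGoodProg : Program :=
  .seq (.setNat 15 (.const 0) (.add vn (.const 1)))
  (.seq (forLoop 12 (.add vn (.const 1)) (.cond (.both (.ratLT (.const 0) (.get 8 (ix vk vj)))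
        (.neg (.natLE (nvar 15) (.add (.get 4 vk) (.const 1)))))
      (.setNat 15 (.const 0) (.add (.get 4 vk) (.const 1))) .skip))
    (.setNat 5 vj (nvar 15)))

/-- All pushes and all relabellings, once each. -/
def sweepProg : Program :=
  .seq (forLoop 10 vn (forLoop 11 vn (forLoop 12 (.add vn (.const 1)) pushProg)))
  (.seq (forLoop 10 vn relabelAgentProg) (forLoop 11 vn relabelGoodProg))

/-- All shares and unmet demands are multiples of `1 / D`. -/
def Flow.IsFine (n D : ℕ) (σ : Flow) : Prop :=
  (∀ i ≤ n, ∀ j < n, Fine D (σ.f i j)) ∧ ∀ i ≤ n, Fine D (σ.r i)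

theorem edgeTest_holds {n : ℕ} {s : State} (hn : s.nat 0 0 = n) (i j : NExp) :
    (edgeTest i j).holds s ↔ edgeOf n s (i.eval s) (j.eval s) := by
  simp only [edgeTest, Test.holds, Test.holds_natEQ, Test.holds_ratEQ, NExp.eval, QExp.eval, edgeOf,
    hn]

theorem flowOf_setNat {n a k v : ℕ} {s : State} (h4 : a ≠ 4) (h5 : a ≠ 5) :
    flowOf n (s.setNat a k v) = flowOf n s := by
  simp only [flowOf, setNat_rat, setNat_nat_ne h4.symm, setNat_nat_ne h5.symm]

theorem edgeOf_setNat {n a k v : ℕ} {s : State} (h1 : a ≠ 1) (h2 : a ≠ 2) (h3 : a ≠ 3) :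
    edgeOf n (s.setNat a k v) = edgeOf n s := by
  funext i j
  simp only [edgeOf, setNat_rat, setNat_nat_ne h1.symm, setNat_nat_ne h2.symm,
    setNat_nat_ne h3.symm]

theorem edgeOf_frame {n : ℕ} {P : Program} {s s' : State} (h : Frame P s s')
    (h1 : P.writesNat 1 = false) (h2 : P.writesNat 2 = false) (h3 : P.writesNat 3 = false)
    (h6 : P.writesRat 6 = false) (h7 : P.writesRat 7 = false) : edgeOf n s' = edgeOf n s := by
  funext i j
  simp only [edgeOf, h.1 1 h1, h.1 2 h2, h.1 3 h3, h.2 6 h6, h.2 7 h7]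

theorem index_inj {n i j a b : ℕ} (hj : j < n) (hb : b < n) :
    i * n + j = a * n + b ↔ i = a ∧ j = b := by
  constructor
  · intro h
    have hn : 0 < n := by omega
    have h1 : (n * i + j) / n = i := by
      rw [Nat.mul_add_div hn, Nat.div_eq_of_lt hj, add_zero]
    have h2 : (n * a + b) / n = a := by
      rw [Nat.mul_add_div hn, Nat.div_eq_of_lt hb, add_zero]
    have h3 : i = a := by rw [← h1, ← h2, mul_comm n i, mul_comm n a, h]
    subst h3
    exact ⟨rfl, by omega⟩
  · rintro ⟨rfl, rfl⟩; rfl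

/-- The state of a sweep that started with the flow `σ`: either there was progress, or nothing was
changed and `done` says what was found impossible.  As there is no progress from a stable flow, the
number of sweeps can be fixed in advance. -/
def Sweeping (n D : ℕ) (E : ℕ → ℕ → Prop) (d c : ℕ → ℚ) (σ : Flow) (done : Prop) (s : State) :
    Prop :=
  s.nat 0 0 = n ∧ edgeOf n s = E ∧ (flowOf n s).Inv n E d c ∧ (flowOf n s).IsFine n D ∧
    (¬ σ.Stable n E ∧ σ.pot n < (flowOf n s).pot n ∨ flowOf n s = σ ∧ done)

theorem Sweeping.setNat {n D a k v : ℕ} {E : ℕ → ℕ → Prop} {d c : ℕ → ℚ} {σ : Flow}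
    {done : Prop} {s : State} (h : Sweeping n D E d c σ done s) (ha : 6 ≤ a) :
    Sweeping n D E d c σ done (s.setNat a k v) := by
  obtain ⟨h1, h2, h3, h4, h5⟩ := h
  unfold Sweeping
  rw [setNat_nat_ne (by omega : 0 ≠ a), edgeOf_setNat (by omega) (by omega) (by omega),
    flowOf_setNat (by omega) (by omega)]
  exact ⟨h1, h2, h3, h4, h5⟩

theorem Sweeping.mono {n D : ℕ} {E : ℕ → ℕ → Prop} {d c : ℕ → ℚ} {σ : Flow}
    {done done' : Prop} {s : State} (h : Sweeping n D E d c σ done s) (hd : done → done') :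
    Sweeping n D E d c σ done' s := by
  obtain ⟨h1, h2, h3, h4, h5⟩ := h
  exact ⟨h1, h2, h3, h4, h5.imp id fun h => ⟨h.1, hd h.2⟩⟩

section

variable {n N β D Q : ℕ} {E : ℕ → ℕ → Prop} {d c : ℕ → ℚ} {σ : Flow}

theorem Flow.Inv.f_le (H : σ.Inv n E d c) {i j : ℕ} (hi : i ≤ n) (hj : j < n) : σ.f i j ≤ c j := by
  rw [← H.col j hj]
  exact single_le_sum (f := fun i => σ.f i j) (fun a ha => H.nonneg a (by simp at ha; omega) j hj)
    (by simp; omega)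

theorem Flow.Inv.r_le (H : σ.Inv n E d c) {i : ℕ} (hi : i ≤ n) : σ.r i ≤ d i := by
  rw [← H.row i hi]
  exact le_add_of_nonneg_left (sum_nonneg fun j hj => H.nonneg i hi j (by simpa using hj))

theorem pushProg_spec (lim : Limits n N β D Q) (hd : ∀ i ≤ n, d i ≤ Q) (hc : ∀ j < n, c j ≤ Q)
    {s : State} {done : Prop} {i j k : ℕ} (hi : i < n) (hj : j < n) (hk : k ≤ n)
    (si : s.nat 10 0 = i) (sj : s.nat 11 0 = j) (sk : s.nat 12 0 = k)
    (h : Sweeping n D E d c σ done s) :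
    Reaches N β pushProg s (Sweeping n D E d c σ (done ∧ ¬ σ.CanPush E i j k)) := by
  obtain ⟨hn, hE, hI, hF, hp⟩ := h
  have htest : ∀ R, (Test.both (edgeTest vi vj) R).holds s ↔ E i j ∧ R.holds s := by
    intro R
    simp only [Test.holds, edgeTest_holds hn, hE, NExp.eval, si, sj]
  refine .cond (fun hc' => ?_) (fun hc' => .skip ?_)
  · rw [htest] at hc'
    simp only [Test.holds, Test.holds_natEQ, Test.holds_ratLT, NExp.eval, QExp.eval, si, sj, sk,
      hn] at hc'
    have hcan : (flowOf n s).CanPush E i j k := by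
      obtain ⟨a1, a2, a3, a4, a5⟩ := hc'
      exact ⟨a1, a2, a3, a4, a5⟩
    have hik : i ≠ k := by
      rintro rfl; have := hcan.2.2.2; omega
    set δ := min (s.rat 9 i) (s.rat 8 (k * n + j)) with hδ
    have hij' : i * n + j ≠ k * n + j := fun h => hik ((index_inj hj hj).mp h).1
    -- the state after the push
    let s' : State := ((((s.setRat 10 0 δ).setRat 8 (i * n + j) (s.rat 8 (i * n + j) + δ)).setRat 8
      (k * n + j) (s.rat 8 (k * n + j) - δ)).setRat 9 i (s.rat 9 i - δ)).setRat 9 k (s.rat 9 k + δ)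
    have hrs' : s'.rat 9 = Function.update (Function.update (s.rat 9) i (s.rat 9 i - δ)) k
        (s.rat 9 k + δ) := by
      simp [s', State.setRat]
    have hfs' : s'.rat 8 = Function.update (Function.update (s.rat 8) (i * n + j)
        (s.rat 8 (i * n + j) + δ)) (k * n + j) (s.rat 8 (k * n + j) - δ) := by
      simp [s', State.setRat]
    have hpush : Flow.IsPush n i j k δ (flowOf n s) (flowOf n s') := by
      refine ⟨fun a ha b hb => ?_, fun a ha => ?_, rfl, rfl⟩
      · simp only [flowOf, hfs', Function.update_apply, index_inj hb hj]
        by_cases h1 : a = k ∧ b = j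
        · obtain ⟨rfl, rfl⟩ := h1
          simp [hik.symm]
        · by_cases h2 : a = i ∧ b = j
          · obtain ⟨rfl, rfl⟩ := h2
            simp [hik]
          · simp [h1, h2]
      · simp only [flowOf, hrs', Function.update_apply]
        by_cases h1 : a = k
        · subst h1; simp [hik.symm]
        · by_cases h2 : a = i
          · subst h2; simp [hik]
          · simp [h1, h2]
    obtain ⟨hI', hpot⟩ := hI.push hi hj hk hcan hpush
    have hFδ : Fine D δ := (hF.2 i hi.le).min (hF.1 k hk j hj)
    have hF' : (flowOf n s').IsFine n D := by
      refine ⟨fun a ha b hb => ?_, fun a ha => ?_⟩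
      · rw [hpush.f a ha b hb]
        refine ((hF.1 a ha b hb).add ?_).sub ?_ <;> split_ifs <;> first | exact hFδ | exact Fine.zero D
      · rw [hpush.r a ha]
        refine ((hF.2 a ha).sub ?_).add ?_ <;> split_ifs <;> first | exact hFδ | exact Fine.zero D
    have sizef : ∀ a ≤ n, ratBits (s'.rat 8 (a * n + j)) ≤ β := fun a ha =>
      lim.rat _ (hF'.1 a ha j hj) (hI'.nonneg a ha j hj) ((hI'.f_le ha hj).trans (hc j hj))
    have sizer : ∀ a ≤ n, ratBits (s'.rat 9 a) ≤ β := fun a ha =>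
      lim.rat _ (hF'.2 a ha) (hI'.r_nonneg a ha) ((hI'.r_le ha).trans (hd a ha))
    have sizeδ : ratBits δ ≤ β := lim.rat _ hFδ
      (le_min (hI.r_nonneg i hi.le) (hI.nonneg k hk j hj))
      ((min_le_left _ _).trans ((hI.r_le hi.le).trans (hd i hi.le)))
    have e1 : s'.rat 8 (i * n + j) = s.rat 8 (i * n + j) + δ := by
      rw [hfs', Function.update_of_ne hij', Function.update_self]
    have e2 : s'.rat 8 (k * n + j) = s.rat 8 (k * n + j) - δ := by
      rw [hfs', Function.update_self]
    have e3 : s'.rat 9 i = s.rat 9 i - δ := by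
      rw [hrs', Function.update_of_ne hik, Function.update_self]
    have e4 : s'.rat 9 k = s.rat 9 k + δ := by
      rw [hrs', Function.update_self]
    have b1 := sizef i hi.le
    have b2 := sizef k hk
    have b3 := sizer i hi.le
    have b4 := sizer k hk
    rw [e1] at b1
    rw [e2] at b2
    rw [e3] at b3
    rw [e4] at b4
    have fin : Sweeping n D E d c σ (done ∧ ¬ σ.CanPush E i j k) s' := by
      refine ⟨hn, hE ▸ ?_, hI', hF', Or.inl ?_⟩
      · rfl
      · rcases hp with h | h
        · exact ⟨h.1, h.2.trans hpot⟩
        · rw [← h.1]; exact ⟨fun hst => hst.push i hi j hj k hk hcan, hpot⟩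
    refine .seq ?_
    have hmin : Reaches N β (.cond (.ratLE (.get 9 vi) (.get 8 (ix vk vj)))
        (.setRat 10 (.const 0) (.get 9 vi)) (.setRat 10 (.const 0) (.get 8 (ix vk vj)))) s
        (fun t => t = s.setRat 10 0 δ) := by
      refine .cond (fun hle => ?_) (fun hle => ?_)
      · simp only [Test.holds, NExp.eval, QExp.eval, si, sj, sk, hn] at hle
        have : δ = s.rat 9 i := min_eq_left hle
        refine .setRat ?_ ?_ <;> simp only [NExp.eval, QExp.eval, si, ← this]
        exact sizeδ
      · simp only [Test.holds, NExp.eval, QExp.eval, si, sj, sk, hn, not_le] at hle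
        have : δ = s.rat 8 (k * n + j) := min_eq_right hle.le
        refine .setRat ?_ ?_ <;> simp only [NExp.eval, QExp.eval, sj, sk, hn, ← this]
        exact sizeδ
    refine hmin.mono ?_
    rintro t rfl
    have t1 : ((s.setRat 10 0 δ).rat 10) 0 = δ := by simp [State.setRat]
    refine .seq (.setRat ?_ (.seq (.setRat ?_ (.seq (.setRat ?_ (.setRat ?_ ?_))))))
    all_goals
      simp only [NExp.eval, QExp.eval, setRat_nat, si, sj, sk, hn, setRat_rat_self, ne_eq,
        Nat.reduceEqDiff, not_false_eq_true, setRat_rat_ne,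
        Function.update_self, Function.update_of_ne hij'.symm, Function.update_of_ne hik.symm]
    · exact b1
    · exact b2
    · exact b3
    · exact b4
    · exact fin
  · refine ⟨hn, hE, hI, hF, hp.imp id fun h => ⟨h.1, h.2, fun hcan => hc' ?_⟩⟩
    rw [htest]
    rw [← h.1] at hcan
    obtain ⟨a1, a2, a3, a4, a5⟩ := hcan
    simp only [Test.holds, Test.holds_natEQ, Test.holds_ratLT, NExp.eval, QExp.eval, si, sj, sk,
      hn]
    exact ⟨a1, a2, a3, a4, a5⟩

theorem relabelAgentProg_spec (lim : Limits n N β D Q) {s : State} {done : Prop} {i : ℕ}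
    (hi : i < n) (si : s.nat 10 0 = i) (h : Sweeping n D E d c σ done s) :
    Reaches N β relabelAgentProg s (Sweeping n D E d c σ
      (done ∧ (σ.h i = n + 1 ∨ ∃ j < n, E i j ∧ σ.l j = σ.h i))) := by
  have hn := h.1
  refine .seq (.setNat ?_ ?_)
  · simp only [NExp.eval, hn]; exact lim.small (by omega)
  simp only [NExp.eval, hn]
  refine .seq (.forN lim (by simpa [State.setNat] using hn) (fun j t => Sweeping n D E d c σ done t ∧
    t.nat 10 0 = i ∧ t.nat 15 0 ≤ n + 1 ∧ (∀ b < j, E i b → t.nat 15 0 ≤ t.nat 5 b) ∧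
    (t.nat 15 0 = n + 1 ∨ ∃ b < n, E i b ∧ t.nat 5 b = t.nat 15 0)) rfl (by norm_num) rfl ?_ ?_ ?_)
  · refine ⟨(h.setNat (by norm_num)).setNat (by norm_num), ?_⟩
    simp [State.setNat, si]
  · rintro j t hj - hn' tj ⟨hS, ti, hle, hall, hex⟩
    have hE := hS.2.1
    have hlj : t.nat 5 j ≤ n + 1 := hS.2.2.1.l_le j hj
    refine .cond (fun hc => .setNat ?_ ?_) (fun hc => .skip ?_)
    · simp only [NExp.eval, tj]; exact lim.small (by omega)
    · simp only [Test.holds, edgeTest_holds hn', hE, NExp.eval, ti, tj, not_le] at hc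
      refine ⟨(hS.setNat (by norm_num)).setNat (by norm_num), ?_⟩
      simp [State.setNat, NExp.eval, tj, ti]
      refine ⟨hlj, fun b hb hEb => ?_, Or.inr ⟨j, hj, hc.1, rfl⟩⟩
      rcases hb.lt_or_eq with h' | rfl
      · exact hc.2.le.trans (hall b h' hEb)
      · exact le_rfl
    · simp only [Test.holds, edgeTest_holds hn', hE, NExp.eval, ti, tj, not_le, not_and,
        not_lt] at hc
      refine ⟨hS.setNat (by norm_num), ?_⟩
      simp [State.setNat, ti]
      refine ⟨hle, fun b hb hEb => ?_, hex⟩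
      rcases hb.lt_or_eq with h' | rfl
      · exact hall b h' hEb
      · exact hc hEb
  · rintro t - hn' ⟨hS, ti, hle, hall, hex⟩
    obtain ⟨-, hE, hI, hF, hp⟩ := hS
    refine .setNat ?_ ?_
    · simp only [NExp.eval]; exact lim.small (by omega)
    simp only [NExp.eval, ti]
    set v := t.nat 15 0
    have hE' : edgeOf n (t.setNat 4 i v) = E := by
      rw [edgeOf_setNat (by norm_num) (by norm_num) (by norm_num), hE]
    have hn'' : (t.setNat 4 i v).nat 0 0 = n := by rw [setNat_nat_ne (by norm_num), hn']
    have hh : (flowOf n (t.setNat 4 i v)).h = Function.update (flowOf n t).h i v := by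
      simp only [flowOf, setNat_nat_self]
    have hl : (flowOf n (t.setNat 4 i v)).l = (flowOf n t).l := by
      simp only [flowOf, setNat_nat_ne (show 5 ≠ 4 by norm_num)]
    have hv : (flowOf n t).h i ≤ v := by
      rcases hex with h' | ⟨b, hb, hEb, h'⟩
      · rw [h']; exact hI.h_le i hi.le
      · rw [← h']; exact hI.edge i hi b hb hEb
    rcases hv.eq_or_lt with heq | hlt
    · have hsame : flowOf n (t.setNat 4 i v) = flowOf n t := by
        have : (flowOf n (t.setNat 4 i v)).h = (flowOf n t).h := by
          rw [hh, ← heq, Function.update_eq_self]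
        exact Flow.ext_iff.mpr ⟨rfl, rfl, this, hl⟩
      refine ⟨hn'', hE', hsame ▸ hI, hsame ▸ hF, ?_⟩
      rw [hsame]
      refine hp.imp id fun h' => ⟨h'.1, h'.2, ?_⟩
      rw [← h'.1, heq]; exact hex
    · obtain ⟨hI', hpot⟩ := hI.relabelAgent (σ' := flowOf n (t.setNat 4 i v)) hi hlt hle hall rfl rfl
        hh hl
      refine ⟨hn'', hE', hI', hF, Or.inl ?_⟩
      rcases hp with h' | h'
      · exact ⟨h'.1, h'.2.trans hpot⟩
      · rw [← h'.1]
        refine ⟨fun hst => ?_, hpot⟩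
        rcases hst.h i hi with e | ⟨b, hb, hEb, e⟩
        · omega
        · have : v ≤ (flowOf n t).l b := hall b hb hEb
          omega

theorem relabelGoodProg_spec (lim : Limits n N β D Q) {s : State} {done : Prop} {j : ℕ}
    (hj : j < n) (sj : s.nat 11 0 = j) (h : Sweeping n D E d c σ done s) :
    Reaches N β relabelGoodProg s (Sweeping n D E d c σ
      (done ∧ (σ.l j = n + 1 ∨ ∃ k ≤ n, σ.f k j ≠ 0 ∧ σ.l j = σ.h k + 1))) := by
  have hn := h.1
  refine .seq (.setNat ?_ ?_)
  · simp only [NExp.eval, hn]; exact lim.small (by omega)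
  simp only [NExp.eval, hn]
  refine .seq (.forN1 lim (by simpa [State.setNat] using hn) (fun k t => Sweeping n D E d c σ done t ∧
    t.nat 11 0 = j ∧ t.nat 15 0 ≤ n + 1 ∧
    (∀ a < k, t.rat 8 (a * n + j) ≠ 0 → t.nat 15 0 ≤ t.nat 4 a + 1) ∧
    (t.nat 15 0 = n + 1 ∨ ∃ a ≤ n, t.rat 8 (a * n + j) ≠ 0 ∧ t.nat 15 0 = t.nat 4 a + 1))
      rfl (by norm_num) rfl ?_ ?_ ?_)
  · refine ⟨(h.setNat (by norm_num)).setNat (by norm_num), ?_⟩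
    simp [State.setNat, sj]
  · rintro k t hk hn' tk ⟨hS, tj, hle, hall, hex⟩
    have hf0 : 0 ≤ t.rat 8 (k * n + j) := hS.2.2.1.nonneg k hk j hj
    have hhk : t.nat 4 k ≤ n + 1 := hS.2.2.1.h_le k hk
    refine .cond (fun hc => .setNat ?_ ?_) (fun hc => .skip ?_)
    · simp only [NExp.eval, tk]; exact lim.small (by omega)
    · simp only [Test.holds, Test.holds_ratLT, NExp.eval, QExp.eval, tk, tj, hn', not_le] at hc
      refine ⟨(hS.setNat (by norm_num)).setNat (by norm_num), ?_⟩
      simp [State.setNat, NExp.eval, tj, tk]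
      refine ⟨by omega, fun a ha hfa => ?_, Or.inr ⟨k, hk, hc.1.ne', rfl⟩⟩
      rcases ha.lt_or_eq with h' | rfl
      · have := hall a h' hfa; omega
      · exact le_rfl
    · simp only [Test.holds, Test.holds_ratLT, NExp.eval, QExp.eval, tk, tj, hn', not_le, not_and,
        not_lt] at hc
      refine ⟨hS.setNat (by norm_num), ?_⟩
      simp [State.setNat, tj]
      refine ⟨hle, fun a ha hfa => ?_, hex⟩
      rcases ha.lt_or_eq with h' | rfl
      · exact hall a h' hfa
      · exact hc (lt_of_le_of_ne hf0 (Ne.symm hfa))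
  · rintro t hn' ⟨hS, tj, hle, hall, hex⟩
    obtain ⟨-, hE, hI, hF, hp⟩ := hS
    refine .setNat ?_ ?_
    · simp only [NExp.eval]; exact lim.small (by omega)
    simp only [NExp.eval, tj]
    set v := t.nat 15 0
    have hE' : edgeOf n (t.setNat 5 j v) = E := by
      rw [edgeOf_setNat (by norm_num) (by norm_num) (by norm_num), hE]
    have hn'' : (t.setNat 5 j v).nat 0 0 = n := by rw [setNat_nat_ne (by norm_num), hn']
    have hl : (flowOf n (t.setNat 5 j v)).l = Function.update (flowOf n t).l j v := by
      simp only [flowOf, setNat_nat_self]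
    have hh : (flowOf n (t.setNat 5 j v)).h = (flowOf n t).h := by
      simp only [flowOf, setNat_nat_ne (show 4 ≠ 5 by norm_num)]
    have hv : (flowOf n t).l j ≤ v := by
      rcases hex with h' | ⟨b, hb, hEb, h'⟩
      · rw [h']; exact hI.l_le j hj
      · rw [h']; exact hI.holder b hb j hj hEb
    rcases hv.eq_or_lt with heq | hlt
    · have hsame : flowOf n (t.setNat 5 j v) = flowOf n t := by
        have : (flowOf n (t.setNat 5 j v)).l = (flowOf n t).l := by
          rw [hl, ← heq, Function.update_eq_self]
        exact Flow.ext_iff.mpr ⟨rfl, rfl, hh, this⟩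
      refine ⟨hn'', hE', hsame ▸ hI, hsame ▸ hF, ?_⟩
      rw [hsame]
      refine hp.imp id fun h' => ⟨h'.1, h'.2, ?_⟩
      rw [← h'.1, heq]; exact hex
    · obtain ⟨hI', hpot⟩ := hI.relabelGood (σ' := flowOf n (t.setNat 5 j v)) hj hlt hle
        (fun k hk hf => hall k (by omega) hf) rfl rfl hh hl
      refine ⟨hn'', hE', hI', hF, Or.inl ?_⟩
      rcases hp with h' | h'
      · exact ⟨h'.1, h'.2.trans hpot⟩
      · rw [← h'.1]
        refine ⟨fun hst => ?_, hpot⟩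
        rcases hst.l j hj with e | ⟨b, hb, hfb, e⟩
        · omega
        · have : v ≤ (flowOf n t).h b + 1 := hall b (by omega) hfb
          omega

theorem sweepProg_spec (lim : Limits n N β D Q) (hd : ∀ i ≤ n, d i ≤ Q) (hc : ∀ j < n, c j ≤ Q)
    {s : State} (hn : s.nat 0 0 = n) (hE : edgeOf n s = E) (hI : (flowOf n s).Inv n E d c)
    (hF : (flowOf n s).IsFine n D) :
    Reaches N β sweepProg s
      (Sweeping n D E d c (flowOf n s) ((flowOf n s).Stable n E)) := by
  set σ := flowOf n s
  have start : Sweeping n D E d c σ True s := ⟨hn, hE, hI, hF, Or.inr ⟨rfl, trivial⟩⟩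
  refine .seq (.forN lim hn (fun i t => Sweeping n D E d c σ
    (∀ a < i, ∀ b < n, ∀ k ≤ n, ¬ σ.CanPush E a b k) t) rfl (by norm_num) rfl ?_ ?_ ?_)
  · exact (start.setNat (by norm_num)).mono (by simp)
  · intro i t hi _ hn' ti hS
    refine .forN lim hn' (fun j t => t.nat 10 0 = i ∧ Sweeping n D E d c σ
      ((∀ a < i, ∀ b < n, ∀ k ≤ n, ¬ σ.CanPush E a b k) ∧
        ∀ b < j, ∀ k ≤ n, ¬ σ.CanPush E i b k) t) rfl (by norm_num) rfl ?_ ?_ ?_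
    · refine ⟨by simpa [State.setNat] using ti, (hS.setNat (by norm_num)).mono fun h => ⟨h, by simp⟩⟩
    · rintro j t hj - hn' tj ⟨ti, hS⟩
      refine .forN1 lim hn' (fun k t => t.nat 10 0 = i ∧ t.nat 11 0 = j ∧ Sweeping n D E d c σ
        (((∀ a < i, ∀ b < n, ∀ k ≤ n, ¬ σ.CanPush E a b k) ∧
        ∀ b < j, ∀ k ≤ n, ¬ σ.CanPush E i b k) ∧ ∀ m < k, ¬ σ.CanPush E i j m) t)
        rfl (by norm_num) rfl ?_ ?_ ?_
      · exact ⟨by simpa [State.setNat] using ti, by simpa [State.setNat] using tj,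
          (hS.setNat (by norm_num)).mono fun h => ⟨h, by simp⟩⟩
      · rintro k t hk hn' tk ⟨ti, tj, hS⟩
        refine ((pushProg_spec lim hd hc hi hj hk ti tj tk hS).frame).mono ?_
        rintro t' ⟨hf, hS'⟩
        refine ⟨?_, ?_, (hS'.setNat (by norm_num)).mono ?_⟩
        · rw [setNat_nat_ne (by norm_num), hf.1 10 rfl, ti]
        · rw [setNat_nat_ne (by norm_num), hf.1 11 rfl, tj]
        · rintro ⟨⟨h1, h2⟩, h3⟩
          refine ⟨h1, fun m hm => ?_⟩
          rcases Nat.lt_succ_iff_lt_or_eq.mp hm with h' | rfl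
          · exact h2 m h'
          · exact h3
      · rintro t hn' ⟨ti, tj, hS⟩
        refine ⟨by rw [setNat_nat_ne (by norm_num), ti], (hS.setNat (by norm_num)).mono ?_⟩
        rintro ⟨⟨h1, h2⟩, h3⟩
        refine ⟨h1, fun b hb k hk => ?_⟩
        rcases Nat.lt_succ_iff_lt_or_eq.mp hb with h' | rfl
        · exact h2 b h' k hk
        · exact h3 k (by omega)
    · rintro t - hn' ⟨ti, hS⟩
      refine (hS.setNat (by norm_num)).mono ?_
      rintro ⟨h1, h2⟩ a ha
      rcases Nat.lt_succ_iff_lt_or_eq.mp ha with h' | rfl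
      · exact h1 a h'
      · exact h2
  intro t _ hn' hS
  refine .seq (.forN lim hn' (fun i t => Sweeping n D E d c σ
    ((∀ a < n, ∀ b < n, ∀ k ≤ n, ¬ σ.CanPush E a b k) ∧
      ∀ a < i, σ.h a = n + 1 ∨ ∃ j < n, E a j ∧ σ.l j = σ.h a) t) rfl (by norm_num) rfl ?_ ?_ ?_)
  · exact (hS.setNat (by norm_num)).mono fun h => ⟨h, by simp⟩
  · intro i t hi _ _ ti hS
    refine (relabelAgentProg_spec lim hi ti hS).mono fun t' hS' => (hS'.setNat (by norm_num)).mono ?_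
    rintro ⟨⟨h1, h2⟩, h3⟩
    refine ⟨h1, fun a ha => ?_⟩
    rcases Nat.lt_succ_iff_lt_or_eq.mp ha with h' | rfl
    · exact h2 a h'
    · exact h3
  intro t _ hn' hS
  refine .forN lim hn' (fun j t => Sweeping n D E d c σ
    (((∀ a < n, ∀ b < n, ∀ k ≤ n, ¬ σ.CanPush E a b k) ∧
      ∀ a < n, σ.h a = n + 1 ∨ ∃ j < n, E a j ∧ σ.l j = σ.h a) ∧
      ∀ b < j, σ.l b = n + 1 ∨ ∃ k ≤ n, σ.f k b ≠ 0 ∧ σ.l b = σ.h k + 1) t)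
      rfl (by norm_num) rfl ?_ ?_ ?_
  · exact (hS.setNat (by norm_num)).mono fun h => ⟨h, by simp⟩
  · intro j t hj _ _ tj hS
    refine (relabelGoodProg_spec lim hj tj hS).mono fun t' hS' => (hS'.setNat (by norm_num)).mono ?_
    rintro ⟨⟨h1, h2⟩, h3⟩
    refine ⟨h1, fun a ha => ?_⟩
    rcases Nat.lt_succ_iff_lt_or_eq.mp ha with h' | rfl
    · exact h2 a h'
    · exact h3
  · intro t _ _ hS
    exact hS.mono fun h => ⟨h.1.1, h.1.2, h.2⟩

end

end ADHZ

namespace ADHZ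

open Finset

/-- The expression for `(n + 3) ^ 5`. -/
def sweepBound : NExp :=
  let m : NExp := .add vn (.const 3)
  .mul m (.mul m (.mul m (.mul m m)))

/-- Initially the dummy agent holds everything, and the agents demand what they can pay for at the
prices in the arrays `6` and `7` with the budgets in array `5`. -/
def flowInitProg : Program :=
  .seq (forLoop 10 vn
    (.seq (.cond (.ratEQ (.get 6 vi) (.const 0)) (.setRat 9 vi (.const 1))
      (.cond (.ratLE (.get 5 vi) (.get 6 vi)) (.setRat 9 vi (.get 5 vi))
        (.setRat 9 vi (.get 6 vi))))
    (.seq (.setNat 4 vi (.const 0)) (forLoop 11 vn (.setRat 8 (ix vi vj) (.const 0))))))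
  (.seq (forLoop 11 vn
    (.seq (.cond (.ratEQ (.get 7 vj) (.const 0)) (.setRat 8 (ix vn vj) (.const 1))
      (.setRat 8 (ix vn vj) (.get 7 vj)))
    (.setNat 5 vj (.const 1))))
  (.seq (.setNat 4 vn (.const 0)) (.setRat 9 vn (.const 0))))

/-- A maximum flow for the prices in the arrays `6` and `7` and the budgets in array `5`. -/
def flowProg : Program := .seq flowInitProg (forLoop 13 sweepBound sweepProg)

/-- The demands at the prices in the memory; the dummy agent's is the total capacity. -/
def demOf (n : ℕ) (s : State) (i : ℕ) : ℚ :=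
  if i < n then dem (s.rat 5 i) (s.rat 6 i) else ∑ j ∈ range n, cap (s.rat 7 j)

/-- The capacities at the prices in the memory. -/
def capOf (s : State) (j : ℕ) : ℚ := cap (s.rat 7 j)

/-- The budgets and prices in the memory are in the range that the flow program can handle. -/
structure FlowReady (n D : ℕ) (s : State) : Prop where
  n_eq : s.nat 0 0 = n
  budget : ∀ i < n, 0 < s.rat 5 i ∧ Fine D (s.rat 5 i)
  priceA : ∀ i < n, 0 ≤ s.rat 6 i ∧ s.rat 6 i ≤ n ∧ Fine D (s.rat 6 i)
  priceG : ∀ j < n, 0 ≤ s.rat 7 j ∧ s.rat 7 j ≤ n ∧ Fine D (s.rat 7 j)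

theorem cap_le {q : ℚ} {m : ℕ} (hq : q ≤ m) : cap q ≤ (m + 1 : ℕ) := by
  unfold cap; push_cast; split_ifs
  · have : (0 : ℚ) ≤ m := Nat.cast_nonneg m
    linarith
  · linarith

theorem Fine.cap {D : ℕ} {q : ℚ} (h : Fine D q) : Fine D (cap q) := by
  unfold ADHZ.cap; split_ifs
  · exact Fine.one D
  · exact h

theorem Fine.dem {D : ℕ} {b q : ℚ} (hb : Fine D b) (h : Fine D q) : Fine D (dem b q) := by
  unfold ADHZ.dem; split_ifs
  · exact Fine.one D
  · exact hb.min h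

section

variable {n N β D Q : ℕ} {s : State}

theorem FlowReady.capOf_le (lim : Limits n N β D Q) (h : FlowReady n D s) :
    ∀ j < n, capOf s j ≤ Q := by
  intro j hj
  obtain ⟨h1, h2, -⟩ := h.priceG j hj
  refine (cap_le h2).trans ?_
  have := lim.range
  have := lim.one_le
  have : n + 1 ≤ n * (n + 1) := Nat.le_mul_of_pos_left _ (by omega)
  exact_mod_cast (by omega : n + 1 ≤ Q)

theorem FlowReady.demOf_le (lim : Limits n N β D Q) (h : FlowReady n D s) :
    ∀ i ≤ n, demOf n s i ≤ Q := by
  intro i hi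
  unfold demOf
  have h3 := lim.range
  have h4 := lim.one_le
  have h5 : n + 1 ≤ n * (n + 1) := Nat.le_mul_of_pos_left _ (by omega)
  split_ifs with hi'
  · obtain ⟨h1, h2, -⟩ := h.priceA i hi'
    refine (dem_le_cap _ _).trans ((cap_le h2).trans ?_)
    exact_mod_cast (by omega : n + 1 ≤ Q)
  · refine (sum_le_card_nsmul _ _ ((n + 1 : ℕ) : ℚ) fun j hj => ?_).trans ?_
    · obtain ⟨h1, h2, -⟩ := h.priceG j (by simpa using hj)
      exact cap_le h2
    · rw [card_range, nsmul_eq_mul]; exact_mod_cast h3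

theorem FlowReady.size (lim : Limits n N β D Q) {v : ℚ} (h0 : 0 ≤ v) (hv : v ≤ (n + 1 : ℕ))
    (hF : Fine D v) : ratBits v ≤ β := by
  have h3 := lim.range
  have h4 := lim.one_le
  have h5 : n + 1 ≤ n * (n + 1) := Nat.le_mul_of_pos_left _ (by omega)
  exact lim.rat v hF h0 (hv.trans (by exact_mod_cast (by omega : n + 1 ≤ Q)))

theorem flowInitProg_spec (lim : Limits n N β D Q) (h : FlowReady n D s) :
    Reaches N β flowInitProg s fun s' => (flowOf n s').Inv n (edgeOf n s) (demOf n s) (capOf s) ∧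
      (flowOf n s').IsFine n D := by
  have hn := h.n_eq
  have hdem : ∀ i < n, 0 ≤ dem (s.rat 5 i) (s.rat 6 i) ∧ ratBits (dem (s.rat 5 i) (s.rat 6 i)) ≤ β := by
    intro i hi
    obtain ⟨h1, h2, h3⟩ := h.priceA i hi
    have h0 := dem_nonneg (h.budget i hi).1 h1
    exact ⟨h0, FlowReady.size lim h0 ((dem_le_cap _ _).trans (cap_le h2))
      ((h.budget i hi).2.dem h3)⟩
  have zero_size : ratBits 0 ≤ β := FlowReady.size lim le_rfl (Nat.cast_nonneg _) (Fine.zero D)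
  refine .seq (.forN lim hn (fun i t => ∀ a < i, t.rat 9 a = dem (s.rat 5 a) (s.rat 6 a) ∧
    t.nat 4 a = 0 ∧ ∀ b < n, t.rat 8 (a * n + b) = 0) rfl (by norm_num) rfl ?_ ?_ ?_)
  · intro a ha; omega
  · intro i t hi hf hn' ti hI
    have t5 : t.rat 5 = s.rat 5 := hf.2 5 rfl
    have t6 : t.rat 6 = s.rat 6 := hf.2 6 rfl
    have hset : Reaches N β (.cond (.ratEQ (.get 6 vi) (.const 0)) (.setRat 9 vi (.const 1))
        (.cond (.ratLE (.get 5 vi) (.get 6 vi)) (.setRat 9 vi (.get 5 vi))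
        (.setRat 9 vi (.get 6 vi)))) t
        (fun t' => t' = t.setRat 9 i (dem (s.rat 5 i) (s.rat 6 i))) := by
      have hsz := (hdem i hi).2
      refine .cond (fun hc => ?_) (fun hc => .cond (fun hc' => ?_) (fun hc' => ?_))
      · simp only [Test.holds_ratEQ, QExp.eval, NExp.eval, ti, t6] at hc
        have e : dem (s.rat 5 i) (s.rat 6 i) = 1 := by simp [dem, hc]
        rw [e] at hsz ⊢
        refine .setRat hsz ?_
        simp [QExp.eval, NExp.eval, ti]
      · simp only [Test.holds_ratEQ, Test.holds, QExp.eval, NExp.eval, ti, t6, t5] at hc hc'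
        have e : dem (s.rat 5 i) (s.rat 6 i) = s.rat 5 i := by simp [dem, hc, hc']
        rw [e] at hsz ⊢
        refine .setRat ?_ ?_ <;> simp only [QExp.eval, NExp.eval, ti, t5]
        exact hsz
      · simp only [Test.holds_ratEQ, Test.holds, QExp.eval, NExp.eval, ti, t6, t5, not_le] at hc hc'
        have e : dem (s.rat 5 i) (s.rat 6 i) = s.rat 6 i := by simp [dem, hc, hc'.le]
        rw [e] at hsz ⊢
        refine .setRat ?_ ?_ <;> simp only [QExp.eval, NExp.eval, ti, t6]
        exact hsz
    refine .seq (hset.mono ?_)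
    rintro t' rfl
    refine .seq (.setNat (lim.small (Nat.zero_le _)) ?_)
    simp only [NExp.eval, setRat_nat, ti]
    set t1 := (t.setRat 9 i (dem (s.rat 5 i) (s.rat 6 i))).setNat 4 i 0
    have hn1 : t1.nat 0 0 = n := by
      simp only [t1]; rw [setNat_nat_ne (by norm_num), setRat_nat, hn']
    have ti1 : t1.nat 10 0 = i := by
      simp only [t1]; rw [setNat_nat_ne (by norm_num), setRat_nat, ti]
    have inv1 : ∀ a < i + 1, t1.rat 9 a = dem (s.rat 5 a) (s.rat 6 a) ∧ t1.nat 4 a = 0 := by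
      intro a ha
      by_cases hai : a = i
      · subst hai; simp [t1, State.setNat, State.setRat]
      · have := hI a (by omega)
        simp [t1, State.setNat, State.setRat, hai, this]
    have inv8 : ∀ a < i, ∀ b < n, t1.rat 8 (a * n + b) = 0 := by
      intro a ha b hb
      have := (hI a ha).2.2 b hb
      simpa [t1, State.setNat, State.setRat] using this
    refine .forN lim hn1 (fun j t' => (∀ a < i, ∀ b < n, t'.rat 8 (a * n + b) = 0) ∧
      ∀ b < j, t'.rat 8 (i * n + b) = 0) rfl (by norm_num) rfl ⟨inv8, by simp⟩ ?_ ?_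
    · rintro j t' hj hf' hn'' tj ⟨h1, h2⟩
      have ti' : t'.nat 10 0 = i := by rw [hf'.1 10 rfl, ti1]
      refine .setRat zero_size ?_
      simp only [NExp.eval, QExp.eval, ti', tj, hn'', setNat_rat, setRat_rat_self,
        Function.update_apply]
      refine ⟨fun a ha b hb => ?_, fun b hb => ?_⟩
      · split_ifs
        · rfl
        · exact h1 a ha b hb
      · simp only [index_inj (show b < n by omega) hj]
        by_cases hbj : b = j
        · simp [hbj]
        · simp only [hbj, and_false, if_false]; exact h2 b (by omega)
    · rintro t' hf' hn'' ⟨h1, h2⟩ a ha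
      rw [setNat_rat, setNat_nat_ne (by norm_num), hf'.1 4 rfl, hf'.2 9 rfl]
      refine ⟨(inv1 a ha).1, (inv1 a ha).2, fun b hb => ?_⟩
      by_cases hai : a = i
      · subst hai; exact h2 b hb
      · exact h1 a (by omega) b hb
  intro t hf hn' hI
  have t7 : t.rat 7 = s.rat 7 := hf.2 7 rfl
  refine .seq (.forN lim hn' (fun j u => (∀ a < n, ∀ b < n, u.rat 8 (a * n + b) = 0) ∧
    ∀ b < j, u.rat 8 (n * n + b) = capOf s b ∧ u.nat 5 b = 1) rfl (by norm_num) rfl ?_ ?_ ?_)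
  · exact ⟨fun a ha => (hI a ha).2.2, by simp⟩
  · rintro j u hj hf' hn'' uj ⟨h1, h2⟩
    have u7 : u.rat 7 = s.rat 7 := by rw [hf'.2 7 rfl, t7]
    obtain ⟨g1, g2, g3⟩ := h.priceG j hj
    have hsz : ratBits (capOf s j) ≤ β := FlowReady.size lim (cap_pos g1).le (cap_le g2) g3.cap
    have hset : Reaches N β (.cond (.ratEQ (.get 7 vj) (.const 0)) (.setRat 8 (ix vn vj) (.const 1))
        (.setRat 8 (ix vn vj) (.get 7 vj))) u (fun u' => u' = u.setRat 8 (n * n + j) (capOf s j)) := by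
      refine .cond (fun hc => ?_) (fun hc => ?_)
      · simp only [Test.holds_ratEQ, QExp.eval, NExp.eval, uj, u7] at hc
        have e : capOf s j = 1 := by simp [capOf, cap, hc]
        rw [e] at hsz ⊢
        refine .setRat hsz ?_
        simp [QExp.eval, NExp.eval, uj, hn'']
      · simp only [Test.holds_ratEQ, QExp.eval, NExp.eval, uj, u7] at hc
        have e : capOf s j = s.rat 7 j := by simp [capOf, cap, hc]
        rw [e] at hsz ⊢
        refine .setRat ?_ ?_ <;> simp only [QExp.eval, NExp.eval, uj, u7, hn'']
        exact hsz
    refine .seq (hset.mono ?_)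
    rintro u' rfl
    refine .setNat (lim.small (by simp only [NExp.eval]; omega)) ?_
    simp only [NExp.eval, setRat_nat, uj]
    refine ⟨fun a ha b hb => ?_, fun b hb => ?_⟩
    · simp only [setNat_rat, setRat_rat_self, Function.update_apply]
      simp only [index_inj hb hj]
      rw [if_neg (by omega)]
      exact h1 a ha b hb
    · simp only [setNat_rat, setRat_rat_self, Function.update_apply]
      simp only [index_inj (show b < n by omega) hj]
      rw [setNat_nat_ne (show 5 ≠ 11 by norm_num), setNat_nat_self, Function.update_apply,
        setRat_nat]
      by_cases hbj : b = j
      · simp [hbj]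
      · simp only [hbj, and_false, if_false]; exact h2 b (by omega)
  rintro u hf' hn'' ⟨h1, h2⟩
  refine .seq (.setNat (lim.small (Nat.zero_le _)) (.setRat zero_size ?_))
  simp only [NExp.eval, QExp.eval, hn'', setNat_nat_ne (show 0 ≠ 4 by norm_num)]
  set w := (u.setNat 4 n 0).setRat 9 n 0
  have wf : ∀ i < n, ∀ j < n, (flowOf n w).f i j = 0 := fun i hi j hj => by
    simpa [w, flowOf, State.setNat, State.setRat] using h1 i hi j hj
  have wfn : ∀ j < n, (flowOf n w).f n j = capOf s j := fun j hj => by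
    simpa [w, flowOf, State.setNat, State.setRat] using (h2 j hj).1
  have wr : ∀ i < n, (flowOf n w).r i = dem (s.rat 5 i) (s.rat 6 i) := fun i hi => by
    have := (hI i hi).1
    have e : u.rat 9 = t.rat 9 := hf'.2 9 rfl
    simp [w, flowOf, State.setNat, State.setRat, hi.ne, e, this]
  have wrn : (flowOf n w).r n = 0 := by simp [w, flowOf, State.setRat]
  have wh : ∀ i ≤ n, (flowOf n w).h i = 0 := fun i hi => by
    have e : u.nat 4 = t.nat 4 := hf'.1 4 rfl
    rcases hi.lt_or_eq with h' | rfl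
    · have := (hI i h').2.1
      simp [w, flowOf, State.setNat, State.setRat, h'.ne, e, this]
    · simp [w, flowOf, State.setNat, State.setRat]
  have wl : ∀ j < n, (flowOf n w).l j = 1 := fun j hj => by
    simpa [w, flowOf, State.setNat, State.setRat] using (h2 j hj).2
  have hcap : ∀ j < n, 0 < capOf s j := fun j hj => cap_pos (h.priceG j hj).1
  refine ⟨⟨?_, ?_, ?_, ?_, ?_, ?_, ?_, wh n le_rfl, ?_, ?_, ?_⟩, ?_, ?_⟩
  · intro i hi j hj
    rcases hi.lt_or_eq with h' | rfl
    · rw [wf i h' j hj]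
    · rw [wfn j hj]; exact (hcap j hj).le
  · intro i hi j hj hne; exact absurd (wf i hi j hj) hne
  · intro j hj
    rw [sum_range_succ, wfn j hj, sum_eq_zero fun i hi => wf i (by simpa using hi) j hj, zero_add]
  · intro i hi
    rcases hi.lt_or_eq with h' | rfl
    · rw [wr i h']; exact (hdem i h').1
    · rw [wrn]
  · intro i hi
    unfold demOf
    rcases hi.lt_or_eq with h' | rfl
    · rw [wr i h', if_pos h', sum_eq_zero fun j hj => wf i h' j (by simpa using hj), zero_add]
    · rw [wrn, if_neg (lt_irrefl _), add_zero]
      exact sum_congr rfl fun j hj => wfn j (by simpa using hj)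
  · intro i hi j hj _; rw [wh i hi.le]; exact Nat.zero_le _
  · intro i hi j hj _; rw [wh i hi, wl j hj]
  · intro i hi; rw [wh i hi]; exact Nat.zero_le _
  · intro j hj; rw [wl j hj]
  · intro j hj; rw [wl j hj]; omega
  · intro i hi j hj
    rcases hi.lt_or_eq with h' | rfl
    · rw [wf i h' j hj]; exact Fine.zero D
    · rw [wfn j hj]; exact (h.priceG j hj).2.2.cap
  · intro i hi
    rcases hi.lt_or_eq with h' | rfl
    · rw [wr i h']; exact (h.budget i h').2.dem (h.priceA i h').2.2
    · rw [wrn]; exact Fine.zero D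

theorem flowProg_spec (lim : Limits n N β D Q) (h : FlowReady n D s) :
    Reaches N β flowProg s fun s' => (flowOf n s').Inv n (edgeOf n s) (demOf n s) (capOf s) ∧
      (flowOf n s').IsFine n D ∧ (flowOf n s').Stable n (edgeOf n s) := by
  refine .seq_of (flowInitProg_spec lim h) ?_
  rintro t hf ⟨hI, hF⟩
  have hn : t.nat 0 0 = n := by rw [hf.1 0 rfl, h.n_eq]
  have hE : edgeOf n t = edgeOf n s := edgeOf_frame hf rfl rfl rfl rfl rfl
  -- after `k` sweeps the potential is at least `k`, unless a stable state was reached before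
  refine .forLoop (M := (n + 3) ^ 5) (fun k t => t.nat 0 0 = n ∧ edgeOf n t = edgeOf n s ∧
    (flowOf n t).Inv n (edgeOf n s) (demOf n s) (capOf s) ∧ (flowOf n t).IsFine n D ∧
    (k ≤ (flowOf n t).pot n ∨ (flowOf n t).Stable n (edgeOf n s))) rfl ?_ lim.loops
    (lim.nat _ le_rfl) ?_ ?_ ?_
  · intro t' hf'
    simp only [sweepBound, NExp.eval, hf'.1 0 rfl, hn]; ring
  · refine ⟨hn, ?_⟩
    rw [edgeOf_setNat (by norm_num) (by norm_num) (by norm_num),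
      flowOf_setNat (by norm_num) (by norm_num)]
    exact ⟨hE, hI, hF, Or.inl (Nat.zero_le _)⟩
  · rintro k t' hk - - ⟨hn', hE', hI', hF', hk'⟩
    refine (sweepProg_spec lim (h.demOf_le lim) (h.capOf_le lim) hn' hE' hI' hF').mono ?_
    rintro t'' hS
    obtain ⟨g1, g2, g3, g4, g5⟩ := hS.setNat (a := 13) (k := 0) (v := k + 1) (by norm_num)
    refine ⟨g1, g2, g3, g4, ?_⟩
    rcases g5 with ⟨g5, g6⟩ | ⟨g5, g6⟩
    · rcases hk' with hk' | hk'
      · left; omega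
      · exact absurd hk' g5
    · right; rw [g5]; exact g6
  · rintro t' - ⟨hn', hE', hI', hF', hk'⟩
    refine ⟨hI', hF', ?_⟩
    rcases hk' with hk' | hk'
    · -- at the maximal potential, another sweep could not make progress
      exfalso
      have := hI'.pot_lt
      omega
    · exact hk'

end

end ADHZ

namespace ADHZ

open Finset

/-! ### The program for a round -/

/-- The flag in natural-number array `14` says whether some demand is unmet. -/
def actProg : Program :=
  .seq (.setNat 14 (.const 0) (.const 0))
    (forLoop 10 vn (.cond (.ratLT (.const 0) (.get 9 vi)) (.setNat 14 (.const 0) (.const 1)) .skip))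

/-- Splitting of the blocks.  The members with the top label in array `lab` move to the new block
with the odd number; for the others, the price in array `pi` becomes the new upper price. -/
def splitProg (id lab hi pi : ℕ) : Program :=
  forLoop 10 vn (.cond (.natLE (.add vn (.const 1)) (.get lab vi))
    (.setNat id vi (.add (.mul (.const 2) (.get id vi)) (.const 1)))
    (.seq (.setNat id vi (.mul (.const 2) (.get id vi))) (.setRat hi vi (.get pi vi))))

/-- Counts the goods and the rich agents of the block of `vj`, and adds up the budgets of its poor
agents; the limit between rich and poor is the budget of agent `vi`. -/
def countProg (id : ℕ) : Program :=
  .seq (.setNat 16 (.const 0) (.const 0)) (.seq (.setNat 17 (.const 0) (.const 0))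
  (.seq (.setRat 10 (.const 0) (.const 0))
  (forLoop 12 vn (.seq
    (.cond (.natEQ (.get 3 vk) (.get id vj)) (.setNat 16 (.const 0) (.add (nvar 16) (.const 1))) .skip)
    (.cond (.natEQ (.get 2 vk) (.get id vj))
      (.cond (.ratLE (.get 5 vk) (.get 5 vi))
        (.setRat 10 (.const 0) (.add (qvar 10) (.get 5 vk)))
        (.setNat 17 (.const 0) (.add (nvar 17) (.const 1)))) .skip)))))

/-- The prices of the blocks of the agents or goods whose block numbers are in array `id`. -/
def priceProg (id hi pi : ℕ) : Program :=
  forLoop 11 vn (.seq (.setRat pi vj (.get hi vj))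
    (forLoop 10 vn (.cond (.natEQ (.get 2 vi) (.get id vj))
      (.seq (countProg id) (.cond (.neg (.natLE (nvar 16) (nvar 17)))
        (.seq (.setRat 10 (.const 0) (.div (qvar 10) (.ofNat (.sub (nvar 16) (nvar 17)))))
          (.cond (.ratLT (qvar 10) (.get pi vj)) (.setRat pi vj (qvar 10)) .skip)) .skip))
      .skip)))

/-- One block, with the price `0` and the upper price `n`. -/
def solveInitProg : Program :=
  .seq (forLoop 10 vn (.seq (.setNat 2 vi (.const 0)) (.seq (.setNat 3 vi (.const 0))
    (.seq (.setRat 6 vi (.const 0)) (.seq (.setRat 7 vi (.const 0))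
    (.seq (.setRat 11 vi (.ofNat vn)) (.setRat 12 vi (.ofNat vn))))))))
    (.setNat 14 (.const 0) (.const 1))

/-- New blocks and their prices. -/
def refineProg : Program :=
  .seq (splitProg 2 4 11 6) (.seq (splitProg 3 5 12 7) (.seq (priceProg 2 11 6) (priceProg 3 12 7)))

/-- Equilibrium prices for the budgets in rational array `5`. -/
def solveProg : Program :=
  .seq solveInitProg (.loop (.natEQ (nvar 14) (.const 1))
    (.seq flowProg (.seq actProg (.cond (.natEQ (nvar 14) (.const 1)) refineProg .skip))))

/-- The bound on the encoding length of the memory may be used to prove the next one. -/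
theorem Reaches.of_small {N β : ℕ} {P : Program} {s : State} {Q : State → Prop}
    (h : Small β s → Reaches N β P s Q) : Reaches N β P s Q := fun hs => h hs hs

section

variable {n N β D Q : ℕ} {s : State}

theorem actProg_spec (lim : Limits n N β D Q) (hn : s.nat 0 0 = n) :
    Reaches N β actProg s fun t => t.nat 14 0 = 1 ↔ ∃ i < n, 0 < s.rat 9 i := by
  refine .seq (.setNat (lim.small (Nat.zero_le _)) ?_)
  simp only [NExp.eval]
  refine .forN lim (by rw [setNat_nat_ne (by norm_num), hn])
    (fun k t => t.nat 14 0 = 1 ↔ ∃ i < k, 0 < s.rat 9 i) rfl (by norm_num) rfl ?_ ?_ ?_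
  · simp [State.setNat]
  · intro k t hk hf hn' tk hI
    have e : t.rat 9 = s.rat 9 := hf.2 9 rfl
    refine .cond (fun hc => .setNat (lim.small (by simp [NExp.eval])) ?_) (fun hc => .skip ?_) <;>
      simp only [Test.holds_ratLT, QExp.eval, NExp.eval, tk, e] at hc
    · simp only [State.setNat, NExp.eval]
      simpa using ⟨k, by omega, hc⟩
    · rw [setNat_nat_ne (by norm_num), hI]
      refine ⟨fun ⟨i, h1, h2⟩ => ⟨i, by omega, h2⟩, fun ⟨i, h1, h2⟩ => ⟨i, ?_, h2⟩⟩
      by_contra h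
      obtain rfl : i = k := by omega
      exact hc h2
  · intro t _ _ h; exact h

theorem splitProg_spec (lim : Limits n N β D Q) {id lab hi pi : ℕ} (h1 : id ≠ 10) (h2 : id ≠ 0)
    (h3 : lab ≠ 10) (h4 : lab ≠ id) (h5 : pi ≠ hi) (hn : s.nat 0 0 = n)
    (hlab : ∀ a < n, s.nat lab a ≤ n + 1) (hid : ∀ a < n, natBits (2 * s.nat id a + 1) ≤ β) :
    Reaches N β (splitProg id lab hi pi) s fun t => ∀ a < n,
      t.nat id a = 2 * s.nat id a + (if s.nat lab a = n + 1 then 1 else 0) ∧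
      t.rat hi a = if s.nat lab a = n + 1 then s.rat hi a else s.rat pi a := by
  refine .forN lim hn (fun k t => (∀ a < k,
      t.nat id a = 2 * s.nat id a + (if s.nat lab a = n + 1 then 1 else 0) ∧
      t.rat hi a = if s.nat lab a = n + 1 then s.rat hi a else s.rat pi a) ∧
    ∀ a, k ≤ a → t.nat id a = s.nat id a ∧ t.rat hi a = s.rat hi a)
    (by simp [Program.writesNat, h1]) (by norm_num) (by simp [Program.writesNat, h2]) ?_ ?_ ?_
  · simp [State.setNat, h1]
  · rintro k t hk hf hn' tk ⟨hI, hI'⟩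
    have el : t.nat lab = s.nat lab := hf.1 lab (by
      simp [forLoop, Program.writesNat, Ne.symm h3, Ne.symm h4])
    have ep : t.rat pi = s.rat pi := hf.2 pi (by
      simp [forLoop, Program.writesRat, Ne.symm h5])
    obtain ⟨i1, i2⟩ := hI' k le_rfl
    refine .of_small fun hs => .cond (fun hc => .setNat ?_ ?_) (fun hc => .seq (.setNat ?_
      (.setRat ?_ ?_)))
    · simpa only [NExp.eval, tk, i1] using hid k hk
    · simp only [Test.holds, NExp.eval, tk, hn', el] at hc
      have e : s.nat lab k = n + 1 := le_antisymm (hlab k hk) hc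
      simp only [NExp.eval, tk, i1, State.setNat, Function.update_of_ne h1, Function.update_self]
      refine ⟨fun a ha => ?_, fun a ha => ?_⟩
      · by_cases hak : a = k
        · subst hak; simp [e, i2]
        · simpa [hak] using hI a (by omega)
      · have hak : a ≠ k := by omega
        simpa [hak] using hI' a (by omega)
    · simp only [NExp.eval, tk, i1]; exact (natBits_mono (by omega)).trans (hid k hk)
    · exact hs.2 _ _
    · simp only [Test.holds, NExp.eval, tk, hn', el] at hc
      have e : s.nat lab k ≠ n + 1 := by omega
      have ek : (t.setNat id k (2 * s.nat id k)).nat 10 0 = k := by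
        rw [setNat_nat_ne (Ne.symm h1), tk]
      simp only [NExp.eval, QExp.eval, tk, i1, ek, setNat_rat, ep]
      simp only [State.setNat, State.setRat, Function.update_of_ne h1, Function.update_self]
      refine ⟨fun a ha => ?_, fun a ha => ?_⟩
      · by_cases hak : a = k
        · subst hak; simp [e]
        · simpa [hak] using hI a (by omega)
      · have hak : a ≠ k := by omega
        simpa [hak] using hI' a (by omega)
  · intro t _ _ h; exact h.1

theorem numGoods_succ (m : ℕ) (idG : ℕ → ℕ) (k : ℕ) :
    numGoods (m + 1) idG k = numGoods m idG k + if idG m = k then 1 else 0 := by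
  unfold numGoods
  rw [range_add_one, filter_insert]
  split_ifs <;> simp

theorem numRich_succ (m : ℕ) (b : ℕ → ℚ) (idA : ℕ → ℕ) (k : ℕ) (γ : ℚ) :
    numRich (m + 1) b idA k γ = numRich m b idA k γ + if idA m = k ∧ γ < b m then 1 else 0 := by
  unfold numRich
  rw [range_add_one, filter_insert]
  split_ifs <;> simp

theorem poorBudget_succ (m : ℕ) (b : ℕ → ℚ) (idA : ℕ → ℕ) (k : ℕ) (γ : ℚ) :
    poorBudget (m + 1) b idA k γ = poorBudget m b idA k γ + if idA m = k ∧ b m ≤ γ then b m else 0 := by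
  unfold poorBudget
  rw [range_add_one, filter_insert]
  split_ifs <;> simp [add_comm]

theorem numGoods_le (m : ℕ) (idG : ℕ → ℕ) (k : ℕ) : numGoods m idG k ≤ m :=
  (card_filter_le _ _).trans (card_range m).le

theorem numRich_le (m : ℕ) (b : ℕ → ℚ) (idA : ℕ → ℕ) (k : ℕ) (γ : ℚ) :
    numRich m b idA k γ ≤ m :=
  (card_filter_le _ _).trans (card_range m).le

/-- The budgets in the memory are positive multiples of `1 / D'`, and their sum is at most `n`. -/
structure BudgetReady (n D' : ℕ) (b : ℕ → ℚ) : Prop where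
  pos : ∀ i < n, 0 < b i
  fine : ∀ i < n, Fine D' (b i)
  sum_le : ∑ i ∈ range n, b i ≤ n

variable {D' : ℕ} {b : ℕ → ℚ}

theorem BudgetReady.poorBudget (hb : BudgetReady n D' b) {m : ℕ} (hm : m ≤ n) (idA : ℕ → ℕ) (k : ℕ)
    (γ : ℚ) : Fine D' (poorBudget m b idA k γ) ∧ 0 ≤ ADHZ.poorBudget m b idA k γ ∧
      ADHZ.poorBudget m b idA k γ ≤ n := by
  have hlt : ∀ i ∈ (range m).filter (fun i => idA i = k ∧ b i ≤ γ), i < n := fun i hi => by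
    simp at hi; omega
  refine ⟨Fine.sum fun i hi => hb.fine i (hlt i hi), sum_nonneg fun i hi => (hb.pos i (hlt i hi)).le,
    le_trans (sum_le_sum_of_subset_of_nonneg ?_ fun i hi _ => ?_) hb.sum_le⟩
  · intro i hi; simpa using hlt i hi
  · exact (hb.pos i (by simpa using hi)).le

theorem BudgetReady.blockCand (hb : BudgetReady n D' b) (hD : D' * n.factorial ∣ D)
    {idA idG : ℕ → ℕ} {k : ℕ} {γ : ℚ} (hc : numRich n b idA k γ < numGoods n idG k) :
    Fine D (blockCand n b idA idG k γ) ∧ 0 ≤ ADHZ.blockCand n b idA idG k γ ∧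
      ADHZ.blockCand n b idA idG k γ ≤ n := by
  obtain ⟨h1, h2, h3⟩ := hb.poorBudget le_rfl idA k γ
  have hpos : 0 < numGoods n idG k - numRich n b idA k γ := Nat.sub_pos_of_lt hc
  have hle : numGoods n idG k - numRich n b idA k γ ≤ n :=
    (Nat.sub_le _ _).trans (numGoods_le n idG k)
  refine ⟨(h1.div hpos).of_dvd ((Nat.mul_dvd_mul_left _ (Nat.dvd_factorial hpos hle)).trans hD),
    div_nonneg h2 (Nat.cast_nonneg _), (div_le_self h2 ?_).trans h3⟩
  exact_mod_cast hpos

theorem BudgetReady.scanPrice (hb : BudgetReady n D' b) (hD : D' * n.factorial ∣ D)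
    (idA idG : ℕ → ℕ) (k : ℕ) {hi : ℚ} (hF : Fine D hi) (h0 : 0 ≤ hi) (m : ℕ) :
    Fine D (scanPrice n b idA idG k hi m) ∧ 0 ≤ ADHZ.scanPrice n b idA idG k hi m := by
  rcases scanPrice_eq (n := n) (b := b) (idA := idA) (idG := idG) (k := k) (hi := hi) m with
    h | ⟨i, -, -, hc, h⟩
  · rw [h]; exact ⟨hF, h0⟩
  · rw [h]; obtain ⟨h1, h2, -⟩ := hb.blockCand hD hc; exact ⟨h1, h2⟩

theorem Limits.of_le (lim : Limits n N β D Q) {v : ℚ} (hF : Fine D v) (h0 : 0 ≤ v) (h : v ≤ n) :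
    ratBits v ≤ β := by
  refine lim.rat v hF h0 (h.trans ?_)
  have := lim.range
  have := lim.one_le
  have : n ≤ n * (n + 1) := Nat.le_mul_of_pos_right _ (by omega)
  exact_mod_cast (by omega : n ≤ Q)

theorem countProg_spec (lim : Limits n N β D Q) (hD : D' * n.factorial ∣ D) {id i j : ℕ}
    (hid : id = 2 ∨ id = 3) (hn : s.nat 0 0 = n) (hb : BudgetReady n D' (s.rat 5))
    (si : s.nat 10 0 = i) (sj : s.nat 11 0 = j) :
    Reaches N β (countProg id) s fun t => t.nat 16 0 = numGoods n (s.nat 3) (s.nat id j) ∧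
      t.nat 17 0 = numRich n (s.rat 5) (s.nat 2) (s.nat id j) (s.rat 5 i) ∧
      t.rat 10 0 = poorBudget n (s.rat 5) (s.nat 2) (s.nat id j) (s.rat 5 i) := by
  have hD' : D' ∣ D := (Dvd.intro _ rfl).trans hD
  have w : ∀ a, a ≠ 12 → a ≠ 16 → a ≠ 17 → (countProg id).writesNat a = false := by
    intro a h1 h2 h3
    simp [countProg, forLoop, Program.writesNat, h1.symm, h2.symm, h3.symm]
  refine .seq (.setNat (lim.small (Nat.zero_le _)) (.seq (.setNat (lim.small (Nat.zero_le _))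
    (.seq (.setRat (lim.of_le (Fine.zero D) le_rfl (Nat.cast_nonneg _)) ?_)))))
  simp only [NExp.eval, QExp.eval]
  refine .forN lim (by simpa [State.setNat, State.setRat] using hn) (fun m t =>
    t.nat 16 0 = numGoods m (s.nat 3) (s.nat id j) ∧
      t.nat 17 0 = numRich m (s.rat 5) (s.nat 2) (s.nat id j) (s.rat 5 i) ∧
      t.rat 10 0 = poorBudget m (s.rat 5) (s.nat 2) (s.nat id j) (s.rat 5 i))
      rfl (by norm_num) rfl ?_ ?_ ?_
  · simp [State.setNat, State.setRat, numGoods, numRich, poorBudget]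
  · rintro m t hm hf hn' tm ⟨h1, h2, h3⟩
    have e2 : t.nat 2 = s.nat 2 := hf.1 2 rfl
    have e3 : t.nat 3 = s.nat 3 := hf.1 3 rfl
    have e5 : t.rat 5 = s.rat 5 := hf.2 5 rfl
    have ti : t.nat 10 0 = i := by rw [hf.1 10 rfl]; simpa [State.setNat, State.setRat] using si
    have tj : t.nat 11 0 = j := by rw [hf.1 11 rfl]; simpa [State.setNat, State.setRat] using sj
    have eid : t.nat id = s.nat id := by rcases hid with rfl | rfl <;> assumption
    have c1 : Reaches N β (.cond (.natEQ (.get 3 vk) (.get id vj))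
        (.setNat 16 (.const 0) (.add (nvar 16) (.const 1))) .skip) t
        fun u => u.nat 16 0 = numGoods (m + 1) (s.nat 3) (s.nat id j) := by
      refine .cond (fun hc => .setNat ?_ ?_) (fun hc => .skip ?_)
      · simp only [NExp.eval, h1]
        have := numGoods_le m (s.nat 3) (s.nat id j)
        exact lim.small (by omega)
      · simp only [Test.holds_natEQ, NExp.eval, tm, tj, e3, eid] at hc
        simp only [NExp.eval, setNat_nat_self, Function.update_self, h1, numGoods_succ, if_pos hc]
      · simp only [Test.holds_natEQ, NExp.eval, tm, tj, e3, eid] at hc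
        rw [h1, numGoods_succ, if_neg hc, add_zero]
    refine .seq_of c1 ?_
    intro u hu g1
    have u2 : u.nat 2 = s.nat 2 := by rw [hu.1 2 rfl, e2]
    have u5 : u.rat 5 = s.rat 5 := by rw [hu.2 5 rfl, e5]
    have u10 : u.rat 10 = t.rat 10 := hu.2 10 rfl
    have u17 : u.nat 17 = t.nat 17 := hu.1 17 rfl
    have ui : u.nat 10 0 = i := by rw [hu.1 10 rfl, ti]
    have uj : u.nat 11 0 = j := by rw [hu.1 11 rfl, tj]
    have um : u.nat 12 0 = m := by rw [hu.1 12 rfl, tm]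
    have uid : u.nat id = s.nat id := by
      rw [hu.1 id (by rcases hid with rfl | rfl <;> rfl), eid]
    refine .cond (fun hc => .cond (fun hc' => .setRat ?_ ?_) (fun hc' => .setNat ?_ ?_))
      (fun hc => .skip ?_) <;>
      simp only [Test.holds_natEQ, NExp.eval, um, uj, u2, uid] at hc
    · simp only [Test.holds, NExp.eval, QExp.eval, um, u5, ui] at hc'
      simp only [NExp.eval, QExp.eval, u10, h3, um, u5]
      obtain ⟨p1, p2, p3⟩ := hb.poorBudget (show m + 1 ≤ n by omega) (s.nat 2) (s.nat id j) (s.rat 5 i)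
      rw [poorBudget_succ, if_pos ⟨hc, hc'⟩] at p1 p2 p3
      exact lim.of_le (p1.of_dvd hD') p2 p3
    · simp only [Test.holds, NExp.eval, QExp.eval, um, u5, ui] at hc'
      simp only [NExp.eval, QExp.eval, u10, h3, um, u5]
      rw [poorBudget_succ, if_pos ⟨hc, hc'⟩, numRich_succ, if_neg (by simp [hc']), add_zero, ← h2,
        ← u17, ← g1]
      simp [State.setNat, State.setRat]
    · simp only [NExp.eval, u17, h2]
      have := numRich_le m (s.rat 5) (s.nat 2) (s.nat id j) (s.rat 5 i)
      exact lim.small (by omega)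
    · simp only [Test.holds, NExp.eval, QExp.eval, um, u5, ui, not_le] at hc'
      simp only [NExp.eval, u17, h2]
      rw [poorBudget_succ, if_neg (by simp [hc']), numRich_succ, if_pos ⟨hc, hc'⟩, add_zero, ← h3,
        ← u10, ← g1]
      simp [State.setNat]
    · rw [poorBudget_succ, if_neg (by simp [hc]), numRich_succ, if_neg (by simp [hc]), add_zero,
        add_zero, ← h3, ← h2, ← g1, ← u10, ← u17]
      simp [State.setNat]
  · intro t _ _ h; exact h

theorem priceProg_spec (lim : Limits n N β D Q) (hD : D' * n.factorial ∣ D) {id hi pi : ℕ}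
    (h : (id, hi, pi) = (2, 11, 6) ∨ (id, hi, pi) = (3, 12, 7)) (hn : s.nat 0 0 = n)
    (hb : BudgetReady n D' (s.rat 5)) :
    Reaches N β (priceProg id hi pi) s fun t => ∀ a < n, t.rat pi a =
      scanPrice n (s.rat 5) (s.nat 2) (s.nat 3) (s.nat id a) (s.rat hi a) n := by
  have hid : id = 2 ∨ id = 3 := by rcases h with h | h <;> simp_all
  have w : (priceProg id hi pi).writesNat 2 = false ∧ (priceProg id hi pi).writesNat 3 = false ∧
      (priceProg id hi pi).writesRat 5 = false ∧ (priceProg id hi pi).writesRat hi = false := by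
    rcases h with h | h <;> obtain ⟨rfl, rfl, rfl⟩ := by simpa using h
    all_goals exact ⟨rfl, rfl, rfl, rfl⟩
  have wc : (countProg id).writesRat pi = false := by
    rcases h with h | h <;> obtain ⟨rfl, rfl, rfl⟩ := by simpa using h
    all_goals rfl
  have hpi : pi ≠ 10 := by rcases h with h | h <;> simp_all
  have hpi5 : pi ≠ 5 := by rcases h with h | h <;> simp_all
  have hids : ∀ {t : State}, t.nat 2 = s.nat 2 → t.nat 3 = s.nat 3 → t.nat id = s.nat id := by
    intro t h2 h3; rcases hid with rfl | rfl <;> assumption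
  -- the outer loop prices the members one after the other; the inner loop computes `scanPrice`
  refine .forN lim hn (fun j t => ∀ a < j, t.rat pi a =
      scanPrice n (s.rat 5) (s.nat 2) (s.nat 3) (s.nat id a) (s.rat hi a) n)
      rfl (by norm_num) rfl (by simp) ?_ fun t _ _ h => h
  intro j t hj hf hn' tj hI
  have e2 : t.nat 2 = s.nat 2 := hf.1 2 w.1
  have e3 : t.nat 3 = s.nat 3 := hf.1 3 w.2.1
  have e5 : t.rat 5 = s.rat 5 := hf.2 5 w.2.2.1
  have eh : t.rat hi = s.rat hi := hf.2 hi w.2.2.2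
  refine .of_small fun hs => .seq (.setRat (hs.2 _ _) ?_)
  simp only [NExp.eval, QExp.eval, tj, eh]
  refine .forN lim (by rw [setRat_nat, hn']) (fun i u => u.nat 11 0 = j ∧ u.nat 2 = s.nat 2 ∧
      u.nat 3 = s.nat 3 ∧ u.rat 5 = s.rat 5 ∧ (∀ a < j, u.rat pi a =
      scanPrice n (s.rat 5) (s.nat 2) (s.nat 3) (s.nat id a) (s.rat hi a) n) ∧
      u.rat pi j = scanPrice n (s.rat 5) (s.nat 2) (s.nat 3) (s.nat id j) (s.rat hi j) i)
      rfl (by norm_num) rfl ?_ ?_ ?_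
  · refine ⟨by simpa [State.setNat, State.setRat] using tj, by simpa [State.setNat, State.setRat] using e2,
      by simpa [State.setNat, State.setRat] using e3, by simpa [State.setNat, State.setRat, hpi5.symm] using e5,
      fun a ha => ?_, by simp [State.setNat, State.setRat, scanPrice]⟩
    simpa [State.setNat, State.setRat, ha.ne] using hI a ha
  · rintro i u hi' - hn'' ui ⟨uj, u2, u3, u5, hI1, hI2⟩
    have uid := hids u2 u3
    -- whatever the branch, it suffices that cell `j` of array `pi` holds the next scan price
    have post : ∀ v : State, v.nat 11 = u.nat 11 → v.nat 2 = u.nat 2 → v.nat 3 = u.nat 3 →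
        v.rat 5 = u.rat 5 → v.rat pi = Function.update (u.rat pi) j
          (scanPrice n (s.rat 5) (s.nat 2) (s.nat 3) (s.nat id j) (s.rat hi j) (i + 1)) →
        (v.setNat 10 0 (i + 1)).nat 11 0 = j ∧ (v.setNat 10 0 (i + 1)).nat 2 = s.nat 2 ∧
        (v.setNat 10 0 (i + 1)).nat 3 = s.nat 3 ∧ (v.setNat 10 0 (i + 1)).rat 5 = s.rat 5 ∧
        (∀ a < j, (v.setNat 10 0 (i + 1)).rat pi a =
          scanPrice n (s.rat 5) (s.nat 2) (s.nat 3) (s.nat id a) (s.rat hi a) n) ∧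
        (v.setNat 10 0 (i + 1)).rat pi j =
          scanPrice n (s.rat 5) (s.nat 2) (s.nat 3) (s.nat id j) (s.rat hi j) (i + 1) := by
      intro v v11 v2 v3 v5 vp
      simp only [setNat_rat, setNat_nat_ne (show 11 ≠ 10 by norm_num),
        setNat_nat_ne (show 2 ≠ 10 by norm_num), setNat_nat_ne (show 3 ≠ 10 by norm_num), v11, v2, v3,
        v5, vp, uj, u2, u3, u5, Function.update_self, true_and, and_true]
      intro a ha
      rw [Function.update_of_ne ha.ne, hI1 a ha]
    refine .cond (fun hc => .seq_of (countProg_spec lim hD hid hn'' (by rw [u5]; exact hb) ui uj) ?_)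
      (fun hc => .skip (post u rfl rfl rfl rfl ?_)) <;>
      simp only [Test.holds_natEQ, NExp.eval, ui, uj, u2, uid] at hc
    · intro v hv hv'
      rw [u2, u3, u5, uid] at hv'
      obtain ⟨g1, g2, g3⟩ := hv'
      have v2 : v.nat 2 = u.nat 2 := hv.1 2 rfl
      have v3 : v.nat 3 = u.nat 3 := hv.1 3 rfl
      have v11 : v.nat 11 = u.nat 11 := hv.1 11 rfl
      have vj : v.nat 11 0 = j := by rw [v11, uj]
      have v5 : v.rat 5 = u.rat 5 := hv.2 5 rfl
      have vp : v.rat pi = u.rat pi := hv.2 pi wc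
      refine .cond (fun hc' => ?_) (fun hc' => .skip (post v v11 v2 v3 v5 ?_)) <;>
        simp only [Test.holds, NExp.eval, g1, g2, not_le, not_lt] at hc'
      · have hcand : v.rat 10 0 / ((v.nat 16 0 - v.nat 17 0 : ℕ) : ℚ) =
            blockCand n (s.rat 5) (s.nat 2) (s.nat 3) (s.nat id j) (s.rat 5 i) := by
          rw [g1, g2, g3]; rfl
        obtain ⟨p1, p2, p3⟩ := hb.blockCand hD hc'
        have hsz := lim.of_le p1 p2 p3
        refine .seq (.setRat ?_ (.cond (fun hl => .setRat ?_ (post _ ?_ ?_ ?_ ?_ ?_))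
          (fun hl => .skip (post _ ?_ ?_ ?_ ?_ ?_)))) <;>
          simp only [NExp.eval, QExp.eval, hcand, setRat_nat, setRat_rat_self,
            setRat_rat_ne (show 5 ≠ 10 by norm_num), Function.update_self, setRat_rat_ne hpi5.symm,
            setRat_rat_ne hpi, v2, v3, v5, v11, vp, vj]
        · exact hsz
        · exact hsz
        · simp only [Test.holds_ratLT, NExp.eval, QExp.eval, hcand, setRat_nat, setRat_rat_self,
            Function.update_self, setRat_rat_ne hpi, vp, vj, hI2] at hl
          rw [scanPrice, if_pos ⟨hc, hc', hl⟩]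
        · simp only [Test.holds_ratLT, NExp.eval, QExp.eval, hcand, setRat_nat, setRat_rat_self,
            Function.update_self, setRat_rat_ne hpi, vp, vj, hI2] at hl
          rw [scanPrice, if_neg (fun h => hl h.2.2), ← hI2, Function.update_eq_self]
      · rw [vp, scanPrice, if_neg (fun h => absurd h.2.1 (by omega)), ← hI2,
          Function.update_eq_self]
    · rw [scanPrice, if_neg (fun h => hc h.1), ← hI2, Function.update_eq_self]
  · rintro u - - ⟨u1, u2, u3, u4, hI1, hI2⟩ a ha
    rw [setNat_rat]
    rcases Nat.lt_succ_iff_lt_or_eq.mp ha with h' | rfl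
    · exact hI1 a h'
    · exact hI2

end

end ADHZ

namespace ADHZ

open Finset

/-! ### Correctness of a round -/

section

variable {n N β D D' Q k : ℕ} {s : State} {L E : ℕ → ℕ → Prop} {b : ℕ → ℚ} {idA idG : ℕ → ℕ}
  {lo hi pr : ℕ → ℚ} {pos : ℕ → Prop}

theorem Blocks.congr {idA' idG' : ℕ → ℕ} {pos' : ℕ → Prop} (B : Blocks n L b idA idG lo hi pos)
    (hA : ∀ i < n, idA' i = idA i) (hG : ∀ j < n, idG' j = idG j) (hpos : ∀ k, pos' k → pos k) :
    Blocks n L b idA' idG' lo hi pos' := by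
  refine ⟨B.lo_nonneg, B.lo_le, fun i hi j hj => ?_, ?_, ?_⟩
  · rw [hA i hi, hG j hj]; exact B.ord i hi j hj
  · obtain ⟨z, z0, zE, zd, zc⟩ := B.meet
    refine ⟨z, z0, fun i hi j hj h => ?_, fun i hi => ?_, fun j hj => ?_⟩
    · rw [hA i hi, hG j hj]; exact zE i hi j hj h
    · rw [hA i hi]; exact zd i hi
    · rw [hG j hj]; exact zc j hj
  · obtain ⟨z, z0, zE, zd, zc⟩ := B.sell
    refine ⟨z, z0, fun i hi j hj h => ?_, fun i hi => ?_, fun j hj h => ?_⟩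
    · rw [hA i hi, hG j hj]; exact zE i hi j hj h
    · rw [hA i hi]; exact zd i hi
    · rw [hG j hj] at h ⊢; exact zc j hj (hpos _ h)

/-- The number of pairs of agents in different blocks. -/
def numApart (n : ℕ) (idA : ℕ → ℕ) : ℕ :=
  #{a ∈ range n ×ˢ range n | idA a.1 ≠ idA a.2}

theorem numApart_le : numApart n idA ≤ n ^ 2 :=
  (card_filter_le _ _).trans (by simp [sq])

theorem numApart_lt {idA' : ℕ → ℕ} (h : ∀ i < n, ∀ i' < n, idA i ≠ idA i' → idA' i ≠ idA' i')
    {i i' : ℕ} (hi : i < n) (hi' : i' < n) (he : idA i = idA i') (hne : idA' i ≠ idA' i') :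
    numApart n idA < numApart n idA' := by
  refine card_lt_card ⟨fun a ha => ?_, fun hsub => ?_⟩
  · simp only [mem_filter, mem_product, mem_range] at ha ⊢
    exact ⟨ha.1, h _ ha.1.1 _ ha.1.2 ha.2⟩
  · have : (i, i') ∈ (range n ×ˢ range n).filter fun a => idA a.1 ≠ idA a.2 :=
      hsub (by simp [hi, hi', hne])
    simp [he] at this

/-- The situation after `k` refinements.  The prices of the initial block are not balanced, so the
first refinement need not separate any agents. -/
structure Refining (n D : ℕ) (L : ℕ → ℕ → Prop) (b : ℕ → ℚ) (k : ℕ) (lo pr hi : ℕ → ℚ)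
    (idA idG : ℕ → ℕ) : Prop where
  blocks : Blocks n L b idA idG lo hi fun κ => pr κ ≠ 0
  range : ∀ κ, lo κ ≤ pr κ ∧ pr κ ≤ hi κ
  hi_le : ∀ κ, hi κ ≤ n
  fine : ∀ κ, Fine D (pr κ) ∧ Fine D (hi κ)
  balanced : (k = 0 ∧ ∀ κ, pr κ = 0) ∨
    ∀ κ, (hi κ = 0 ∧ pr κ = 0) ∨ Balanced n b idA idG κ (pr κ)
  progress : k ≤ numApart n idA + 1
  idA_lt : ∀ i < n, idA i < 2 ^ k
  idG_lt : ∀ j < n, idG j < 2 ^ k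

theorem Refining.start (hb : BudgetReady n D' b) (hn : 1 ≤ n) (hL : ∀ i < n, ∃ j < n, L i j)
    (hA : ∀ i < n, idA i = 0) (hG : ∀ j < n, idG j = 0) :
    Refining n D L b 0 (fun _ => 0) (fun _ => 0) (fun _ => n) idA idG := by
  have hn' : (0 : ℚ) < n := by exact_mod_cast hn
  refine ⟨(Blocks.start hb.sum_le hb.pos hn' hL).congr hA hG fun _ h => h, fun _ => ⟨le_rfl, hn'.le⟩,
    fun _ => le_rfl, fun _ => ⟨Fine.zero D, Fine.natCast D n⟩, Or.inl ⟨rfl, fun _ => rfl⟩,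
    Nat.zero_le _, fun i hi => ?_, fun j hj => ?_⟩
  · rw [hA i hi]; norm_num
  · rw [hG j hj]; norm_num

/-- A refinement: the blocks are split along the stable flow, and every new block gets a balanced
price. -/
theorem Refining.step (R : Refining n D L b k lo pr hi idA idG) (hb : BudgetReady n D' b)
    (hD : D' * n.factorial ∣ D) {σ : Flow} {d c : ℕ → ℚ} (H : σ.Inv n E d c) (hs : σ.Stable n E)
    (hE : ∀ i < n, ∀ j < n, E i j ↔ L i j ∧ idA i = idG j)
    (hd : ∀ i < n, d i = dem (b i) (pr (idA i))) (hc : ∀ j < n, c j = cap (pr (idG j)))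
    (hr : ∃ i < n, 0 < σ.r i) {idA' idG' : ℕ → ℕ}
    (hA : ∀ i < n, idA' i = 2 * idA i + if σ.h i = n + 1 then 1 else 0)
    (hG : ∀ j < n, idG' j = 2 * idG j + if σ.l j = n + 1 then 1 else 0) {hi' : ℕ → ℚ}
    (hhi : hi' = fun κ => if κ % 2 = 1 then hi (κ / 2) else pr (κ / 2)) :
    Refining n D L b (k + 1) (fun κ => if κ % 2 = 1 then pr (κ / 2) else lo (κ / 2))
      (fun κ => scanPrice n b idA' idG' κ (hi' κ) n) hi' idA' idG' := by
  obtain ⟨i0, hi0, hr0⟩ := hr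
  have htop := H.active_top hs hi0 hr0
  have B1 := R.blocks.split R.range H hs hE hd hc ⟨i0, hi0, htop⟩
  have B2 : Blocks n L b idA' idG' (fun κ => if κ % 2 = 1 then pr (κ / 2) else lo (κ / 2)) hi'
      fun κ => hi' κ ≠ 0 := by
    rw [hhi]; exact B1.congr hA hG fun _ h => h
  obtain ⟨hlo, hbal⟩ := B2.price hb.pos
  have hpos : ∀ κ, 0 ≤ hi' κ := B2.hi_nonneg
  have hfine : ∀ κ, Fine D (hi' κ) := by
    intro κ; rw [hhi]; dsimp only; split_ifs
    · exact (R.fine _).2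
    · exact (R.fine _).1
  have hscan := fun κ => hb.scanPrice hD idA' idG' κ (hfine κ) (hpos κ) n
  refine ⟨B2.congr (fun _ _ => rfl) (fun _ _ => rfl) fun κ h h0 => h ?_,
    fun κ => ⟨hlo κ, scanPrice_le n⟩, fun κ => ?_, fun κ => ⟨(hscan κ).1, hfine κ⟩, Or.inr hbal, ?_,
    fun i hi => ?_, fun j hj => ?_⟩
  · exact le_antisymm ((scanPrice_le n).trans h0.le) (hscan κ).2
  · rw [hhi]; dsimp only; split_ifs
    · exact R.hi_le _
    · exact (R.range _).2.trans (R.hi_le _)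
  · rcases R.balanced with h | h
    · omega
    · obtain ⟨i, hi, i', hi', h1, h2, h3⟩ := R.blocks.exists_split h H hs hE hd hc hi0 hr0
      have : numApart n idA < numApart n idA' := by
        refine numApart_lt (fun a ha a' ha' hne => ?_) hi hi' h1 ?_
        · rw [hA a ha, hA a' ha']; split_ifs <;> omega
        · rw [hA i hi, hA i' hi', if_pos h2, if_neg h3]; omega
      have := R.progress
      omega
  · have := R.idA_lt i hi
    rw [hA i hi, pow_succ]; split_ifs <;> omega
  · have := R.idG_lt j hj
    rw [hG j hj, pow_succ]; split_ifs <;> omega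

theorem refineProg_spec (lim : Limits n N β D Q) (hD : D' * n.factorial ∣ D) (hn : s.nat 0 0 = n)
    (hb : BudgetReady n D' (s.rat 5)) (hA : ∀ a < n, s.nat 4 a ≤ n + 1)
    (hG : ∀ a < n, s.nat 5 a ≤ n + 1)
    (hid : ∀ a < n, natBits (2 * s.nat 2 a + 1) ≤ β ∧ natBits (2 * s.nat 3 a + 1) ≤ β) :
    Reaches N β refineProg s fun t => ∀ a < n,
      (t.nat 2 a = 2 * s.nat 2 a + (if s.nat 4 a = n + 1 then 1 else 0) ∧
      t.rat 11 a = (if s.nat 4 a = n + 1 then s.rat 11 a else s.rat 6 a) ∧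
      t.rat 6 a = scanPrice n (s.rat 5) (t.nat 2) (t.nat 3) (t.nat 2 a) (t.rat 11 a) n) ∧
      (t.nat 3 a = 2 * s.nat 3 a + (if s.nat 5 a = n + 1 then 1 else 0) ∧
      t.rat 12 a = (if s.nat 5 a = n + 1 then s.rat 12 a else s.rat 7 a) ∧
      t.rat 7 a = scanPrice n (s.rat 5) (t.nat 2) (t.nat 3) (t.nat 3 a) (t.rat 12 a) n) := by
  refine .seq_of (splitProg_spec lim (by norm_num) (by norm_num) (by norm_num) (by norm_num)
    (by norm_num) hn hA fun a ha => (hid a ha).1) ?_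
  intro t1 f1 g1
  have n1 : t1.nat 0 0 = n := by rw [f1.1 0 rfl, hn]
  refine .seq_of (splitProg_spec lim (by norm_num) (by norm_num) (by norm_num) (by norm_num)
    (by norm_num) n1 (fun a ha => by rw [f1.1 5 rfl]; exact hG a ha)
    fun a ha => by rw [f1.1 3 rfl]; exact (hid a ha).2) ?_
  intro t2 f2 g2
  have n2 : t2.nat 0 0 = n := by rw [f2.1 0 rfl, n1]
  have b2 : t2.rat 5 = s.rat 5 := by rw [f2.2 5 rfl, f1.2 5 rfl]
  refine .seq_of (priceProg_spec lim hD (Or.inl rfl) n2 (by rw [b2]; exact hb)) ?_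
  intro t3 f3 g3
  have n3 : t3.nat 0 0 = n := by rw [f3.1 0 rfl, n2]
  have b3 : t3.rat 5 = s.rat 5 := by rw [f3.2 5 rfl, b2]
  refine (priceProg_spec lim hD (Or.inr rfl) n3 (by rw [b3]; exact hb)).frame.mono ?_
  rintro t4 ⟨f4, g4⟩ a ha
  refine ⟨⟨?_, ?_, ?_⟩, ?_, ?_, ?_⟩
  · rw [f4.1 2 rfl, f3.1 2 rfl, f2.1 2 rfl]; exact (g1 a ha).1
  · rw [f4.2 11 rfl, f3.2 11 rfl, f2.2 11 rfl]; exact (g1 a ha).2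
  · rw [f4.1 2 rfl, f4.1 3 rfl, f4.2 11 rfl, f4.2 6 rfl, f3.1 2 rfl, f3.1 3 rfl, f3.2 11 rfl,
      g3 a ha, b2]
  · rw [f4.1 3 rfl, f3.1 3 rfl, (g2 a ha).1, f1.1 3 rfl, f1.1 5 rfl]
  · rw [f4.2 12 rfl, f3.2 12 rfl, (g2 a ha).2, f1.1 5 rfl, f1.2 12 rfl, f1.2 7 rfl]
  · rw [f4.1 2 rfl, f4.1 3 rfl, f4.2 12 rfl, g4 a ha, b3]

/-- The liked goods in the memory. -/
def likeOf (n : ℕ) (s : State) (i j : ℕ) : Prop := s.nat 1 (i * n + j) = 1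

/-- The memory after `k` refinements, for some prices of the blocks. -/
def RefiningState (n D k : ℕ) (L : ℕ → ℕ → Prop) (b : ℕ → ℚ) (s : State) (lo pr hi : ℕ → ℚ) :
    Prop :=
  s.nat 0 0 = n ∧ likeOf n s = L ∧ s.rat 5 = b ∧ Refining n D L b k lo pr hi (s.nat 2) (s.nat 3) ∧
    ∀ a < n, (s.rat 6 a = pr (s.nat 2 a) ∧ s.rat 11 a = hi (s.nat 2 a)) ∧
      s.rat 7 a = pr (s.nat 3 a) ∧ s.rat 12 a = hi (s.nat 3 a)

/-- The prices in the memory are equilibrium prices. -/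
def HasPrices (n D : ℕ) (L : ℕ → ℕ → Prop) (b : ℕ → ℚ) (pr : ℕ → ℚ) : Prop :=
  ∃ p q y, EqCert n L b p q y ∧ ∀ j < n, pr j = p j ∧ p j ≤ n ∧ Fine D (p j)

theorem solveInitProg_spec (lim : Limits n N β D Q) (hn : s.nat 0 0 = n)
    (hb : BudgetReady n D' (s.rat 5)) (hL : ∀ i < n, ∃ j < n, likeOf n s i j) :
    Reaches N β solveInitProg s fun t => t.nat 14 0 = 1 ∧
      RefiningState n D 0 (likeOf n s) (s.rat 5) t (fun _ => 0) (fun _ => 0) (fun _ => n) := by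
  have z1 := lim.small (Nat.zero_le (n + 2))
  have z2 := lim.of_le (Fine.zero D) le_rfl (Nat.cast_nonneg _)
  have z3 := lim.of_le (Fine.natCast D n) (Nat.cast_nonneg _) le_rfl
  refine .seq (.forN lim hn (fun k t => ∀ a < k, t.nat 2 a = 0 ∧ t.nat 3 a = 0 ∧ t.rat 6 a = 0 ∧
    t.rat 7 a = 0 ∧ t.rat 11 a = n ∧ t.rat 12 a = n) rfl (by norm_num) rfl (by simp) ?_ ?_)
  · intro k t hk hf hn' tk hI
    refine .seq (.setNat z1 (.seq (.setNat z1 (.seq (.setRat z2 (.seq (.setRat z2 (.seq (.setRat ?_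
      (.setRat ?_ ?_)))))))))) <;>
      simp [NExp.eval, QExp.eval, State.setNat, State.setRat, tk, hn', z3]
    intro a ha
    by_cases hak : a = k
    · simp [hak]
    · simpa [hak] using hI a (by omega)
  · intro t hf hn' hI
    refine .setNat (lim.small (by simp [NExp.eval])) ?_
    have t5 : t.rat 5 = s.rat 5 := hf.2 5 rfl
    have t1 : likeOf n t = likeOf n s := by unfold likeOf; rw [hf.1 1 rfl]
    refine ⟨by simp [State.setNat, NExp.eval], by simp [State.setNat, hn'],
      by
        rw [← t1]; unfold likeOf; rw [setNat_nat_ne (by norm_num)], t5, Refining.start hb lim.one_le hL ?_ ?_, ?_⟩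
    · intro i hi; simpa [State.setNat] using (hI i hi).1
    · intro i hi; simpa [State.setNat] using (hI i hi).2.1
    · intro a ha
      obtain ⟨-, -, h1, h2, h3, h4⟩ := hI a ha
      exact ⟨⟨h1, h3⟩, h2, h4⟩

theorem solveProg_spec (lim : Limits n N β D Q) (hD : D' * n.factorial ∣ D) (hn : s.nat 0 0 = n)
    (hb : BudgetReady n D' (s.rat 5)) (hL : ∀ i < n, ∃ j < n, likeOf n s i j) :
    Reaches N β solveProg s fun t => HasPrices n D (likeOf n s) (s.rat 5) (t.rat 7) := by
  refine .seq_of (solveInitProg_spec lim hn hb hL) ?_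
  rintro s0 - ⟨hact, hR0⟩
  set L := likeOf n s
  set b := s.rat 5
  refine .loop (fun k t => (t.nat 14 0 = 1 ∧ ∃ lo pr hi, RefiningState n D k L b t lo pr hi) ∨
    (t.nat 14 0 ≠ 1 ∧ HasPrices n D L b (t.rat 7))) (Or.inl ⟨hact, _, _, _, hR0⟩) ?_ ?_
  · intro k t hI hc
    simp only [Test.holds_natEQ, NExp.eval] at hc
    rcases hI with ⟨-, lo, pr, hi, hn', hL', hb', R, hpr⟩ | ⟨h, -⟩
    swap
    · exact absurd hc h
    have hk : k ≤ n ^ 2 + 1 := R.progress.trans (Nat.add_le_add_right numApart_le 1)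
    have pr0 : ∀ κ, 0 ≤ pr κ := fun κ => (R.blocks.lo_nonneg κ).trans (R.range κ).1
    have prn : ∀ κ, pr κ ≤ n := fun κ => (R.range κ).2.trans (R.hi_le κ)
    have hD' : D' ∣ D := (Dvd.intro _ rfl).trans hD
    have ready : FlowReady n D t := by
      refine ⟨hn', fun i hi => ?_, fun i hi => ?_, fun j hj => ?_⟩
      · rw [hb']; exact ⟨hb.pos i hi, (hb.fine i hi).of_dvd hD'⟩
      · rw [(hpr i hi).1.1]; exact ⟨pr0 _, prn _, (R.fine _).1⟩
      · rw [(hpr j hj).2.1]; exact ⟨pr0 _, prn _, (R.fine _).1⟩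
    refine ⟨?_, .seq_of (flowProg_spec lim ready) ?_⟩
    -- the number of refinements is bounded by the number of pairs of agents that can be separated
    · have h1 : (n + 3) ^ 2 ≤ (n + 3) ^ 5 := Nat.pow_le_pow_right (by omega) (by norm_num)
      have := lim.loops
      nlinarith
    rintro t1 f1 ⟨H, -, hs⟩
    have hE : ∀ i < n, ∀ j < n, edgeOf n t i j ↔ L i j ∧ t.nat 2 i = t.nat 3 j := by
      intro i hi j hj
      rw [← hL']
      refine ⟨fun h => ⟨h.1, h.2.1⟩, fun h => ⟨h.1, h.2, ?_⟩⟩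
      rw [(hpr i hi).1.1, (hpr j hj).2.1, h.2]
    have hd : ∀ i < n, demOf n t i = dem (b i) (pr (t.nat 2 i)) := by
      intro i hi; rw [demOf, if_pos hi, hb', (hpr i hi).1.1]
    have hcp : ∀ j < n, capOf t j = cap (pr (t.nat 3 j)) := by
      intro j hj; rw [capOf, (hpr j hj).2.1]
    have n1 : t1.nat 0 0 = n := by rw [f1.1 0 rfl, hn']
    refine .seq_of (actProg_spec lim n1) ?_
    intro t2 f2 hact2
    have n2 : t2.nat 0 0 = n := by rw [f2.1 0 rfl, n1]
    have b2 : t2.rat 5 = b := by rw [f2.2 5 rfl, f1.2 5 rfl, hb']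
    have e4 : t2.nat 4 = (flowOf n t1).h := by rw [f2.1 4 rfl]; rfl
    have e5 : t2.nat 5 = (flowOf n t1).l := by rw [f2.1 5 rfl]; rfl
    have e2 : t2.nat 2 = t.nat 2 := by rw [f2.1 2 rfl, f1.1 2 rfl]
    have e3 : t2.nat 3 = t.nat 3 := by rw [f2.1 3 rfl, f1.1 3 rfl]
    have q6 : t2.rat 6 = t.rat 6 := by rw [f2.2 6 rfl, f1.2 6 rfl]
    have q7 : t2.rat 7 = t.rat 7 := by rw [f2.2 7 rfl, f1.2 7 rfl]
    have q11 : t2.rat 11 = t.rat 11 := by rw [f2.2 11 rfl, f1.2 11 rfl]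
    have q12 : t2.rat 12 = t.rat 12 := by rw [f2.2 12 rfl, f1.2 12 rfl]
    have l2 : likeOf n t2 = L := by
      rw [← hL']; unfold likeOf; rw [f2.1 1 rfl, f1.1 1 rfl]
    have hidb : ∀ v < 2 ^ k, natBits (2 * v + 1) ≤ β := by
      intro v hv
      refine lim.ids _ ?_
      have : 2 ^ (k + 1) ≤ 2 ^ (n ^ 2 + 3) := Nat.pow_le_pow_right (by norm_num) (by omega)
      rw [pow_succ] at this
      omega
    refine .cond (fun hc2 => ?_) (fun hc2 => .skip ?_)
    · simp only [Test.holds_natEQ, NExp.eval] at hc2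
      refine (refineProg_spec lim hD n2 (by rw [b2]; exact hb) ?_ ?_ ?_).frame.mono ?_
      · intro a ha; rw [e4]; exact H.h_le a ha.le
      · intro a ha; rw [e5]; exact H.l_le a ha
      · intro a ha; rw [e2, e3]; exact ⟨hidb _ (R.idA_lt a ha), hidb _ (R.idG_lt a ha)⟩
      · rintro t3 ⟨f3, g⟩
        rw [b2, e2, e3, e4, e5, q6, q7, q11, q12] at g
        have R' := R.step hb hD H hs hE hd hcp (hact2.mp hc2) (fun i hi => (g i hi).1.1)
          (fun j hj => (g j hj).2.1) rfl
        refine Or.inl ⟨by rw [f3.1 14 rfl, hc2], _, _, _, by rw [f3.1 0 rfl, n2], ?_,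
          by rw [f3.2 5 rfl, b2], R', fun a ha => ?_⟩
        · rw [← l2]; unfold likeOf; rw [f3.1 1 rfl]
        obtain ⟨⟨g1, g2, g3⟩, g4, g5, g6⟩ := g a ha
        obtain ⟨⟨p1, p2⟩, p3, p4⟩ := hpr a ha
        -- the block number says whether a block is a top block, and from which block it stems
        have parity : ∀ (v : ℕ) (c : Prop) [Decidable c], ((2 * v + if c then 1 else 0) % 2 = 1 ↔ c) ∧
            (2 * v + if c then 1 else 0) / 2 = v := by
          intro v c _
          by_cases h : c
          · simp only [h, if_true, iff_true]; omega
          · simp only [h, if_false, iff_false]; omega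
        have h1 : t3.rat 11 a = if t3.nat 2 a % 2 = 1 then hi (t3.nat 2 a / 2)
            else pr (t3.nat 2 a / 2) := by
          rw [g1, (parity _ _).2, g2, p1, p2]; simp only [(parity _ _).1]
        have h2 : t3.rat 12 a = if t3.nat 3 a % 2 = 1 then hi (t3.nat 3 a / 2)
            else pr (t3.nat 3 a / 2) := by
          rw [g4, (parity _ _).2, g5, p3, p4]; simp only [(parity _ _).1]
        exact ⟨⟨by rw [g3, h1], h1⟩, by rw [g6, h2], h2⟩
    · simp only [Test.holds_natEQ, NExp.eval] at hc2
      have hr : ∀ i < n, (flowOf n t1).r i = 0 := by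
        intro i hi
        by_contra h
        exact hc2 (hact2.mpr ⟨i, hi, lt_of_le_of_ne (H.r_nonneg i hi.le) (Ne.symm h)⟩)
      have hbal : ∀ κ, pr κ = 0 ∨ Balanced n b (t.nat 2) (t.nat 3) κ (pr κ) := fun κ => by
        rcases R.balanced with h | h
        · exact Or.inl (h.2 κ)
        · exact (h κ).imp And.right id
      refine Or.inr ⟨hc2, _, _, _, R.blocks.eqCert hb.pos R.range hbal H hE hd hcp hr, fun j hj => ?_⟩
      rw [q7, (hpr j hj).2.1]
      exact ⟨rfl, prn _, (R.fine _).1⟩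
  · intro k t hI hc
    simp only [Test.holds_natEQ, NExp.eval] at hc
    rcases hI with ⟨h, -⟩ | ⟨-, h⟩
    · exact absurd h hc
    · exact h

end

end ADHZ

namespace ADHZ

open Finset

/-! ### Rounds -/

/-- The budgets after a round with the prices `p`. -/
def budgetFor (n : ℕ) (ε : ℚ) (e : ℕ → ℕ → ℚ) (p : ℕ → ℚ) (i : ℕ) : ℚ :=
  ε / 2 + (1 - ε / 2) * ∑ j ∈ range n, p j * e i j

/-- The endowments `e` are a fractional perfect matching with entries that are multiples of `1 / F`,
and `ε` lies between `0` and `1`. -/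
structure Endowed (n : ℕ) (ε : ℚ) (e : ℕ → ℕ → ℚ) (F : ℕ) : Prop where
  eps_pos : 0 < ε
  eps_lt : ε < 1
  nonneg : ∀ i < n, ∀ j < n, 0 ≤ e i j
  row : ∀ i < n, ∑ j ∈ range n, e i j = 1
  col : ∀ j < n, ∑ i ∈ range n, e i j = 1
  fine : ∀ i < n, ∀ j < n, Fine F (e i j)

/-- `P 0 = 0`, and `P (m + 1)` are the prices of round `m`, for the rounds `0, …, k - 1`. -/
structure PriceRun (n : ℕ) (L : ℕ → ℕ → Prop) (ε : ℚ) (e : ℕ → ℕ → ℚ) (k : ℕ) (P : ℕ → ℕ → ℚ) :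
    Prop where
  zero : ∀ j < n, P 0 j = 0
  cert : ∀ m < k, ∃ q y, EqCert n L (budgetFor n ε e (P m)) (P (m + 1)) q y
  mono : ∀ m < k, ∀ j < n, P m j ≤ P (m + 1) j

theorem EqCert.congr {n : ℕ} {L L' : ℕ → ℕ → Prop} {b b' p p' q : ℕ → ℚ} {y : ℕ → ℕ → ℚ}
    (H : EqCert n L b p q y) (hL : ∀ i < n, ∀ j < n, L i j ↔ L' i j) (hb : ∀ i < n, b i = b' i)
    (hp : ∀ j < n, p j = p' j) : EqCert n L' b' p' q y := by
  refine ⟨fun j hj => hp j hj ▸ H.price_nonneg j hj, H.nonneg, fun i hi j hj h => ?_,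
    fun i hi j hj h => ?_, fun i hi h => H.full i hi (by rw [hb i hi]; exact h),
    fun i hi h => by rw [← hb i hi]; exact H.part i hi (by rw [hb i hi]; exact h), H.col_le,
    fun j hj h => H.col_eq j hj (by rw [hp j hj]; exact h)⟩
  · rw [← hL i hi j hj, ← hp j hj]; exact H.supp i hi j hj h
  · rw [← hp j hj]; exact H.liked i hi j hj ((hL i hi j hj).mpr h)

theorem Limits.of_dvd {n N β D D' Q : ℕ} (lim : Limits n N β D Q) (h : D' ∣ D) :
    Limits n N β D' Q :=
  ⟨lim.one_le, lim.loops, lim.nat, lim.ids, fun v hv => lim.rat v (hv.of_dvd h), lim.range⟩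

theorem Fine.self (q : ℚ) : Fine q.den q := ⟨q.num, Rat.mul_den_eq_num q⟩

section

variable {n F D k : ℕ} {ε : ℚ} {e : ℕ → ℕ → ℚ} {p p' : ℕ → ℚ} {L : ℕ → ℕ → Prop}
  {P : ℕ → ℕ → ℚ}

theorem Endowed.le_one (M : Endowed n ε e F) {i j : ℕ} (hi : i < n) (hj : j < n) : e i j ≤ 1 := by
  rw [← M.row i hi]
  exact single_le_sum (f := fun j => e i j) (fun a ha => M.nonneg i hi a (by simpa using ha))
    (by simpa using hj)

theorem Endowed.worth_nonneg (M : Endowed n ε e F) (hp : ∀ j < n, 0 ≤ p j) {i : ℕ} (hi : i < n) :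
    0 ≤ ∑ j ∈ range n, p j * e i j :=
  sum_nonneg fun j hj => mul_nonneg (hp j (by simpa using hj)) (M.nonneg i hi j (by simpa using hj))

theorem Endowed.budgetFor_pos (M : Endowed n ε e F) (hp : ∀ j < n, 0 ≤ p j) {i : ℕ} (hi : i < n) :
    0 < budgetFor n ε e p i := by
  have h1 := M.eps_pos
  have h2 := M.eps_lt
  have h3 := mul_nonneg (by linarith : 0 ≤ 1 - ε / 2) (M.worth_nonneg hp hi)
  unfold budgetFor
  linarith

theorem Endowed.budgetFor_mono (M : Endowed n ε e F) (hp : ∀ j < n, p j ≤ p' j) {i : ℕ}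
    (hi : i < n) : budgetFor n ε e p i ≤ budgetFor n ε e p' i := by
  have h2 := M.eps_lt
  have h3 : ∑ j ∈ range n, p j * e i j ≤ ∑ j ∈ range n, p' j * e i j :=
    sum_le_sum fun j hj => mul_le_mul_of_nonneg_right (hp j (by simpa using hj))
      (M.nonneg i hi j (by simpa using hj))
  have := mul_le_mul_of_nonneg_left h3 (by linarith : 0 ≤ 1 - ε / 2)
  unfold budgetFor
  linarith

theorem Endowed.sum_budgetFor_le (M : Endowed n ε e F) (hp : ∑ j ∈ range n, p j ≤ n) :
    ∑ i ∈ range n, budgetFor n ε e p i ≤ n := by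
  have h2 := M.eps_lt
  have h3 : ∑ i ∈ range n, ∑ j ∈ range n, p j * e i j = ∑ j ∈ range n, p j := by
    rw [sum_comm]
    refine sum_congr rfl fun j hj => ?_
    rw [← mul_sum, M.col j (by simpa using hj), mul_one]
  simp only [budgetFor]
  rw [sum_add_distrib, ← mul_sum, h3, sum_const, card_range, nsmul_eq_mul]
  nlinarith [mul_le_mul_of_nonneg_left hp (by linarith : 0 ≤ 1 - ε / 2)]

theorem Endowed.budgetFor_fine (M : Endowed n ε e F) (hp : ∀ j < n, Fine D (p j)) {i : ℕ}
    (hi : i < n) : Fine (2 * ε.den * (D * F)) (budgetFor n ε e p i) := by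
  have h1 : Fine (2 * ε.den) (ε / 2) := by
    have := (Fine.self ε).div (k := 2) (by norm_num)
    rw [mul_comm] at this
    exact_mod_cast this
  have h2 : Fine (D * F) (∑ j ∈ range n, p j * e i j) := Fine.sum fun j hj =>
    (hp j (by simpa using hj)).mul (M.fine i hi j (by simpa using hj))
  exact (h1.of_dvd (Dvd.intro _ rfl)).add (((Fine.one _).sub h1).mul h2)

/-- If the budget of some agent falls short of the value of its endowment at the new prices by more
than the factor `1 - ε`, then the total price has increased by more than `ε / 2`. -/
theorem Endowed.sum_price_lt (M : Endowed n ε e F) (hp : ∀ j < n, 0 ≤ p j)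
    (hpp : ∀ j < n, p j ≤ p' j) {i : ℕ} (hi : i < n)
    (h : budgetFor n ε e p i < (1 - ε) * ∑ j ∈ range n, p' j * e i j) :
    ∑ j ∈ range n, p j + ε / 2 < ∑ j ∈ range n, p' j := by
  have h1 := M.eps_pos
  have h2 := M.eps_lt
  have h0 := M.worth_nonneg hp hi
  have h3 : ∑ j ∈ range n, p' j * e i j - ∑ j ∈ range n, p j * e i j ≤
      ∑ j ∈ range n, p' j - ∑ j ∈ range n, p j := by
    rw [← sum_sub_distrib, ← sum_sub_distrib]
    refine sum_le_sum fun j hj => ?_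
    have hj' : j < n := by simpa using hj
    rw [← sub_mul]
    exact mul_le_of_le_one_right (sub_nonneg.mpr (hpp j hj')) (M.le_one hi hj')
  unfold budgetFor at h
  set w := ∑ j ∈ range n, p j * e i j
  set w' := ∑ j ∈ range n, p' j * e i j
  have h4 : ε / 2 < w' - w := by
    by_contra hcon
    push Not at hcon
    nlinarith
  linarith

theorem PriceRun.nonneg (R : PriceRun n L ε e k P) {m : ℕ} (hm : m ≤ k) {j : ℕ} (hj : j < n) :
    0 ≤ P m j := by
  cases m with
  | zero => exact (R.zero j hj).ge
  | succ m =>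
    obtain ⟨q, y, H⟩ := R.cert m hm
    exact H.price_nonneg j hj

theorem PriceRun.sum_le (R : PriceRun n L ε e k P) (M : Endowed n ε e F) {m : ℕ} (hm : m ≤ k) :
    ∑ j ∈ range n, P m j ≤ n := by
  induction m with
  | zero =>
    rw [sum_eq_zero fun j hj => R.zero j (by simpa using hj)]
    exact Nat.cast_nonneg n
  | succ m ih =>
    obtain ⟨q, y, H⟩ := R.cert m hm
    exact H.sum_price_le.trans (M.sum_budgetFor_le (ih (by omega)))

theorem PriceRun.le (R : PriceRun n L ε e k P) (M : Endowed n ε e F) {m : ℕ} (hm : m ≤ k) {j : ℕ}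
    (hj : j < n) : P m j ≤ n :=
  (single_le_sum (f := fun j => P m j) (fun a ha => R.nonneg hm (by simpa using ha))
    (by simpa using hj)).trans (R.sum_le M hm)

theorem PriceRun.budgetReady (R : PriceRun n L ε e k P) (M : Endowed n ε e F)
    (hF : ∀ j < n, Fine D (P k j)) :
    BudgetReady n (2 * ε.den * (D * F)) (budgetFor n ε e (P k)) :=
  ⟨fun _ hi => M.budgetFor_pos (fun _ hj => R.nonneg le_rfl hj) hi,
    fun _ hi => M.budgetFor_fine hF hi, M.sum_budgetFor_le (R.sum_le M le_rfl)⟩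

/-- The maximum of the old prices and of equilibrium prices for the new budgets extends a run. -/
theorem PriceRun.extend (R : PriceRun n L ε e k P) (M : Endowed n ε e F) {pr : ℕ → ℚ}
    (h : HasPrices n D L (budgetFor n ε e (P k)) pr) :
    PriceRun n L ε e (k + 1) (fun m => if m ≤ k then P m else fun j => max (P k j) (pr j)) := by
  obtain ⟨p, q, y, H, hp⟩ := h
  have H' : EqCert n L (budgetFor n ε e (P k)) pr q y :=
    H.congr (fun _ _ _ _ => Iff.rfl) (fun _ _ => rfl) fun j hj => (hp j hj).1.symm
  refine ⟨fun j hj => ?_, fun m hm => ?_, fun m hm j hj => ?_⟩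
  · rw [if_pos (Nat.zero_le _)]; exact R.zero j hj
  · rw [if_pos (by omega)]
    rcases Nat.lt_succ_iff_lt_or_eq.mp hm with h' | rfl
    · rw [if_pos (by omega)]; exact R.cert m h'
    · rw [if_neg (by omega)]
      cases m with
      | zero =>
        refine ⟨q, y, H'.congr (fun _ _ _ _ => Iff.rfl) (fun _ _ => rfl) fun j hj => ?_⟩
        rw [R.zero j hj, max_eq_right (H'.price_nonneg j hj)]
      | succ m =>
        obtain ⟨q₀, y₀, H₀⟩ := R.cert m (by omega)
        exact H₀.max H' (fun i hi => M.budgetFor_pos (fun j hj => R.nonneg (by omega) hj) hi)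
          fun i hi => M.budgetFor_mono (R.mono m (by omega)) hi
  · rw [if_pos (by omega)]
    rcases Nat.lt_succ_iff_lt_or_eq.mp hm with h' | rfl
    · rw [if_pos (by omega)]; exact R.mono m h' j hj
    · rw [if_neg (by omega)]; exact le_max_left _ _

end

/-- The value of the endowment of agent `vi` at the prices in array `4`. -/
def worthProg : Program :=
  .seq (.setRat 10 (.const 0) (.const 0))
    (forLoop 11 vn (.setRat 10 (.const 0) (.add (qvar 10) (.mul (.get 4 vj) (.get 2 (ix vi vj))))))

/-- The budgets of the next round. -/
def budgetProg : Program :=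
  forLoop 10 vn (.seq worthProg (.setRat 5 vi (.add (.div (qvar 0) (.const 2))
    (.mul (.sub (.const 1) (.div (qvar 0) (.const 2))) (qvar 10)))))

/-- The prices in array `4` rise to those in array `7`. -/
def raiseProg : Program :=
  forLoop 11 vn (.cond (.ratLE (.get 4 vj) (.get 7 vj)) (.setRat 4 vj (.get 7 vj)) .skip)

/-- The flag in natural-number array `18` says whether the budget of some agent is too small. -/
def testProg : Program :=
  .seq (.setNat 18 (.const 0) (.const 0)) (forLoop 10 vn (.seq worthProg
    (.cond (.ratLT (.get 5 vi) (.mul (.sub (.const 1) (qvar 0)) (qvar 10)))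
      (.setNat 18 (.const 0) (.const 1)) .skip)))

/-- One round. -/
def roundProg : Program := .seq budgetProg (.seq solveProg (.seq raiseProg testProg))

/-- All rounds. -/
def roundsProg : Program :=
  .seq (.setNat 18 (.const 0) (.const 1)) (.loop (.natEQ (nvar 18) (.const 1)) roundProg)

/-- The endowments in the memory. -/
def endowmentOf (n : ℕ) (s : State) (i j : ℕ) : ℚ := s.rat 2 (i * n + j)

section

variable {n N β D D' F Q k : ℕ} {s : State} {ε : ℚ} {L : ℕ → ℕ → Prop} {e : ℕ → ℕ → ℚ}
  {p : ℕ → ℚ} {P : ℕ → ℕ → ℚ}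

theorem worthProg_spec (lim : Limits n N β D Q) (hn : s.nat 0 0 = n) (hD : D' * F ∣ D)
    (M : Endowed n ε (endowmentOf n s) F) (hp : ∀ j < n, 0 ≤ s.rat 4 j ∧ Fine D' (s.rat 4 j))
    (hsum : ∑ j ∈ range n, s.rat 4 j ≤ n) {i : ℕ} (hi : i < n) (si : s.nat 10 0 = i) :
    Reaches N β worthProg s fun t =>
      t.rat 10 0 = ∑ j ∈ range n, s.rat 4 j * endowmentOf n s i j := by
  refine .seq (.setRat (lim.of_le (Fine.zero D) le_rfl (Nat.cast_nonneg _)) ?_)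
  simp only [NExp.eval, QExp.eval]
  refine .forN lim (by rw [setRat_nat, hn]) (fun m t =>
    t.rat 10 0 = ∑ j ∈ range m, s.rat 4 j * endowmentOf n s i j) rfl (by norm_num) rfl ?_ ?_ ?_
  · simp [State.setNat, State.setRat]
  · intro m t hm hf hn' tm hI
    have e4 : t.rat 4 = s.rat 4 := hf.2 4 rfl
    have e2 : t.rat 2 = s.rat 2 := hf.2 2 rfl
    have ti : t.nat 10 0 = i := by rw [hf.1 10 rfl, setRat_nat, si]
    have hsub : range (m + 1) ⊆ range n := range_subset_range.mpr hm
    have key : (QExp.add (qvar 10) (.mul (.get 4 vj) (.get 2 (ix vi vj)))).eval t =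
        ∑ j ∈ range (m + 1), s.rat 4 j * endowmentOf n s i j := by
      simp only [QExp.eval, NExp.eval, hI, e4, e2, ti, tm, hn', sum_range_succ, endowmentOf]
    refine .setRat ?_ ?_
    · rw [key]
      refine lim.of_le ((Fine.sum fun j hj => ?_).of_dvd hD) (sum_nonneg fun j hj => ?_) ?_
      · have := mem_range.mp (hsub hj)
        exact (hp j this).2.mul (M.fine i hi j this)
      · have := mem_range.mp (hsub hj)
        exact mul_nonneg (hp j this).1 (M.nonneg i hi j this)
      · refine le_trans (sum_le_sum fun j hj => ?_) ((sum_le_sum_of_subset_of_nonneg hsub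
          fun j hj _ => (hp j (by simpa using hj)).1).trans hsum)
        have := mem_range.mp (hsub hj)
        exact mul_le_of_le_one_right (hp j this).1 (M.le_one hi this)
    · rw [key]; simp [State.setNat, State.setRat, NExp.eval]
  · intro t _ _ h; exact h

theorem budgetProg_spec (lim : Limits n N β D Q) (hn : s.nat 0 0 = n)
    (hD : 2 * ε.den * (D' * F) ∣ D) (hε : s.rat 0 0 = ε)
    (M : Endowed n ε (endowmentOf n s) F) (hp : ∀ j < n, 0 ≤ s.rat 4 j ∧ Fine D' (s.rat 4 j))
    (hsum : ∑ j ∈ range n, s.rat 4 j ≤ n) :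
    Reaches N β budgetProg s fun t =>
      ∀ i < n, t.rat 5 i = budgetFor n ε (endowmentOf n s) (s.rat 4) i := by
  refine .forN lim hn (fun k t => ∀ i < k,
    t.rat 5 i = budgetFor n ε (endowmentOf n s) (s.rat 4) i) rfl (by norm_num) rfl (by simp) ?_
    fun _ _ _ h => h
  intro i t hi hf hn' ti hI
  have e4 : t.rat 4 = s.rat 4 := hf.2 4 rfl
  have e2 : endowmentOf n t = endowmentOf n s := by unfold endowmentOf; rw [hf.2 2 rfl]
  refine .seq_of (worthProg_spec lim hn' ((Dvd.intro_left _ rfl).trans hD) (e2 ▸ M)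
    (by rw [e4]; exact hp) (by rw [e4]; exact hsum) hi ti) ?_
  intro u fu hu
  have ui : u.nat 10 0 = i := by rw [fu.1 10 rfl, ti]
  have u0 : u.rat 0 0 = ε := by rw [fu.2 0 rfl, hf.2 0 rfl, hε]
  have u5 : u.rat 5 = t.rat 5 := fu.2 5 rfl
  have key : (QExp.add (.div (qvar 0) (.const 2))
      (.mul (.sub (.const 1) (.div (qvar 0) (.const 2))) (qvar 10))).eval u =
      budgetFor n ε (endowmentOf n s) (s.rat 4) i := by
    simp only [QExp.eval, NExp.eval, hu, u0, e2, e4, budgetFor]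
  refine .setRat ?_ ?_
  · rw [key]
    have hpos := fun i (hi : i < n) => M.budgetFor_pos (fun j hj => (hp j hj).1) hi
    refine lim.of_le ((M.budgetFor_fine (fun j hj => (hp j hj).2) hi).of_dvd hD) (hpos i hi).le ?_
    exact (single_le_sum (f := fun i => budgetFor n ε (endowmentOf n s) (s.rat 4) i)
      (fun a ha => (hpos a (by simpa using ha)).le) (by simpa using hi)).trans
      (M.sum_budgetFor_le hsum)
  · intro a ha
    rw [key]
    simp only [NExp.eval, ui, setNat_rat, setRat_rat_self, u5]
    by_cases hai : a = i
    · rw [hai, Function.update_self]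
    · rw [Function.update_of_ne hai]; exact hI a (by omega)

theorem raiseProg_spec (lim : Limits n N β D Q) (hn : s.nat 0 0 = n) :
    Reaches N β raiseProg s fun t => ∀ j < n, t.rat 4 j = max (s.rat 4 j) (s.rat 7 j) := by
  refine .forN lim hn (fun k t => (∀ j < k, t.rat 4 j = max (s.rat 4 j) (s.rat 7 j)) ∧
    ∀ j, k ≤ j → t.rat 4 j = s.rat 4 j) rfl (by norm_num) rfl (by simp [State.setNat]) ?_
    fun _ _ _ h => h.1
  rintro j t hj hf hn' tj ⟨h1, h2⟩
  have e7 : t.rat 7 = s.rat 7 := hf.2 7 rfl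
  refine .of_small fun hs => .cond (fun hc => .setRat (hs.2 _ _) ?_) (fun hc => .skip ?_) <;>
    simp only [Test.holds, QExp.eval, NExp.eval, tj, e7, h2 j le_rfl] at hc ⊢
  · refine ⟨fun a ha => ?_, fun a ha => ?_⟩ <;> rw [setNat_rat, setRat_rat_self]
    · by_cases haj : a = j
      · rw [haj, Function.update_self, max_eq_right hc]
      · rw [Function.update_of_ne haj]; exact h1 a (by omega)
    · rw [Function.update_of_ne (by omega)]; exact h2 a (by omega)
  · refine ⟨fun a ha => ?_, fun a ha => ?_⟩ <;> rw [setNat_rat]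
    · by_cases haj : a = j
      · rw [haj, h2 j le_rfl, max_eq_left (not_le.mp hc).le]
      · exact h1 a (by omega)
    · exact h2 a (by omega)

theorem testProg_spec (lim : Limits n N β D Q) (hn : s.nat 0 0 = n)
    (hD : D' * F ∣ D) (hε : s.rat 0 0 = ε)
    (M : Endowed n ε (endowmentOf n s) F) (hp : ∀ j < n, 0 ≤ s.rat 4 j ∧ Fine D' (s.rat 4 j))
    (hsum : ∑ j ∈ range n, s.rat 4 j ≤ n) :
    Reaches N β testProg s fun t => t.nat 18 0 = 1 ↔ ∃ i < n, s.rat 5 i <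
      (1 - ε) * ∑ j ∈ range n, s.rat 4 j * endowmentOf n s i j := by
  refine .seq (.setNat (lim.small (Nat.zero_le _)) ?_)
  simp only [NExp.eval]
  refine .forN lim (by rw [setNat_nat_ne (by norm_num), hn])
    (fun k t => t.nat 18 0 = 1 ↔ ∃ i < k, s.rat 5 i <
      (1 - ε) * ∑ j ∈ range n, s.rat 4 j * endowmentOf n s i j) rfl (by norm_num) rfl
      (by simp [State.setNat]) ?_ fun _ _ _ h => h
  intro i t hi hf hn' ti hI
  have e4 : t.rat 4 = s.rat 4 := hf.2 4 rfl
  have e2 : endowmentOf n t = endowmentOf n s := by unfold endowmentOf; rw [hf.2 2 rfl]; rfl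
  refine .seq_of (worthProg_spec lim hn' hD (e2 ▸ M)
    (by rw [e4]; exact hp) (by rw [e4]; exact hsum) hi ti) ?_
  intro u fu hu
  have ui : u.nat 10 0 = i := by rw [fu.1 10 rfl, ti]
  have u0 : u.rat 0 0 = ε := by rw [fu.2 0 rfl, hf.2 0 rfl]; exact hε
  have u5 : u.rat 5 = s.rat 5 := by rw [fu.2 5 rfl, hf.2 5 rfl]; rfl
  have u18 : u.nat 18 = t.nat 18 := fu.1 18 rfl
  refine .cond (fun hc => .setNat (lim.small (by simp [NExp.eval])) ?_) (fun hc => .skip ?_) <;>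
    simp only [Test.holds_ratLT, QExp.eval, NExp.eval, ui, u0, u5, hu, e2, e4] at hc
  · simp only [State.setNat, NExp.eval]
    simpa using ⟨i, by omega, hc⟩
  · rw [setNat_nat_ne (by norm_num), u18, hI]
    refine ⟨fun ⟨a, h1, h2⟩ => ⟨a, by omega, h2⟩, fun ⟨a, h1, h2⟩ => ⟨a, ?_, h2⟩⟩
    by_contra h
    obtain rfl : a = i := by omega
    exact hc h2

end

end ADHZ

namespace ADHZ

open Finset

/-- What the rounds leave in the memory: a run of `m + 1` rounds, the prices and the budgets of its
last round, and the certainty that these budgets are large enough. -/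
structure Finished (n D : ℕ) (L : ℕ → ℕ → Prop) (ε : ℚ) (e : ℕ → ℕ → ℚ) (m : ℕ) (P : ℕ → ℕ → ℚ)
    (s : State) : Prop where
  run : PriceRun n L ε e (m + 1) P
  price : ∀ j < n, s.rat 4 j = P (m + 1) j ∧ Fine D (s.rat 4 j)
  budget : ∀ i < n, s.rat 5 i = budgetFor n ε e (P m) i ∧ Fine D (s.rat 5 i)
  short : m * (ε / 2) ≤ n
  enough : ∀ i < n, (1 - ε) * ∑ j ∈ range n, P (m + 1) j * e i j ≤ budgetFor n ε e (P m) i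

section

variable {n N β D F Q k : ℕ} {s : State} {ε : ℚ} {L : ℕ → ℕ → Prop} {e : ℕ → ℕ → ℚ}
  {p : ℕ → ℚ} {P : ℕ → ℕ → ℚ}

/-- The situation before round `k`: while the flag is set, the total price grows with `k`. -/
def BeforeRound (n G : ℕ) (L : ℕ → ℕ → Prop) (ε : ℚ) (e : ℕ → ℕ → ℚ) (k : ℕ) (s : State) : Prop :=
  s.nat 0 0 = n ∧ likeOf n s = L ∧ s.rat 0 0 = ε ∧ endowmentOf n s = e ∧ ∃ P,
    PriceRun n L ε e k P ∧ (∀ j < n, s.rat 4 j = P k j ∧ Fine (G ^ k) (P k j)) ∧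
    (s.nat 18 0 = 1 ∧ k * (ε / 2) ≤ ∑ j ∈ range n, P k j ∨
      s.nat 18 0 ≠ 1 ∧ ∃ m, k = m + 1 ∧ m * (ε / 2) ≤ n ∧
        (∀ i < n, s.rat 5 i = budgetFor n ε e (P m) i ∧ Fine (G ^ k) (s.rat 5 i)) ∧
        ∀ i < n, (1 - ε) * ∑ j ∈ range n, P k j * e i j ≤ budgetFor n ε e (P m) i)

/-- One round multiplies the denominator of the prices by the fixed factor `G`: the budgets cost the
factor `2 * ε.den * F`, and the prices of the blocks the factor `n!`.  The test looks at the next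
budgets, whose denominator divides `G ^ (k + 2)`. -/
theorem roundProg_spec {G : ℕ} (hG : G = 2 * ε.den * F * n.factorial)
    (lim' : Limits n N β (G ^ (k + 2)) Q) (M : Endowed n ε e F) (hL : ∀ i < n, ∃ j < n, L i j)
    (h : BeforeRound n G L ε e k s) (h18 : s.nat 18 0 = 1) :
    Reaches N β roundProg s (BeforeRound n G L ε e (k + 1)) := by
  obtain ⟨hn, hl, hε, he, P, R, hP, hflag⟩ := h
  have hsum : (k : ℚ) * (ε / 2) ≤ ∑ j ∈ range n, P k j := by
    rcases hflag with h | h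
    · exact h.2
    · exact absurd h18 h.1
  have lim : Limits n N β (G ^ (k + 1)) Q := lim'.of_dvd (pow_dvd_pow G (by omega))
  have hGk : 2 * ε.den * (G ^ k * F) * n.factorial = G ^ (k + 1) := by
    rw [pow_succ, hG]; ring
  have hdvd : 2 * ε.den * (G ^ k * F) ∣ G ^ (k + 1) := ⟨_, hGk.symm⟩
  have hp : ∀ j < n, 0 ≤ s.rat 4 j ∧ Fine (G ^ k) (s.rat 4 j) := fun j hj => by
    rw [(hP j hj).1]; exact ⟨R.nonneg le_rfl hj, (hP j hj).2⟩
  have hps : ∑ j ∈ range n, s.rat 4 j = ∑ j ∈ range n, P k j :=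
    sum_congr rfl fun j hj => (hP j (by simpa using hj)).1
  have hbud : budgetFor n ε e (s.rat 4) = budgetFor n ε e (P k) := by
    funext i
    unfold budgetFor
    rw [sum_congr rfl fun j hj => by rw [(hP j (by simpa using hj)).1]]
  refine .seq_of (budgetProg_spec lim hn hdvd hε (he ▸ M) hp (hps ▸ R.sum_le M le_rfl)) ?_
  intro t1 f1 hb1
  rw [he, hbud] at hb1
  have n1 : t1.nat 0 0 = n := by rw [f1.1 0 rfl, hn]
  have l1 : likeOf n t1 = L := by rw [← hl]; unfold likeOf; rw [f1.1 1 rfl]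
  have B0 := R.budgetReady M fun j hj => (hP j hj).2
  have B1 : BudgetReady n (2 * ε.den * (G ^ k * F)) (t1.rat 5) := by
    refine ⟨fun i hi => ?_, fun i hi => ?_, ?_⟩
    · rw [hb1 i hi]; exact B0.pos i hi
    · rw [hb1 i hi]; exact B0.fine i hi
    · rw [sum_congr rfl fun i hi => hb1 i (by simpa using hi)]; exact B0.sum_le
  refine .seq_of (solveProg_spec lim hGk.dvd n1 B1 (by rw [l1]; exact hL)) ?_
  rintro t2 f2 ⟨p, q, y, C, hpr⟩
  rw [l1] at C
  have C' : HasPrices n (G ^ (k + 1)) L (budgetFor n ε e (P k)) (t2.rat 7) :=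
    ⟨p, q, y, C.congr (fun _ _ _ _ => Iff.rfl) hb1 fun _ _ => rfl, hpr⟩
  have n2 : t2.nat 0 0 = n := by rw [f2.1 0 rfl, n1]
  refine .seq_of (raiseProg_spec lim n2) ?_
  intro t3 f3 h3
  have R' := R.extend M C'
  set P' : ℕ → ℕ → ℚ := fun m => if m ≤ k then P m else fun j => max (P k j) (t2.rat 7 j) with hP'
  have eP : P' k = P k := by simp [hP']
  have eP' : ∀ j < n, t3.rat 4 j = P' (k + 1) j := by
    intro j hj
    rw [h3 j hj, f2.2 4 rfl, f1.2 4 rfl, (hP j hj).1]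
    simp [hP']
  have hfine : ∀ j < n, Fine (G ^ (k + 1)) (P' (k + 1) j) := by
    intro j hj
    have : P' (k + 1) j = max (P k j) (t2.rat 7 j) := by simp [hP']
    rw [this]
    refine ((hP j hj).2.of_dvd (Dvd.intro_left G (by rw [pow_succ]; ring))).max ?_
    rw [(hpr j hj).1]; exact (hpr j hj).2.2
  have n3 : t3.nat 0 0 = n := by rw [f3.1 0 rfl, n2]
  have ε3 : t3.rat 0 0 = ε := by rw [f3.2 0 rfl, f2.2 0 rfl, f1.2 0 rfl, hε]
  have e3 : endowmentOf n t3 = e := by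
    rw [← he]; unfold endowmentOf; rw [f3.2 2 rfl, f2.2 2 rfl, f1.2 2 rfl]
  have l3 : likeOf n t3 = L := by
    rw [← l1]; unfold likeOf; rw [f3.1 1 rfl, f2.1 1 rfl]
  have b3 : ∀ i < n, t3.rat 5 i = budgetFor n ε e (P k) i := by
    intro i hi; rw [f3.2 5 rfl, f2.2 5 rfl, hb1 i hi]
  have hdvd' : G ^ (k + 1) * F ∣ G ^ (k + 2) := by
    refine ⟨2 * ε.den * n.factorial, ?_⟩
    rw [pow_succ G (k + 1)]
    conv_lhs => rw [hG]
    conv_rhs => rw [hG]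
    ring
  have hp3 : ∀ j < n, 0 ≤ t3.rat 4 j ∧ Fine (G ^ (k + 1)) (t3.rat 4 j) := fun j hj => by
    rw [eP' j hj]; exact ⟨R'.nonneg le_rfl hj, hfine j hj⟩
  have hs3 : ∑ j ∈ range n, t3.rat 4 j ≤ n := by
    rw [sum_congr rfl fun j hj => eP' j (by simpa using hj)]
    exact R'.sum_le M le_rfl
  refine (testProg_spec lim' n3 hdvd' ε3 (e3 ▸ M) hp3 hs3).frame.mono ?_
  rintro t4 ⟨f4, h4⟩
  have hw : ∀ i, ∑ j ∈ range n, t3.rat 4 j * endowmentOf n t3 i j =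
      ∑ j ∈ range n, P' (k + 1) j * e i j := fun i => by
    rw [e3]; exact sum_congr rfl fun j hj => by rw [eP' j (by simpa using hj)]
  refine ⟨by rw [f4.1 0 rfl, n3], ?_, by rw [f4.2 0 rfl, ε3], ?_, P', R', fun j hj => ?_, ?_⟩
  · rw [← l3]; unfold likeOf; rw [f4.1 1 rfl]
  · rw [← e3]; unfold endowmentOf; rw [f4.2 2 rfl]
  · rw [f4.2 4 rfl]; exact ⟨eP' j hj, hfine j hj⟩
  -- either the test has failed and the total price has risen by `ε / 2`, or the budgets are
  -- large enough
  · by_cases h18' : t4.nat 18 0 = 1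
    · left
      refine ⟨h18', ?_⟩
      obtain ⟨i, hi, hlt⟩ := h4.mp h18'
      rw [hw, b3 i hi, ← eP] at hlt
      have := M.sum_price_lt (fun j hj => R'.nonneg (by omega) hj)
        (fun j hj => R'.mono k (by omega) j hj) hi hlt
      rw [eP] at this
      push_cast
      linarith
    · right
      refine ⟨h18', k, rfl, hsum.trans (R.sum_le M le_rfl), fun i hi => ?_, fun i hi => ?_⟩
      · rw [f4.2 5 rfl, b3 i hi, eP]
        exact ⟨rfl, (B0.fine i hi).of_dvd hdvd⟩
      · by_contra hcon
        push Not at hcon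
        refine h18' (h4.mpr ⟨i, hi, ?_⟩)
        rw [hw, b3 i hi, ← eP]; exact hcon

theorem roundsProg_spec {G T : ℕ} (hG : G = 2 * ε.den * F * n.factorial) (hT : 2 * n / ε ≤ T)
    (hTN : T < N) (lim : Limits n N β (G ^ (T + 2)) Q) (M : Endowed n ε e F)
    (hL : ∀ i < n, ∃ j < n, L i j) (hn : s.nat 0 0 = n) (hl : likeOf n s = L)
    (hε : s.rat 0 0 = ε) (he : endowmentOf n s = e) (hp : ∀ j < n, s.rat 4 j = 0) :
    Reaches N β roundsProg s fun t => ∃ m P, Finished n (G ^ (T + 2)) L ε e m P t := by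
  have h1 := M.eps_pos
  have hkT : ∀ k : ℕ, k * (ε / 2) ≤ n → k ≤ T := by
    intro k hk
    have : (k : ℚ) ≤ 2 * n / ε := by rw [le_div_iff₀ h1]; linarith
    exact_mod_cast this.trans hT
  refine .seq (.setNat (lim.small (by simp [NExp.eval])) ?_)
  refine .loop (BeforeRound n G L ε e) ?_ ?_ ?_
  · refine ⟨by rw [setNat_nat_ne (by norm_num), hn], ?_, hε, he, fun _ _ => 0,
      ⟨fun _ _ => rfl, fun m hm => absurd hm (Nat.not_lt_zero m),
        fun m hm => absurd hm (Nat.not_lt_zero m)⟩, fun j hj => ⟨hp j hj, Fine.zero _⟩, Or.inl ?_⟩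
    · rw [← hl]; unfold likeOf; rw [setNat_nat_ne (by norm_num)]
    · simp [State.setNat, NExp.eval]
  · intro k t hI hc
    simp only [Test.holds_natEQ, NExp.eval] at hc
    have hkT' : k ≤ T := by
      obtain ⟨-, -, -, -, P, R, -, h | h⟩ := hI
      · exact hkT k (h.2.trans (R.sum_le M le_rfl))
      · exact absurd hc h.1
    exact ⟨by omega, roundProg_spec hG (lim.of_dvd (pow_dvd_pow G (by omega))) M hL hI hc⟩
  · intro k t hI hc
    simp only [Test.holds_natEQ, NExp.eval] at hc
    obtain ⟨-, -, -, -, P, R, hP, h | ⟨-, m, rfl, hm, hb, htest⟩⟩ := hI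
    · exact absurd h.1 hc
    · have hd : G ^ (m + 1) ∣ G ^ (T + 2) := pow_dvd_pow G (by have := hkT m hm; omega)
      exact ⟨m, P, R, fun j hj => ⟨(hP j hj).1, (hP j hj).1 ▸ (hP j hj).2.of_dvd hd⟩,
        fun i hi => ⟨(hb i hi).1, (hb i hi).2.of_dvd hd⟩, hm, htest⟩

end

end ADHZ

namespace ADHZ

open Finset

/-! ### The complete program -/

/-- The liked goods are those of maximal utility. -/
def likeProg : Program :=
  forLoop 10 vn (forLoop 11 vn (.seq (.setNat 1 (ix vi vj) (.const 1))
    (forLoop 12 vn (.cond (.ratLT (.get 1 (ix vi vj)) (.get 1 (ix vi vk)))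
      (.setNat 1 (ix vi vj) (.const 0)) .skip))))

/-- One block, in which each agent faces the lowest price of a liked good. -/
def cheapestProg : Program :=
  forLoop 10 vn (.seq (.setNat 2 vi (.const 0)) (.seq (.setNat 3 vi (.const 0))
    (.seq (.setRat 7 vi (.get 4 vi)) (.seq (.setRat 6 vi (.ofNat vn))
      (forLoop 11 vn (.cond (.both (.natEQ (.get 1 (ix vi vj)) (.const 1))
          (.ratLT (.get 4 vj) (.get 6 vi)))
        (.setRat 6 vi (.get 4 vj)) .skip))))))

/-- The leftovers of the goods. -/
def leftoverProg : Program :=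
  .seq (.setRat 10 (.const 0) (.const 0))
    (forLoop 11 vn (.setRat 10 (.const 0) (.add (qvar 10) (.get 8 (ix vn vj)))))

/-- The allocation. -/
def outputProg : Program :=
  forLoop 10 vn (.seq
    (.cond (.ratLE (.get 6 vi) (.get 5 vi)) (.setRat 13 (.const 0) (.const 0))
      (.setRat 13 (.const 0) (.sub (.const 1) (.div (.get 5 vi) (.get 6 vi)))))
    (forLoop 11 vn (.cond (.ratEQ (.get 7 vj) (.const 0))
      (.setRat 3 (ix vi vj) (.add (.get 8 (ix vi vj))
        (.div (.mul (qvar 13) (.get 8 (ix vn vj))) (qvar 10))))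
      (.setRat 3 (ix vi vj) (.div (.get 8 (ix vi vj)) (.get 7 vj))))))

/-- The approximation scheme. -/
def schemeProg : Program :=
  .seq (.seq likeProg (.seq roundsProg (.seq cheapestProg (.seq flowProg leftoverProg)))) outputProg

/-- A larger bound on the encoding length is as good; that the memory obeyed the smaller one is kept
on record. -/
theorem Reaches.weaken {N β γ : ℕ} {P : Program} {s : State} {Q : State → Prop} (hs : Small β s)
    (hβ : β ≤ γ) (h : Reaches N β P s Q) : Reaches N γ P s fun t => Small β t ∧ Q t := by
  intro _
  obtain ⟨s', t, w, h1, h2, h3, h4, h5⟩ := h hs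
  refine ⟨s', t, w, h1, h2, h3.trans ?_, h4.mono hβ, h4, h5⟩
  gcongr

section

variable {n N β γ D F Q k : ℕ} {s : State} {L E : ℕ → ℕ → Prop} {b c d p q : ℕ → ℚ} {σ : Flow}

theorem likeProg_spec (lim : Limits n N β D Q) (hn : s.nat 0 0 = n) :
    Reaches N β likeProg s fun t => ∀ i < n, ∀ j < n, likeOf n t i j ↔
      ∀ k < n, s.rat 1 (i * n + k) ≤ s.rat 1 (i * n + j) := by
  have z := lim.small (show 0 ≤ n + 2 by omega)
  have o := lim.small (show 1 ≤ n + 2 by omega)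
  refine .forN lim hn (fun i t => ∀ a < i, ∀ j < n, likeOf n t a j ↔
      ∀ k < n, s.rat 1 (a * n + k) ≤ s.rat 1 (a * n + j)) rfl (by norm_num) rfl (by simp) ?_
      fun _ _ _ h => h
  intro i t hi hf hn' ti hI
  have e1 : t.rat 1 = s.rat 1 := hf.2 1 rfl
  refine .forN lim hn' (fun j t => t.nat 10 0 = i ∧ (∀ a < i, ∀ j < n, likeOf n t a j ↔
      ∀ k < n, s.rat 1 (a * n + k) ≤ s.rat 1 (a * n + j)) ∧ ∀ b < j, likeOf n t i b ↔
      ∀ k < n, s.rat 1 (i * n + k) ≤ s.rat 1 (i * n + b)) rfl (by norm_num) rfl ?_ ?_ ?_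
  · refine ⟨by simpa [State.setNat] using ti, fun a ha j hj => ?_, by simp⟩
    simpa [likeOf, State.setNat] using hI a ha j hj
  · rintro j t' hj hf' hn'' tj ⟨ti', h1, h2⟩
    have e1' : t'.rat 1 = s.rat 1 := by rw [hf'.2 1 rfl, e1]
    refine .seq (.setNat o ?_)
    simp only [NExp.eval, ti', tj, hn'']
    refine .forN lim (by rw [setNat_nat_ne (by norm_num), hn'']) (fun k t => t.nat 10 0 = i ∧
      t.nat 11 0 = j ∧ (∀ a < i, ∀ j < n, likeOf n t a j ↔
      ∀ k < n, s.rat 1 (a * n + k) ≤ s.rat 1 (a * n + j)) ∧ (∀ b < j, likeOf n t i b ↔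
      ∀ k < n, s.rat 1 (i * n + k) ≤ s.rat 1 (i * n + b)) ∧ (likeOf n t i j ↔
      ∀ m < k, s.rat 1 (i * n + m) ≤ s.rat 1 (i * n + j))) rfl (by norm_num) rfl ?_ ?_ ?_
    · refine ⟨by simpa [State.setNat] using ti', by simpa [State.setNat] using tj,
        fun a ha b hb => ?_, fun b hb => ?_, by simp [likeOf, State.setNat]⟩
      · have hne : a * n + b ≠ i * n + j := fun h => by
          have := (index_inj hb hj).mp h; omega
        rw [← h1 a ha b hb]
        simp [likeOf, State.setNat, Function.update_of_ne hne]
      · have hne : b ≠ j := by omega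
        rw [← h2 b hb]
        simp [likeOf, State.setNat, hne]
    · rintro k u hk fu hn3 uk ⟨ui, uj, g1, g2, g3⟩
      have e1u : u.rat 1 = s.rat 1 := by rw [fu.2 1 rfl, setNat_rat, e1']
      refine .cond (fun hc => .setNat z ?_) (fun hc => .skip ?_) <;>
        simp only [Test.holds_ratLT, QExp.eval, NExp.eval, ui, uj, uk, hn3, e1u] at hc ⊢
      · refine ⟨by simpa [State.setNat] using ui, by simpa [State.setNat] using uj,
          fun a ha b hb => ?_, fun b hb => ?_, ?_⟩
        · have hne : a * n + b ≠ i * n + j := fun h => by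
            have := (index_inj hb hj).mp h; omega
          rw [← g1 a ha b hb]
          simp [likeOf, State.setNat, Function.update_of_ne hne]
        · have hne : b ≠ j := by omega
          rw [← g2 b hb]
          simp [likeOf, State.setNat, hne]
        · refine ⟨fun h => ?_, fun h => absurd (h k (by omega)) (not_le.mpr hc)⟩
          simp [likeOf, State.setNat] at h
      · refine ⟨by simpa [State.setNat] using ui, by simpa [State.setNat] using uj,
          fun a ha b hb => ?_, fun b hb => ?_, ?_⟩
        · rw [← g1 a ha b hb]; simp [likeOf, State.setNat]
        · rw [← g2 b hb]; simp [likeOf, State.setNat]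
        · have : likeOf n (u.setNat 12 0 (k + 1)) i j ↔ likeOf n u i j := by
            simp [likeOf, State.setNat]
          rw [this, g3]
          refine ⟨fun h m hm => ?_, fun h m hm => h m (by omega)⟩
          rcases Nat.lt_succ_iff_lt_or_eq.mp hm with h' | rfl
          · exact h m h'
          · exact not_lt.mp hc
    · rintro u - hn3 ⟨ui, uj, g1, g2, g3⟩
      refine ⟨by simpa [State.setNat] using ui, fun a ha b hb => ?_, fun b hb => ?_⟩
      · rw [← g1 a ha b hb]; simp [likeOf, State.setNat]
      · have : likeOf n (u.setNat 11 0 (j + 1)) i b ↔ likeOf n u i b := by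
          simp [likeOf, State.setNat]
        rw [this]
        rcases Nat.lt_succ_iff_lt_or_eq.mp hb with h' | rfl
        · exact g2 b h'
        · exact g3
  · rintro u - hn3 ⟨ui, g1, g2⟩ a ha b hb
    have : likeOf n (u.setNat 10 0 (i + 1)) a b ↔ likeOf n u a b := by
      simp [likeOf, State.setNat]
    rw [this]
    rcases Nat.lt_succ_iff_lt_or_eq.mp ha with h' | rfl
    · exact g1 a h' b hb
    · exact g2 b hb

theorem cheapestProg_spec (lim : Limits n N β D Q) (hn : s.nat 0 0 = n)
    (hp : ∀ j < n, s.rat 4 j ≤ n) (hL : ∀ i < n, ∃ j < n, likeOf n s i j) :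
    Reaches N β cheapestProg s fun t => ∀ i < n, t.nat 2 i = 0 ∧ t.nat 3 i = 0 ∧
      t.rat 7 i = s.rat 4 i ∧ (∀ j < n, likeOf n s i j → t.rat 6 i ≤ s.rat 4 j) ∧
      ∃ j < n, likeOf n s i j ∧ t.rat 6 i = s.rat 4 j := by
  have z := lim.small (show 0 ≤ n + 2 by omega)
  refine .forN lim hn (fun i t => ∀ a < i, t.nat 2 a = 0 ∧ t.nat 3 a = 0 ∧
      t.rat 7 a = s.rat 4 a ∧ (∀ j < n, likeOf n s a j → t.rat 6 a ≤ s.rat 4 j) ∧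
      ∃ j < n, likeOf n s a j ∧ t.rat 6 a = s.rat 4 j) rfl (by norm_num) rfl (by simp) ?_
      fun _ _ _ h => h
  intro i t hi hf hn' ti hI
  have e4 : t.rat 4 = s.rat 4 := hf.2 4 rfl
  have e1 : t.nat 1 = s.nat 1 := hf.1 1 rfl
  refine .of_small fun hs => .seq (.setNat z (.seq (.setNat z (.seq (.setRat (hs.2 _ _)
    (.seq (.setRat (lim.of_le ?_ ?_ ?_) ?_)))))))
  · exact Fine.natCast _ _
  · exact Nat.cast_nonneg _
  · simp [QExp.eval, NExp.eval, State.setNat, State.setRat, hn']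
  simp only [QExp.eval, NExp.eval, setRat_nat, setNat_nat_ne (show 10 ≠ 2 by norm_num),
    setNat_nat_ne (show 10 ≠ 3 by norm_num), setNat_nat_ne (show 0 ≠ 2 by norm_num),
    setNat_nat_ne (show 0 ≠ 3 by norm_num), setNat_rat, ti, hn', e4]
  set t1 := (((t.setNat 2 i 0).setNat 3 i 0).setRat 7 i (s.rat 4 i)).setRat 6 i n
  have hn1 : t1.nat 0 0 = n := by simpa [t1, State.setNat, State.setRat] using hn'
  have ti1 : t1.nat 10 0 = i := by simpa [t1, State.setNat, State.setRat] using ti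
  have e41 : t1.rat 4 = s.rat 4 := by simpa [t1, State.setNat, State.setRat] using e4
  have e11 : t1.nat 1 = s.nat 1 := by simpa [t1, State.setNat, State.setRat] using e1
  have h6 : t1.rat 6 = Function.update (t.rat 6) i n := by simp [t1, State.setNat, State.setRat]
  have hI1 : ∀ a < i + 1, t1.nat 2 a = 0 ∧ t1.nat 3 a = 0 ∧ t1.rat 7 a = s.rat 4 a := by
    intro a ha
    by_cases hai : a = i
    · simp [t1, State.setNat, State.setRat, hai]
    · have := hI a (by omega)
      simp [t1, State.setNat, State.setRat, hai, this]
  refine .forN lim hn1 (fun j u => (∀ a < i, u.rat 6 a = t.rat 6 a) ∧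
    (∀ b < j, likeOf n s i b → u.rat 6 i ≤ s.rat 4 b) ∧
    (u.rat 6 i = n ∨ ∃ b < n, likeOf n s i b ∧ u.rat 6 i = s.rat 4 b))
    rfl (by norm_num) rfl ?_ ?_ ?_
  · refine ⟨fun a ha => ?_, by simp, Or.inl ?_⟩
    · rw [setNat_rat, h6, Function.update_of_ne ha.ne]
    · rw [setNat_rat, h6, Function.update_self]
  · rintro j u hj fu hn2 uj ⟨g1, g2, g3⟩
    have ui : u.nat 10 0 = i := by rw [fu.1 10 rfl, ti1]
    have u4 : u.rat 4 = s.rat 4 := by rw [fu.2 4 rfl, e41]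
    have u1 : u.nat 1 = s.nat 1 := by rw [fu.1 1 rfl, e11]
    refine .of_small fun hs => .cond (fun hc => .setRat (hs.2 _ _) ?_) (fun hc => .skip ?_) <;>
      simp only [Test.holds, Test.holds_natEQ, Test.holds_ratLT, QExp.eval, NExp.eval, ui, uj, hn2,
        u4, u1] at hc ⊢
    · simp only [setNat_rat, setRat_rat_self, Function.update_self]
      refine ⟨fun a ha => ?_, fun b hb hLb => ?_, Or.inr ⟨j, hj, hc.1, rfl⟩⟩
      · rw [Function.update_of_ne ha.ne]; exact g1 a ha
      · rcases Nat.lt_succ_iff_lt_or_eq.mp hb with h' | rfl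
        · exact hc.2.le.trans (g2 b h' hLb)
        · exact le_rfl
    · simp only [setNat_rat]
      refine ⟨g1, fun b hb hLb => ?_, g3⟩
      rcases Nat.lt_succ_iff_lt_or_eq.mp hb with h' | rfl
      · exact g2 b h' hLb
      · by_contra hcon
        exact hc ⟨hLb, not_le.mp hcon⟩
  · rintro u fu hn2 ⟨g1, g2, g3⟩ a ha
    rw [setNat_nat_ne (by norm_num), setNat_nat_ne (by norm_num), fu.1 2 rfl, fu.1 3 rfl]
    simp only [fu.2 7 rfl]
    obtain ⟨k1, k2, k3⟩ := hI1 a ha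
    refine ⟨k1, k2, k3, ?_⟩
    rcases Nat.lt_succ_iff_lt_or_eq.mp ha with h' | rfl
    · rw [g1 a h']; exact (hI a h').2.2.2
    · refine ⟨g2, ?_⟩
      rcases g3 with h3 | h3
      · obtain ⟨j, hj, hLj⟩ := hL a hi
        refine ⟨j, hj, hLj, le_antisymm (g2 j hj hLj) ?_⟩
        rw [h3]; exact hp j hj
      · exact h3

theorem leftoverProg_spec (lim : Limits n N β D Q) (hn : s.nat 0 0 = n)
    (hF : (flowOf n s).IsFine n D) (h0 : ∀ j < n, 0 ≤ s.rat 8 (n * n + j))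
    (hQ : ∑ j ∈ range n, s.rat 8 (n * n + j) ≤ Q) :
    Reaches N β leftoverProg s fun t => t.rat 10 0 = ∑ j ∈ range n, s.rat 8 (n * n + j) := by
  refine .seq (.setRat (lim.of_le (Fine.zero D) le_rfl (Nat.cast_nonneg _)) ?_)
  simp only [NExp.eval, QExp.eval]
  refine .forN lim (by rw [setRat_nat, hn]) (fun m t =>
    t.rat 10 0 = ∑ j ∈ range m, s.rat 8 (n * n + j)) rfl (by norm_num) rfl ?_ ?_
    fun _ _ _ h => h
  · simp [State.setNat, State.setRat]
  · intro m t hm hf hn' tm hI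
    have e8 : t.rat 8 = s.rat 8 := hf.2 8 rfl
    have hsub : range (m + 1) ⊆ range n := range_subset_range.mpr hm
    have key : (QExp.add (qvar 10) (.get 8 (ix vn vj))).eval t =
        ∑ j ∈ range (m + 1), s.rat 8 (n * n + j) := by
      simp only [QExp.eval, NExp.eval, hI, e8, tm, hn', sum_range_succ]
    refine .setRat ?_ ?_
    · rw [key]
      refine lim.rat _ (Fine.sum fun j hj => hF.1 n le_rfl j (mem_range.mp (hsub hj)))
        (sum_nonneg fun j hj => h0 j (mem_range.mp (hsub hj)))
        ((sum_le_sum_of_subset_of_nonneg hsub fun j hj _ => h0 j (by simpa using hj)).trans hQ)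
    · rw [key]; simp [State.setNat, State.setRat, NExp.eval]

/-- What the agent with budget `b` lacks for a full unit when the liked goods cost `q`. -/
def lack (b q : ℚ) : ℚ := if q ≤ b then 0 else 1 - b / q

/-- The dummy agent's holdings are what the agents have not bought; goods with a positive price are
sold out, so only shares of free goods have to be distributed. -/
theorem Flow.Inv.fillUp_eq (H : σ.Inv n E d c) (hc : ∀ j < n, c j = cap (p j))
    (C : EqCert n L b p q fun i j => σ.f i j / cap (p j)) (hb : ∀ i < n, 0 < b i) {i j : ℕ}
    (hi : i < n) (hj : j < n) :
    fillUp n (fun i j => σ.f i j / cap (p j)) i j = if p j = 0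
      then σ.f i j + lack (b i) (q i) * σ.f n j / ∑ j' ∈ range n, σ.f n j'
      else σ.f i j / p j := by
  have hleft : ∀ j < n, 1 - ∑ i ∈ range n, σ.f i j / cap (p j) = σ.f n j := by
    intro j hj
    have h1 := H.col j hj
    have h2 := cap_pos (C.price_nonneg j hj)
    rw [sum_range_succ, hc j hj] at h1
    have h3 : ∑ i ∈ range n, σ.f i j / cap (p j) = 1 - σ.f n j / cap (p j) := by
      rw [← sum_div, eq_sub_iff_add_eq, ← add_div, h1, div_self h2.ne']
    by_cases h0 : p j = 0
    · rw [h3, h0]; simp [cap]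
    · have h4 := C.col_eq j hj (lt_of_le_of_ne (C.price_nonneg j hj) (Ne.symm h0))
      rw [h3] at h4
      have h5 : σ.f n j / cap (p j) = 0 := by linarith
      rcases div_eq_zero_iff.mp h5 with h6 | h6
      · rw [h3, h6]; simp
      · exact absurd h6 h2.ne'
  have hrow : 1 - ∑ j ∈ range n, σ.f i j / cap (p j) = lack (b i) (q i) := by
    unfold lack
    split_ifs with h
    · rw [C.full i hi h, sub_self]
    · push Not at h
      have h1 := C.part i hi h
      have h2 := ((hb i hi).trans h).ne'
      rw [← h1, mul_div_cancel_left₀ _ h2]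
  unfold fillUp
  rw [hrow, hleft j hj, sum_congr rfl fun j hj => hleft j (by simpa using hj)]
  dsimp only
  split_ifs with h0
  · rw [h0]; simp [cap]
  · have h4 := C.col_eq j hj (lt_of_le_of_ne (C.price_nonneg j hj) (Ne.symm h0))
    have h5 := hleft j hj
    rw [h4, sub_self] at h5
    rw [← h5, cap, if_neg h0]; simp

/-- The allocation is computed by single divisions, whose results need not be multiples of `1 / D`.
As they are never used again, it is enough that their encoding lengths are at most those of the
operands combined. -/
theorem outputProg_spec (lim : Limits n N γ D Q) (hγ : 32 * β ≤ γ) (hs : Small β s)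
    (hn : s.nat 0 0 = n) :
    Reaches N γ outputProg s fun t => ∀ i < n, ∀ j < n, t.rat 3 (i * n + j) =
      if s.rat 7 j = 0 then s.rat 8 (i * n + j) +
        lack (s.rat 5 i) (s.rat 6 i) * s.rat 8 (n * n + j) / s.rat 10 0
      else s.rat 8 (i * n + j) / s.rat 7 j := by
  have hβ := hs.one_le
  have hdiv : ∀ x y : ℚ, ratBits (x / y) ≤ ratBits x + ratBits y := fun x y => by
    rw [div_eq_mul_inv]
    exact (ratBits_mul_le _ _).trans (Nat.add_le_add_left (ratBits_inv_le _) _)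
  have h1 : ratBits 1 = 3 := by decide
  have h0 : ratBits 0 = 2 := by decide
  have hlack : ∀ i, ratBits (lack (s.rat 5 i) (s.rat 6 i)) ≤ 10 * β := by
    intro i
    unfold lack
    split_ifs
    · omega
    · rw [sub_eq_add_neg]
      refine (ratBits_add_le _ _).trans ?_
      rw [ratBits_neg, h1]
      have := hdiv (s.rat 5 i) (s.rat 6 i)
      have := hs.2 5 i
      have := hs.2 6 i
      omega
  refine .forN lim hn (fun i t => ∀ a < i, ∀ j < n, t.rat 3 (a * n + j) =
      if s.rat 7 j = 0 then s.rat 8 (a * n + j) +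
        lack (s.rat 5 a) (s.rat 6 a) * s.rat 8 (n * n + j) / s.rat 10 0
      else s.rat 8 (a * n + j) / s.rat 7 j) rfl (by norm_num) rfl (by simp) ?_ fun _ _ _ h => h
  intro i t hi hf hn' ti hI
  have e5 : t.rat 5 = s.rat 5 := hf.2 5 rfl
  have e6 : t.rat 6 = s.rat 6 := hf.2 6 rfl
  have e7 : t.rat 7 = s.rat 7 := hf.2 7 rfl
  have e8 : t.rat 8 = s.rat 8 := hf.2 8 rfl
  have e10 : t.rat 10 = s.rat 10 := hf.2 10 rfl
  have c1 : Reaches N γ (.cond (.ratLE (.get 6 vi) (.get 5 vi)) (.setRat 13 (.const 0) (.const 0))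
      (.setRat 13 (.const 0) (.sub (.const 1) (.div (.get 5 vi) (.get 6 vi))))) t
      fun u => u.rat 13 0 = lack (s.rat 5 i) (s.rat 6 i) := by
    have hl := hlack i
    refine .cond (fun hc => .setRat ?_ ?_) (fun hc => .setRat ?_ ?_) <;>
      simp only [Test.holds, QExp.eval, NExp.eval, ti, e5, e6, setRat_rat_self,
        Function.update_self] at hc ⊢
    · omega
    · rw [lack, if_pos hc]
    · rw [lack, if_neg hc] at hl; omega
    · rw [lack, if_neg hc]
  refine .seq_of c1 ?_
  intro u fu hu
  have ui : u.nat 10 0 = i := by rw [fu.1 10 rfl, ti]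
  have nu : u.nat 0 0 = n := by rw [fu.1 0 rfl, hn']
  have u3 : u.rat 3 = t.rat 3 := fu.2 3 rfl
  refine .forN lim nu (fun j v => (∀ a < i, ∀ j < n, v.rat 3 (a * n + j) = t.rat 3 (a * n + j)) ∧
    ∀ b < j, v.rat 3 (i * n + b) = if s.rat 7 b = 0 then s.rat 8 (i * n + b) +
        lack (s.rat 5 i) (s.rat 6 i) * s.rat 8 (n * n + b) / s.rat 10 0
      else s.rat 8 (i * n + b) / s.rat 7 b) rfl (by norm_num) rfl ?_ ?_ ?_
  · exact ⟨fun a _ j _ => by rw [setNat_rat, u3], by simp⟩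
  · rintro j v hj fv nv vj ⟨g1, g2⟩
    have vi' : v.nat 10 0 = i := by rw [fv.1 10 rfl, ui]
    have v7 : v.rat 7 = s.rat 7 := by rw [fv.2 7 rfl, fu.2 7 rfl, e7]
    have v8 : v.rat 8 = s.rat 8 := by rw [fv.2 8 rfl, fu.2 8 rfl, e8]
    have v10 : v.rat 10 = s.rat 10 := by rw [fv.2 10 rfl, fu.2 10 rfl, e10]
    have v13 : v.rat 13 0 = lack (s.rat 5 i) (s.rat 6 i) := by rw [fv.2 13 rfl, hu]
    have post : ∀ x : ℚ, (x = if s.rat 7 j = 0 then s.rat 8 (i * n + j) +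
        lack (s.rat 5 i) (s.rat 6 i) * s.rat 8 (n * n + j) / s.rat 10 0
        else s.rat 8 (i * n + j) / s.rat 7 j) →
        (∀ a < i, ∀ b < n, Function.update (v.rat 3) (i * n + j) x (a * n + b) =
          t.rat 3 (a * n + b)) ∧ ∀ b < j + 1, Function.update (v.rat 3) (i * n + j) x (i * n + b) =
          if s.rat 7 b = 0 then s.rat 8 (i * n + b) +
            lack (s.rat 5 i) (s.rat 6 i) * s.rat 8 (n * n + b) / s.rat 10 0
          else s.rat 8 (i * n + b) / s.rat 7 b := by
      intro x hx
      refine ⟨fun a ha b hb => ?_, fun b hb => ?_⟩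
      · rw [Function.update_of_ne, g1 a ha b hb]
        intro h
        have := (index_inj hb hj).mp h; omega
      · rcases Nat.lt_succ_iff_lt_or_eq.mp hb with h' | rfl
        · rw [Function.update_of_ne (by omega), g2 b h']
        · rw [Function.update_self, hx]
    have b8 := hs.2 8 (i * n + j)
    have b8' := hs.2 8 (n * n + j)
    have b7 := hs.2 7 j
    have b10 := hs.2 10 0
    have bl := hlack i
    refine .cond (fun hc => .setRat ?_ ?_) (fun hc => .setRat ?_ ?_) <;>
      simp only [Test.holds_ratEQ, QExp.eval, NExp.eval, vi', vj, nv, v7, v8, v10, v13, setNat_rat,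
        setRat_rat_self] at hc ⊢
    · refine (ratBits_add_le _ _).trans ?_
      have g3 := hdiv (lack (s.rat 5 i) (s.rat 6 i) * s.rat 8 (n * n + j)) (s.rat 10 0)
      have g4 := ratBits_mul_le (lack (s.rat 5 i) (s.rat 6 i)) (s.rat 8 (n * n + j))
      omega
    · exact post _ (by rw [if_pos hc])
    · have := hdiv (s.rat 8 (i * n + j)) (s.rat 7 j)
      omega
    · exact post _ (by rw [if_neg hc])
  · rintro v fv nv ⟨g1, g2⟩ a ha j hj
    rw [setNat_rat]
    rcases Nat.lt_succ_iff_lt_or_eq.mp ha with h' | rfl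
    · rw [g1 a h' j hj, hI a h' j hj]
    · exact g2 j hj

end

end ADHZ

namespace ADHZ

open Finset

section

variable {n N β γ D F Q k : ℕ} {s : State} {ε : ℚ} {L L' : ℕ → ℕ → Prop} {e : ℕ → ℕ → ℚ}
  {P : ℕ → ℕ → ℚ}

theorem Limits.mono (lim : Limits n N β D Q) (h : β ≤ γ) : Limits n N γ D Q :=
  ⟨lim.one_le, lim.loops, fun v hv => (lim.nat v hv).trans h, fun v hv => (lim.ids v hv).trans h,
    fun v h1 h2 h3 => (lim.rat v h1 h2 h3).trans h, lim.range⟩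

theorem PriceRun.congr (R : PriceRun n L ε e k P) (h : ∀ i < n, ∀ j < n, L i j ↔ L' i j) :
    PriceRun n L' ε e k P :=
  ⟨R.zero, fun m hm => by
    obtain ⟨q, y, H⟩ := R.cert m hm
    exact ⟨q, y, H.congr h (fun _ _ => rfl) fun _ _ => rfl⟩, R.mono⟩

theorem schemeProg_spec {G T : ℕ} (hG : G = 2 * ε.den * F * n.factorial) (hT : 2 * n / ε ≤ T)
    (hTN : T < N) (lim : Limits n N β (G ^ (T + 2)) Q) (hγ : 32 * β ≤ γ) (hs : Small β s)
    (hn : s.nat 0 0 = n) (hε : s.rat 0 0 = ε) (M : Endowed n ε (endowmentOf n s) F)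
    (hp : ∀ j < n, s.rat 4 j = 0)
    (hL : ∀ i < n, ∀ j < n, L i j ↔ ∀ k < n, s.rat 1 (i * n + k) ≤ s.rat 1 (i * n + j))
    (hex : ∀ i < n, ∃ j < n, L i j) :
    Reaches N γ schemeProg s fun t => ∃ m P q y, PriceRun n L ε (endowmentOf n s) (m + 1) P ∧
      m * (ε / 2) ≤ n ∧
      (∀ i < n, (1 - ε) * ∑ j ∈ range n, P (m + 1) j * endowmentOf n s i j ≤
        budgetFor n ε (endowmentOf n s) (P m) i) ∧
      EqCert n L (budgetFor n ε (endowmentOf n s) (P m)) (P (m + 1)) q y ∧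
      (∀ j < n, t.rat 4 j = P (m + 1) j) ∧
      ∀ i < n, ∀ j < n, t.rat 3 (i * n + j) = fillUp n y i j := by
  set e := endowmentOf n s with he
  have hβγ : β ≤ γ := by omega
  have limγ : Limits n N γ (G ^ (T + 2)) Q := lim.mono hβγ
  have first : Reaches N β (.seq likeProg (.seq roundsProg (.seq cheapestProg
      (.seq flowProg leftoverProg)))) s fun t => t.nat 0 0 = n ∧ ∃ m P q y,
      PriceRun n L ε e (m + 1) P ∧ m * (ε / 2) ≤ n ∧
      (∀ i < n, (1 - ε) * ∑ j ∈ range n, P (m + 1) j * e i j ≤ budgetFor n ε e (P m) i) ∧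
      EqCert n L (budgetFor n ε e (P m)) (P (m + 1)) q y ∧
      (∀ j < n, t.rat 4 j = P (m + 1) j) ∧
      ∀ i < n, ∀ j < n, fillUp n y i j = if t.rat 7 j = 0 then t.rat 8 (i * n + j) +
          lack (t.rat 5 i) (t.rat 6 i) * t.rat 8 (n * n + j) / t.rat 10 0
        else t.rat 8 (i * n + j) / t.rat 7 j := by
    refine .seq_of (likeProg_spec lim hn) ?_
    intro t1 f1 h1
    have n1 : t1.nat 0 0 = n := by rw [f1.1 0 rfl, hn]
    have hL1 : ∀ i < n, ∀ j < n, likeOf n t1 i j ↔ L i j := fun i hi j hj =>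
      (h1 i hi j hj).trans (hL i hi j hj).symm
    have hex1 : ∀ i < n, ∃ j < n, likeOf n t1 i j := fun i hi => by
      obtain ⟨j, hj, h⟩ := hex i hi
      exact ⟨j, hj, (hL1 i hi j hj).mpr h⟩
    have e1 : endowmentOf n t1 = e := by rw [he]; unfold endowmentOf; rw [f1.2 2 rfl]
    refine .seq_of (roundsProg_spec hG hT hTN lim M hex1 n1 rfl (by rw [f1.2 0 rfl, hε]) e1
      fun j hj => by rw [f1.2 4 rfl, hp j hj]) ?_
    rintro t2 f2 ⟨m, P, R⟩
    have n2 : t2.nat 0 0 = n := by rw [f2.1 0 rfl, n1]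
    have l2 : likeOf n t2 = likeOf n t1 := by unfold likeOf; rw [f2.1 1 rfl]
    refine .seq_of (cheapestProg_spec lim n2 (fun j hj => ?_) (by rw [l2]; exact hex1)) ?_
    · rw [(R.price j hj).1]; exact R.run.le M le_rfl hj
    intro t3 f3 h3
    rw [l2] at h3
    have n3 : t3.nat 0 0 = n := by rw [f3.1 0 rfl, n2]
    have l3 : likeOf n t3 = likeOf n t1 := by rw [← l2]; unfold likeOf; rw [f3.1 1 rfl]
    have p3 : ∀ j < n, t3.rat 7 j = P (m + 1) j := fun j hj => by
      rw [(h3 j hj).2.2.1, (R.price j hj).1]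
    have b3 : ∀ i < n, t3.rat 5 i = budgetFor n ε e (P m) i := fun i hi => by
      rw [f3.2 5 rfl, (R.budget i hi).1]
    have pfine : ∀ j < n, 0 ≤ P (m + 1) j ∧ P (m + 1) j ≤ n ∧ Fine (G ^ (T + 2)) (P (m + 1) j) :=
      fun j hj => ⟨R.run.nonneg le_rfl hj, R.run.le M le_rfl hj, by
        rw [← (R.price j hj).1]; exact (R.price j hj).2⟩
    have hbpos : ∀ i < n, 0 < budgetFor n ε e (P m) i := fun i hi =>
      M.budgetFor_pos (fun j hj => R.run.nonneg (by omega) hj) hi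
    have q3 : ∀ i < n, (∀ j < n, likeOf n t1 i j → t3.rat 6 i ≤ P (m + 1) j) ∧
        ∃ j < n, likeOf n t1 i j ∧ t3.rat 6 i = P (m + 1) j := by
      intro i hi
      obtain ⟨-, -, -, g1, j, hj, g2, g3⟩ := h3 i hi
      exact ⟨fun j hj h => by rw [← (R.price j hj).1]; exact g1 j hj h,
        j, hj, g2, by rw [g3, (R.price j hj).1]⟩
    have ready : FlowReady n (G ^ (T + 2)) t3 := by
      refine ⟨n3, fun i hi => ?_, fun i hi => ?_, fun j hj => ?_⟩
      · rw [f3.2 5 rfl]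
        exact ⟨by rw [(R.budget i hi).1]; exact hbpos i hi, (R.budget i hi).2⟩
      · obtain ⟨-, j, hj, -, h⟩ := q3 i hi
        rw [h]; exact pfine j hj
      · rw [p3 j hj]; exact pfine j hj
    refine .seq_of (flowProg_spec lim ready) ?_
    rintro t4 f4 ⟨H, hF, hst⟩
    have n4 : t4.nat 0 0 = n := by rw [f4.1 0 rfl, n3]
    obtain ⟨q₀, y₀, C₀⟩ := R.run.cert m (by omega)
    obtain ⟨-, C⟩ := H.eqCert_of_eqCert (L := likeOf n t1) (b := budgetFor n ε e (P m))
      (p := P (m + 1)) (q := t3.rat 6) hst hbpos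
      (fun i hi j hj => by
        unfold edgeOf
        rw [(h3 i hi).1, (h3 j hj).2.1, p3 j hj, ← l3, likeOf]
        exact ⟨fun h => ⟨h.1, h.2.2.symm⟩, fun h => ⟨h.1, rfl, h.2.symm⟩⟩)
      (fun i hi => by rw [demOf, if_pos hi, b3 i hi])
      (fun j hj => by rw [capOf, p3 j hj]) (fun i hi => (q3 i hi).1) (fun i hi => (q3 i hi).2) C₀
    have f8 : ∀ j < n, 0 ≤ t4.rat 8 (n * n + j) := fun j hj => H.nonneg n le_rfl j hj
    have hQ : ∑ j ∈ range n, t4.rat 8 (n * n + j) ≤ Q := by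
      have := ready.demOf_le lim n le_rfl
      rw [demOf, if_neg (lt_irrefl n)] at this
      exact (sum_le_sum fun j hj => H.f_le le_rfl (by simpa using hj)).trans this
    refine (leftoverProg_spec lim n4 hF f8 hQ).frame.mono ?_
    rintro t5 ⟨f5, h5⟩
    refine ⟨by rw [f5.1 0 rfl, n4], m, P, t3.rat 6,
      fun i j => (flowOf n t4).f i j / cap (P (m + 1) j), R.run.congr hL1, R.short, R.enough,
      C.congr hL1 (fun _ _ => rfl) fun _ _ => rfl, fun j hj => ?_, fun i hi j hj => ?_⟩
    · rw [f5.2 4 rfl, f4.2 4 rfl, f3.2 4 rfl, (R.price j hj).1]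
    · rw [H.fillUp_eq (fun j hj => by rw [capOf, p3 j hj]) C hbpos hi hj, h5, f5.2 7 rfl, f5.2 8 rfl,
        f5.2 5 rfl, f5.2 6 rfl, f4.2 7 rfl, f4.2 5 rfl, f4.2 6 rfl, p3 j hj, b3 i hi]
      rfl
  refine .seq ((first.weaken hs hβγ).mono ?_)
  rintro t ⟨ht, nt, m, P, q, y, R, h1, h2, C, h3, h4⟩
  refine (outputProg_spec limγ hγ ht nt).frame.mono ?_
  rintro t' ⟨f', h'⟩
  exact ⟨m, P, q, y, R, h1, h2, C, fun j hj => by rw [f'.2 4 rfl, h3 j hj],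
    fun i hi j hj => by rw [h' i hi j hj, h4 i hi j hj]⟩

end

/-! ### Resources -/

theorem size_le (k : ℕ) : Nat.size k ≤ k := Nat.size_le.mpr Nat.lt_two_pow_self

theorem size_pow_le (a k : ℕ) : Nat.size (a ^ k) ≤ k * Nat.size a + 1 := by
  induction k with
  | zero => simp
  | succ k ih =>
    rw [pow_succ, add_mul]
    have := size_mul_le (a ^ k) a
    omega

theorem size_prod_le {ι : Type*} (t : Finset ι) (f : ι → ℕ) :
    Nat.size (∏ i ∈ t, f i) ≤ ∑ i ∈ t, Nat.size (f i) + 1 := by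
  classical
  induction t using Finset.induction_on with
  | empty => simp
  | insert a t ha ih =>
    rw [prod_insert ha, sum_insert ha]
    have := size_mul_le (f a) (∏ i ∈ t, f i)
    omega

theorem size_factorial_le (n : ℕ) : Nat.size n.factorial ≤ n ^ 2 + 1 := by
  induction n with
  | zero => simp
  | succ n ih =>
    rw [Nat.factorial_succ]
    have := size_mul_le (n + 1) n.factorial
    have := size_le (n + 1)
    nlinarith

/-- The length of a multiple of `1 / D` in a bounded range. -/
theorem Fine.ratBits_le {D Q : ℕ} {v : ℚ} (hF : Fine D v) (hD : D ≠ 0) (h0 : 0 ≤ v) (hQ : v ≤ Q) :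
    ratBits v ≤ Nat.size Q + 2 * Nat.size D + 1 := by
  obtain ⟨z, hz⟩ := hF
  have hD' : (0 : ℚ) < D := by exact_mod_cast Nat.pos_of_ne_zero hD
  have hv : v = (z : ℚ) / D := by rw [← hz, mul_div_cancel_right₀ _ hD'.ne']
  have hz0 : (0 : ℚ) ≤ z := by rw [← hz]; positivity
  have hz0' : 0 ≤ z := by exact_mod_cast hz0
  have hzQ : (z : ℚ) ≤ ((Q * D : ℕ) : ℚ) := by
    rw [← hz]; push_cast; exact mul_le_mul_of_nonneg_right hQ hD'.le
  have hzQ' : z.natAbs ≤ Q * D := by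
    have : z ≤ ((Q * D : ℕ) : ℤ) := by exact_mod_cast hzQ
    omega
  have h1 := ratBits_le_of_eq_div hD hv
  have h2 := Nat.size_le_size hzQ'
  have h3 := size_mul_le Q D
  omega

namespace Market

variable {n : ℕ} (M : Market n) {ε : ℚ}

theorem rowMajor_eq (m : Fin n → Fin n → ℚ) {i j : ℕ} (hi : i < n) (hj : j < n) :
    rowMajor m (i * n + j) = m ⟨i, hi⟩ ⟨j, hj⟩ := by
  have hn : 0 < n := by omega
  have h1 : i * n + j < n * n := by nlinarith
  have h2 : (i * n + j) / n = i := by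
    rw [mul_comm, Nat.mul_add_div hn, Nat.div_eq_of_lt hj, add_zero]
  have h3 : (i * n + j) % n = j := by
    rw [mul_comm, Nat.mul_add_mod, Nat.mod_eq_of_lt hj]
  unfold rowMajor
  rw [dif_pos h1]
  congr 1 <;> ext <;> simp [Fin.divNat, Fin.modNat, h2, h3]

/-- A common denominator of the endowments. -/
def denom : ℕ := ∏ i, ∏ j, (M.e i j).den

theorem endowmentOf_eq {i j : ℕ} (hi : i < n) (hj : j < n) :
    endowmentOf n (M.initialState ε) i j = M.e ⟨i, hi⟩ ⟨j, hj⟩ := by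
  simp only [endowmentOf, initialState]
  simp [rowMajor_eq M.e hi hj]

theorem endowed (h0 : 0 < ε) (h1 : ε < 1) :
    Endowed n ε (endowmentOf n (M.initialState ε)) M.denom := by
  refine ⟨h0, h1, fun i hi j hj => ?_, fun i hi => ?_, fun j hj => ?_, fun i hi j hj => ?_⟩
  · rw [M.endowmentOf_eq hi hj]; exact M.e_nonneg _ _
  · rw [sum_range, ← M.e_row ⟨i, hi⟩]
    exact sum_congr rfl fun j _ => M.endowmentOf_eq hi j.2
  · rw [sum_range, ← M.e_col ⟨j, hj⟩]
    exact sum_congr rfl fun i _ => M.endowmentOf_eq i.2 hj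
  · rw [M.endowmentOf_eq hi hj]
    exact (Fine.self _).of_dvd ((dvd_prod_of_mem (fun j => (M.e ⟨i, hi⟩ j).den) (mem_univ _)).trans
      (dvd_prod_of_mem (fun i => ∏ j, (M.e i j).den) (mem_univ _)))

theorem ratBits_le_inputBits (i j : Fin n) :
    ratBits (M.u i j) + ratBits (M.e i j) ≤ M.inputBits ε := by
  unfold inputBits
  have h1 := single_le_sum (f := fun j => ratBits (M.u i j) + ratBits (M.e i j))
    (fun _ _ => Nat.zero_le _) (mem_univ j)
  have h2 := single_le_sum (f := fun i => ∑ j, (ratBits (M.u i j) + ratBits (M.e i j)))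
    (fun _ _ => Nat.zero_le _) (mem_univ i)
  omega

theorem size_denom_le : Nat.size M.denom ≤ M.inputBits ε + n + 1 := by
  refine (size_prod_le _ _).trans ?_
  have : ∑ i, Nat.size (∏ j, (M.e i j).den) ≤
      ∑ i, (∑ j, (ratBits (M.u i j) + ratBits (M.e i j)) + 1) := by
    refine sum_le_sum fun i _ => (size_prod_le _ _).trans (Nat.add_le_add_right
      (sum_le_sum fun j _ => ?_) 1)
    unfold ratBits; omega
  rw [sum_add_distrib] at this
  simp only [sum_const, card_univ, Fintype.card_fin, smul_eq_mul, mul_one] at this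
  unfold inputBits
  omega

theorem small_initialState {β : ℕ} (h : M.inputBits ε + 2 ≤ β) : Small β (M.initialState ε) := by
  have z : ratBits 0 = 2 := by decide
  have row : ∀ (m : Fin n → Fin n → ℚ) k, (∀ i j, ratBits (m i j) ≤ β) →
      ratBits (rowMajor m k) ≤ β := by
    intro m k hm
    unfold rowMajor
    split_ifs
    · exact hm _ _
    · omega
  have hb : natBits n + ratBits ε ≤ M.inputBits ε := by unfold inputBits; omega
  refine ⟨fun a k => ?_, fun a k => ?_⟩ <;> simp only [initialState]
  · split_ifs
    · omega
    · simp only [natBits, Nat.size_zero]; omega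
  · split_ifs
    · omega
    · exact row _ _ fun i j => by have := M.ratBits_le_inputBits (ε := ε) i j; omega
    · exact row _ _ fun i j => by have := M.ratBits_le_inputBits (ε := ε) i j; omega
    · omega

/-- The number of rounds is at most this. -/
def roundBound (n : ℕ) (ε : ℚ) : ℕ := ⌈2 * n / ε⌉₊

/-- Each loop makes at most this number of iterations each time it is entered. -/
def loopBound (n : ℕ) (ε : ℚ) : ℕ := (n + 3) ^ 5 + roundBound n ε + 1

/-- A bound on the encoding length of the numbers in the memory before the output is written. -/
def lengthBound (ε : ℚ) : ℕ := (n + 3) ^ 5 + n ^ 2 + 10 + M.inputBits ε + n * (n + 1) +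
  2 * ((roundBound n ε + 2) * (2 * M.inputBits ε + n + n ^ 2 + 5) + 1)

theorem limits (hn : 1 ≤ n) : Limits n (loopBound n ε) (M.lengthBound ε)
    ((2 * ε.den * M.denom * n.factorial) ^ (roundBound n ε + 2)) (n * (n + 1)) := by
  set G := 2 * ε.den * M.denom * n.factorial
  have hG : G ≠ 0 := by
    refine Nat.mul_ne_zero (Nat.mul_ne_zero (Nat.mul_ne_zero (by norm_num) ε.den_nz) ?_)
      n.factorial_ne_zero
    exact prod_ne_zero_iff.mpr fun i _ => prod_ne_zero_iff.mpr fun j _ => (M.e i j).den_nz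
  have hsG : Nat.size G ≤ 2 * M.inputBits ε + n + n ^ 2 + 5 := by
    have h1 : Nat.size G ≤ _ := size_mul_le (2 * ε.den * M.denom) n.factorial
    have h2 := size_mul_le (2 * ε.den) M.denom
    have h3 := size_mul_le 2 ε.den
    have h4 := M.size_denom_le (ε := ε)
    have h5 := size_factorial_le n
    have h6 := size_le 2
    have h7 : Nat.size ε.den + 1 ≤ M.inputBits ε := by unfold inputBits ratBits; omega
    omega
  refine ⟨hn, by unfold loopBound; omega, fun v hv => ?_, fun v hv => ?_, fun v hF h0 hQ => ?_,
    le_rfl⟩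
  · have := size_le v
    unfold natBits lengthBound; omega
  · have : Nat.size v ≤ n ^ 2 + 4 := Nat.size_le.mpr (by
      have : 2 ^ (n ^ 2 + 4) = 2 * 2 ^ (n ^ 2 + 3) := by rw [pow_succ]; ring
      have := Nat.one_le_two_pow (n := n ^ 2 + 3)
      omega)
    unfold natBits lengthBound; omega
  · have h1 := hF.ratBits_le (pow_ne_zero _ hG) h0 hQ
    have h2 := size_pow_le G (roundBound n ε + 2)
    have h3 := Nat.mul_le_mul_left (roundBound n ε + 2) hsG
    have h4 := size_le (n * (n + 1))
    unfold lengthBound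
    omega

theorem roundBound_le (h0 : 0 < ε) :
    (roundBound n ε : ℝ) ≤ 2 * ((n : ℝ) + 1 / (ε : ℝ)) ^ 2 + 1 := by
  have h0' : (0 : ℝ) < ε := by exact_mod_cast h0
  have h1 : (roundBound n ε : ℝ) < 2 * n / ε + 1 := by
    have := Nat.ceil_lt_add_one (a := 2 * (n : ℚ) / ε) (by positivity)
    have h : ((roundBound n ε : ℕ) : ℚ) < 2 * n / ε + 1 := this
    exact_mod_cast h
  have h2 : 2 * (n : ℝ) / ε = 2 * (n * (1 / (ε : ℝ))) := by ring
  have h3 : (0 : ℝ) ≤ n := Nat.cast_nonneg n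
  have h4 : (0 : ℝ) < 1 / (ε : ℝ) := by positivity
  nlinarith

theorem loopBound_le (hn : 1 ≤ n) (h0 : 0 < ε) :
    (loopBound n ε + 1 : ℝ) ≤ 2000 * ((n : ℝ) + 1 / (ε : ℝ)) ^ 5 := by
  have h1 := roundBound_le (n := n) h0
  have h0' : (0 : ℝ) < 1 / (ε : ℝ) := by
    have : (0 : ℝ) < ε := by exact_mod_cast h0
    positivity
  have hn' : (1 : ℝ) ≤ n := by exact_mod_cast hn
  set X := (n : ℝ) + 1 / (ε : ℝ)
  have hX : 1 ≤ X := by linarith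
  have h2 : ((n : ℝ) + 3) ^ 5 ≤ (4 * X) ^ 5 := by gcongr; linarith
  have h3 : X ^ 2 ≤ X ^ 5 := pow_le_pow_right₀ hX (by norm_num)
  have h4 : 1 ≤ X ^ 5 := one_le_pow₀ hX
  unfold loopBound
  push_cast
  rw [mul_pow] at h2
  linarith

theorem lengthBound_le (hn : 1 ≤ n) (h0 : 0 < ε) :
    (M.lengthBound ε : ℝ) ≤ 2000 * ((n : ℝ) + 1 / (ε : ℝ) + M.inputBits ε) ^ 5 := by
  have h1 := roundBound_le (n := n) h0
  have h0' : (0 : ℝ) < 1 / (ε : ℝ) := by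
    have : (0 : ℝ) < ε := by exact_mod_cast h0
    positivity
  have hn' : (1 : ℝ) ≤ n := by exact_mod_cast hn
  have hB : (0 : ℝ) ≤ M.inputBits ε := Nat.cast_nonneg _
  set X := (n : ℝ) + 1 / (ε : ℝ)
  set Y := X + M.inputBits ε
  have hXY : X ≤ Y := by linarith
  have hnY : (n : ℝ) ≤ Y := by linarith
  have hBY : (M.inputBits ε : ℝ) ≤ Y := by linarith
  have hY : 1 ≤ Y := by linarith
  have p (k : ℕ) (hk : k ≤ 5) : Y ^ k ≤ Y ^ 5 := pow_le_pow_right₀ hY hk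
  have h2 : ((n : ℝ) + 3) ^ 5 ≤ (4 * Y) ^ 5 := by gcongr; linarith
  have h3 : (n : ℝ) ^ 2 ≤ Y ^ 2 := by gcongr
  have h4 : (n : ℝ) * (n + 1) ≤ Y * (Y + 1) := by gcongr
  have h5 : (roundBound n ε : ℝ) ≤ 2 * Y ^ 2 + 1 := h1.trans (by gcongr)
  have h6 : ((roundBound n ε : ℝ) + 2) * (2 * M.inputBits ε + n + n ^ 2 + 5) ≤
      (2 * Y ^ 2 + 1 + 2) * (2 * Y + Y + Y ^ 2 + 5) := by gcongr
  have e6 : (2 * Y ^ 2 + 1 + 2) * (2 * Y + Y + Y ^ 2 + 5) =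
      2 * Y ^ 4 + 6 * Y ^ 3 + 13 * Y ^ 2 + 9 * Y + 15 := by ring
  have q1 := p 1 (by norm_num)
  have q2 := p 2 (by norm_num)
  have q3 := p 3 (by norm_num)
  have q4 := p 4 (by norm_num)
  have q0 : 1 ≤ Y ^ 5 := one_le_pow₀ hY
  rw [pow_one] at q1
  rw [mul_pow] at h2
  rw [e6] at h6
  unfold lengthBound
  push_cast
  linarith [mul_add Y Y 1, sq Y]

end Market

/-! ### From certificates to approximate equilibria -/

namespace Market

variable {n : ℕ} {M : Market n} {ε : ℚ} {k m : ℕ} {P : ℕ → ℕ → ℚ} {q : ℕ → ℚ} {y : ℕ → ℕ → ℚ}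

theorem cast_worth (i : Fin n) (p : ℕ → ℚ) :
    ((∑ j ∈ range n, p j * endowmentOf n (M.initialState ε) i j : ℚ) : ℝ) =
      ∑ j : Fin n, (p j : ℝ) * M.endowment i j := by
  rw [sum_range]
  push_cast
  exact sum_congr rfl fun j _ => by rw [M.endowmentOf_eq i.2 j.2]; rfl

theorem roundBudget_eq
    (R : PriceRun n M.Likes ε (endowmentOf n (M.initialState ε)) k P) (m : ℕ) :
    roundBudget (ε : ℝ) M.endowment (fun m (j : Fin n) => ((P (m + 1) j : ℚ) : ℝ)) m =
      fun i : Fin n => ((budgetFor n ε (endowmentOf n (M.initialState ε)) (P m) i : ℚ) : ℝ) := by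
  funext i
  cases m with
  | zero =>
    rw [budgetFor, sum_eq_zero fun j hj => by rw [R.zero j (by simpa using hj), zero_mul]]
    simp [roundBudget]
  | succ m =>
    rw [budgetFor, Rat.cast_add, Rat.cast_mul, cast_worth]
    simp [roundBudget]

theorem exists_run (hM : M.IsBivalued) (h0 : 0 < ε) (h1 : ε < 1)
    (R : PriceRun n M.Likes ε (endowmentOf n (M.initialState ε)) (m + 1) P)
    (henough : ∀ i < n, (1 - ε) * ∑ j ∈ range n,
      P (m + 1) j * endowmentOf n (M.initialState ε) i j ≤
        budgetFor n ε (endowmentOf n (M.initialState ε)) (P m) i)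
    (C : EqCert n M.Likes (budgetFor n ε (endowmentOf n (M.initialState ε)) (P m)) (P (m + 1)) q y)
    {p : ℕ → Fin n → ℝ} (hp : p = fun m (j : Fin n) => ((P (m + 1) j : ℚ) : ℝ)) :
    ∃ x : ℕ → Fin n → Fin n → ℝ, IsPriceRaisingRun (ε : ℝ) M.utility M.endowment m x p ∧
      (x m = fun i j : Fin n => ((fillUp n y i j : ℚ) : ℝ)) ∧
      IsApproxEquilibriumWith (ε : ℝ) M.utility M.endowment
        (roundBudget (ε : ℝ) M.endowment p m) (x m) (p m) := by
  subst hp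
  set e := endowmentOf n (M.initialState ε) with he
  have E := M.endowed h0 h1
  have hpos : ∀ k ≤ m, ∀ i < n, 0 < budgetFor n ε e (P k) i := fun k hk i hi =>
    E.budgetFor_pos (fun j hj => R.nonneg (by omega) hj) hi
  have hz : ∀ k, ∃ z : ℕ → ℕ → ℚ, k ≤ m → ∃ q', EqCert n M.Likes (budgetFor n ε e (P k)) (P (k + 1)) q' z := by
    intro k
    by_cases hk : k ≤ m
    · obtain ⟨q', z, H⟩ := R.cert k (by omega)
      exact ⟨z, fun _ => ⟨q', H⟩⟩
    · exact ⟨fun _ _ => 0, fun h => absurd h hk⟩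
  choose z hz using hz
  set x : ℕ → Fin n → Fin n → ℝ := fun k i j => ((fillUp n (if k = m then y else z k) i j : ℚ) : ℝ)
    with hx
  have hxm : x m = fun i j : Fin n => ((fillUp n y i j : ℚ) : ℝ) := by simp [hx]
  have hHZ : ∀ k ≤ m, IsHZEquilibrium M.utility (roundBudget (ε : ℝ) M.endowment
      (fun m (j : Fin n) => ((P (m + 1) j : ℚ) : ℝ)) k) (x k) (fun j : Fin n => ((P (k + 1) j : ℚ) : ℝ)) := by
    intro k hk
    rw [roundBudget_eq R]
    by_cases hkm : k = m
    · subst hkm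
      rw [hxm]
      exact C.isHZEquilibrium hM (hpos k hk)
    · obtain ⟨q', H⟩ := hz k hk
      have : x k = fun i j : Fin n => ((fillUp n (z k) i j : ℚ) : ℝ) := by simp [hx, hkm]
      rw [this]
      exact H.isHZEquilibrium hM (hpos k hk)
  refine ⟨x, ⟨hHZ, fun k hk j => ?_⟩, hxm, hHZ m le_rfl, fun i => ?_, fun i => ?_, fun i i' h => ?_⟩
  · exact Rat.cast_le.mpr (R.mono (k + 1) (by omega) j j.2)
  · have := henough i i.2
    rw [roundBudget_eq R]
    dsimp only
    rw [← cast_worth (ε := ε)]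
    exact_mod_cast this
  · have h2 : ∑ j ∈ range n, P m j * e i j ≤ ∑ j ∈ range n, P (m + 1) j * e i j :=
      sum_le_sum fun j hj => mul_le_mul_of_nonneg_right (R.mono m (by omega) j (by simpa using hj))
        (E.nonneg i i.2 j (by simpa using hj))
    have h3 := E.worth_nonneg (p := P m) (fun j hj => R.nonneg (by omega) hj) i.2
    have h4 : budgetFor n ε e (P m) i ≤ ε + ∑ j ∈ range n, P (m + 1) j * e i j := by
      unfold budgetFor
      nlinarith
    rw [roundBudget_eq R]
    dsimp only
    rw [← cast_worth (ε := ε)]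
    exact_mod_cast h4
  · -- the budgets depend on the agents through their endowments only
    cases m <;> simp only [roundBudget, h]

theorem likes_iff {i j : ℕ} (hi : i < n) (hj : j < n) : M.Likes i j ↔
    ∀ k < n, (M.initialState ε).rat 1 (i * n + k) ≤ (M.initialState ε).rat 1 (i * n + j) := by
  have hu : ∀ k (hk : k < n), (M.initialState ε).rat 1 (i * n + k) = M.u ⟨i, hi⟩ ⟨k, hk⟩ :=
    fun k hk => by
      simp only [initialState]
      simp [rowMajor_eq M.u hi hk]
  constructor
  · rintro ⟨_, _, h⟩ k hk
    rw [hu k hk, hu j hj]; exact h _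
  · intro h
    refine ⟨hi, hj, fun k => ?_⟩
    have := h k k.2
    rw [hu k k.2, hu j hj] at this
    exact this

/-- Correctness of the program, with bounds on its costs. -/
theorem schemeProg_correct (M : Market n) (hM : M.IsBivalued) (hn : 1 ≤ n) (h0 : 0 < ε) (h1 : ε < 1) :
    ∃ s t w, Exec schemeProg (M.initialState ε) s t w ∧ t ≤ schemeProg.cost (loopBound n ε) ∧
      w ≤ t * (schemeProg.weight * (32 * M.lengthBound ε)) ∧
      ∃ (K : ℕ) (x : ℕ → Fin n → Fin n → ℝ) (p : ℕ → Fin n → ℝ),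
        IsPriceRaisingRun (ε : ℝ) M.utility M.endowment K x p ∧ K * (ε / 2) ≤ n ∧
        x K = outputAllocation n s ∧ p K = outputPrices n s ∧
        IsApproxEquilibriumWith (ε : ℝ) M.utility M.endowment
          (roundBudget (ε : ℝ) M.endowment p K) (x K) (p K) := by
  have hs : Small (M.lengthBound ε) (M.initialState ε) :=
    M.small_initialState (by unfold lengthBound; omega)
  have spec := schemeProg_spec (s := M.initialState ε) (L := M.Likes) (T := roundBound n ε) rfl
    (Nat.le_ceil _) (by unfold loopBound; omega) (M.limits (ε := ε) hn) le_rfl hs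
    (by simp [initialState]) (by simp [initialState]) (M.endowed h0 h1)
    (fun j _ => by simp [initialState]) (fun i hi j hj => likes_iff hi hj)
    (fun i hi => exists_likes M hi)
  obtain ⟨s, t, w, hexec, ht, hw, -, m, P, q, y, R, hm, henough, C, hprice, halloc⟩ :=
    spec (hs.mono (by omega))
  refine ⟨s, t, w, hexec, ht, hw, ?_⟩
  obtain ⟨x, hrun, hx, happ⟩ := exists_run hM h0 h1 R henough C rfl
  refine ⟨m, x, _, hrun, hm, ?_, ?_, happ⟩
  · rw [hx]
    funext i j
    rw [outputAllocation, halloc i i.2 j j.2]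
  · funext j
    rw [outputPrices, hprice j j.2]

end Market

end ADHZ

open ADHZ in
theorem mainTheorem2 :
    ∃ (P : ADHZ.Program) (C d : ℕ),
      ∀ (n : ℕ) (_ : 1 ≤ n) (M : ADHZ.Market n) (_ : M.IsBivalued)
        (ε : ℚ) (_ : 0 < ε) (_ : ε < 1),
        ∃ (s : ADHZ.State) (t w : ℕ),
          -- the program halts
          ADHZ.Exec P (M.initialState ε) s t w ∧
          -- after polynomially many (in `n` and `1 / ε` alone) elementary operations
          (t : ℝ) ≤ C * ((n : ℝ) + 1 / (ε : ℝ)) ^ d ∧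
          -- and with bit complexity polynomial in `1 / ε` and the input length
          (w : ℝ) ≤ C * ((n : ℝ) + 1 / (ε : ℝ) + M.inputBits ε) ^ d ∧
          -- its output is an approximate equilibrium
          ADHZ.IsApproxEquilibrium (ε : ℝ) M.utility M.endowment
            (ADHZ.outputAllocation n s) (ADHZ.outputPrices n s) ∧
          -- which is the last round of a short price-raising run
          ∃ (K : ℕ) (x : ℕ → Fin n → Fin n → ℝ) (p : ℕ → Fin n → ℝ),
            ADHZ.IsPriceRaisingRun (ε : ℝ) M.utility M.endowment K x p ∧
            (K : ℝ) ≤ C * ((n : ℝ) / (ε : ℝ)) * (1 + Real.log ((n : ℝ) / (ε : ℝ))) ∧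
            x K = ADHZ.outputAllocation n s ∧ p K = ADHZ.outputPrices n s ∧
            ADHZ.IsApproxEquilibriumWith (ε : ℝ) M.utility M.endowment
              (ADHZ.roundBudget (ε : ℝ) M.endowment p K) (x K) (p K) := by
  obtain ⟨C₀, d₀, hcost⟩ := schemeProg.exists_cost_le
  obtain ⟨W, hWdef⟩ : ∃ W, W = schemeProg.weight := ⟨_, rfl⟩
  -- `2000` comes from `loopBound_le` and `lengthBound_le`, and `64000 = 32 * 2000`, where the factor
  -- `32` stems from the program that writes the output
  refine ⟨schemeProg, C₀ * 2000 ^ d₀ * (1 + W * 64000) + 2, 5 * d₀ + 5, ?_⟩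
  intro n hn M hM ε h0 h1
  obtain ⟨s, t, w, hexec, ht, hw, K, x, p, hrun, hK, hx, hp, happ⟩ :=
    M.schemeProg_correct hM hn h0 h1
  rw [← hWdef] at hw
  have h0' : (0 : ℝ) < ε := by exact_mod_cast h0
  have h1' : (ε : ℝ) < 1 := by exact_mod_cast h1
  have hn' : (1 : ℝ) ≤ n := by exact_mod_cast hn
  have hinv : (0 : ℝ) < 1 / (ε : ℝ) := by positivity
  have hX : 1 ≤ (n : ℝ) + 1 / (ε : ℝ) := by linarith
  have hB : (0 : ℝ) ≤ M.inputBits ε := Nat.cast_nonneg _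
  have hloop := Market.loopBound_le (ε := ε) hn h0
  have hlen := M.lengthBound_le (ε := ε) hn h0
  set X := (n : ℝ) + 1 / (ε : ℝ)
  have hXY : X ≤ X + M.inputBits ε := by linarith
  set Y := X + M.inputBits ε
  have hY : 1 ≤ Y := hX.trans hXY
  set A : ℝ := C₀ * 2000 ^ d₀
  have hA : 0 ≤ A := by positivity
  have hW : (0 : ℝ) ≤ W := Nat.cast_nonneg _
  have htX : (t : ℝ) ≤ A * X ^ (5 * d₀) := by
    calc (t : ℝ) ≤ (C₀ : ℝ) * (Market.loopBound n ε + 1) ^ d₀ := by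
          exact_mod_cast ht.trans (hcost _)
      _ ≤ C₀ * (2000 * X ^ 5) ^ d₀ := by gcongr
      _ = A * X ^ (5 * d₀) := by rw [mul_pow, ← pow_mul]; ring
  have hC : ((C₀ * 2000 ^ d₀ * (1 + W * 64000) + 2 : ℕ) : ℝ) = A * (1 + W * 64000) + 2 := by
    push_cast; rfl
  have hAC : A ≤ A * (1 + W * 64000) + 2 := by
    have : 0 ≤ A * (W * 64000) := by positivity
    linarith
  have hAC' : A * (W * 64000) ≤ A * (1 + W * 64000) + 2 := by linarith
  refine ⟨s, t, w, hexec, ?_, ?_, ?_, K, x, p, hrun, ?_, hx, hp, happ⟩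
  · rw [hC]
    calc (t : ℝ) ≤ A * X ^ (5 * d₀) := htX
      _ ≤ A * X ^ (5 * d₀ + 5) := by gcongr; omega
      _ ≤ _ := by gcongr
  · rw [hC]
    calc (w : ℝ) ≤ t * (W * (32 * M.lengthBound ε)) := by exact_mod_cast hw
      _ ≤ (A * Y ^ (5 * d₀)) * (W * (32 * (2000 * Y ^ 5))) := by
          gcongr
          exact htX.trans (by gcongr)
      _ = A * (W * 64000) * Y ^ (5 * d₀ + 5) := by rw [pow_add]; ring
      _ ≤ _ := by gcongr
  · exact ⟨_, hx ▸ hp ▸ happ⟩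
  · have hK' : (K : ℝ) * (ε / 2) ≤ n := by exact_mod_cast hK
    have hnε : 1 ≤ (n : ℝ) / ε := by rw [le_div_iff₀ h0']; linarith
    have hlog : 0 ≤ Real.log ((n : ℝ) / ε) := Real.log_nonneg hnε
    rw [hC]
    have h2 : (K : ℝ) ≤ 2 * (n / ε) := by
      rw [mul_div_assoc', le_div_iff₀ h0']; linarith
    have h3 : 0 ≤ A * (1 + W * 64000) := by positivity
    calc (K : ℝ) ≤ 2 * (n / ε) := h2
      _ ≤ (A * (1 + W * 64000) + 2) * (n / ε) := by gcongr; linarith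
      _ ≤ _ := le_mul_of_one_le_right (by positivity) (by linarith)
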